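/- **Setting.** Observe $Y_{i,s}=m_s(i/n_s)+e_{i,s}$, $i=1,\dots,n_s$, $s=1,2$, with $e_{i,s}=G_s(i/n_s,\mathcal F_{i,s})$, where $\boldsymbol\epsilon_i=(\varepsilon_{i,1},\varepsilon_{i,2})^\top$, $i\in\mathbb Z$, are i.i.d. random vectors, $\mathcal F_{i,s}=(\dots,\varepsilon_{i-1,s},\varepsilon_{i,s})$, and $G_1,G_2:[0,1]\times\mathbb R^\infty\to\mathbb R$ are measurable. Put $\mathbf G(t,\boldsymbol{\mathcal F}_i)=(G_1(t,\mathcal F_{i,1}),G_2(t,\mathcal F_{i,2}))^\top$ and $\|\mathbf v\|_4=(\mathbb E|\mathbf v|^4)^{1/4}$ with the Euclidean norm $|\cdot|$. **Errors.** $\mathbb E\,\mathbf G(t,\boldsymbol{\mathcal F}_0)=0$ for $t\in[0,1]$; $\sup_{t\in[0,1]}\|\mathbf G(t,\boldsymbol{\mathcal F}_0)\|_4<\infty$; $\sup_{0\le t<s\le1}\|\mathbf G(t,\boldsymbol{\mathcal F}_0)-\mathbf G(s,\boldsymbol{\mathcal F}_0)\|_4<\infty$; for some $\rho\in(0,1)$,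 $\sup_{t\in[0,1]}\|\mathbf G(t,\boldsymbol{\mathcal F}_k)-\mathbf G(t,\boldsymbol{\mathcal F}^*_k)\|_4=O(\rho^k)$, $k\ge0$, where $\boldsymbol{\mathcal F}^*_k$ is $\boldsymbol{\mathcal F}_k$ with $\boldsymbol\epsilon_0$ replaced by an independent copy $\boldsymbol\epsilon_0^*$; the matrix $\Sigma^2(t)=\sum_{k=0}^\infty\mathbb E[\mathbf G(t,\boldsymbol{\mathcal F}_0)\mathbf G(t,\boldsymbol{\mathcal F}_k)^\top]$ is diagonal for every $t\in[0,1]$, and for some $\nu_0>0$ the matrix $\Sigma^2(t)-\nu_0I_2$ is positive definite for every $t\in[0,1]$. **Regression functions.** $m_1,m_2$ are twice continuously differentiable on $[0,1]$ with Lipschitz continuous second derivative, and $m_1',m_2'$ are strictly increasing on $[0,1]$. Put $\tilde c_0=(m_2')^{-1}(m_1'(0))$ and $$c=\frac1{1-\tilde c_0}\int_0^{1-\tilde c_0}\big((m_2')^{-1}(m_1'(u))-u\big)\,du .$$ Assume that this is well defined and positive, namely $m_1'(0)\in m_2'([0,1))$, $m_1'(1-\tilde c_0)\in m_2'([0,1])$,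 $c>0$ and $m_1'(1-c)\in m_2'([0,1])$, and that $(m_1')^{-1},(m_2')^{-1}$ are differentiable on $(m_1'(0),m_1'(1-c))$. On this interval let $g=((m_1')^{-1})'-((m_2')^{-1})'$. **Kernels.** $K$ is even, vanishes outside $[-1,1]$, is twice differentiable on $[-1,1]$, $\int_{-1}^1K=1$ and $\int_{-1}^1x^2K(x)\,dx>0$. $K_d$ is an even probability density that vanishes outside $[-1,1]$ and is continuous on $[-1,1]$. **Bandwidths.** $b_{n,s},h_{d,s}>0$ and $N\in\{1,2,\dots\}$ may depend on $(n_1,n_2)$. With $n=n_s$, let $\pi'_{n,s}=\frac{n^{1/4}\log^2n}{nb_{n,s}^2}+b_{n,s}^2$, $\pi_{n,s}=\frac{\log n}{\sqrt{nb_{n,s}}\,b_{n,s}}+\pi_{n,s}'$, $\bar\omega_{n,s}=\frac{\log n}{\sqrt{nb_{n,s}}\,b_{n,s}}+\frac{n^{1/4}\log^2n}{nb_{n,s}^2}+b_{n,s}$. As $n_1,n_2\to\infty$, for $s=1,2$: $\pi_{n,s}=o(h_{d,s})$, $nb_{n,s}^2\to\infty$, $nb_{n,s}^4\log n\,\big(\frac{\pi_{n,s}'}{b_{n,s}}+\frac{\pi_{n,s}^3}{h_{d,s}^3}+h_{d,s}+\frac1{Nh_{d,s}}\big)^2\to0$,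 and $\bar\omega_{n,s}b_{n,s}^{-1/2}\log^2n\to0$. **Estimators.** For $t\in[b_{n,s},1-b_{n,s}]$ let $(\hat m_s(t),\hat m_s'(t))$ be a minimizer of $\sum_{i=1}^{n_s}\big(Y_{i,s}-\beta_0-\beta_1(\tfrac i{n_s}-t)\big)^2K\big(\tfrac{i/n_s-t}{b_{n,s}}\big)$ over $(\beta_0,\beta_1)\in\mathbb R^2$ (arbitrary if there is none), and extend $\hat m_s'$ by its value at $b_{n,s}$ to the left and by its value at $1-b_{n,s}$ to the right. Let $\hat f_s(t)=\frac1{Nh_{d,s}}\sum_{i=1}^NK_d\big(\frac{\hat m_s'(i/N)-t}{h_{d,s}}\big)$, $\hat g_2(x)=\int_{m_2'(0)}^x\hat f_2(t)\,dt$, $\tilde c=\hat g_2(\hat m_1'(0))$, $\hat c=\frac1{1-\tilde c}\int_0^{1-\tilde c}(\hat g_2(\hat m_1'(u))-u)\,du$, $\hat a=\hat m_1'(0)$, $\hat b=\hat m_1'(1-\hat c)$. Fix $\eta>0$, $L\in\mathbb N$ and points $t_1,\dots,t_L$, and let $$\mathcal C_{n_1,n_2}=\{(t_\ell,\hat f_1(t_\ell)-\hat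 f_2(t_\ell)):\ t_\ell\in(\hat a+\eta,\hat b-\eta),\ \ell=1,\dots,L\}.$$ The points are either (A) fixed real numbers, or (B) at fixed relative positions (for example equally spaced) in the estimated interval, $t_\ell=(1-\theta_\ell)(\hat a+\eta)+\theta_\ell(\hat b-\eta)$ with fixed $\theta_\ell\in(0,1)$; in case (B) assume also $m_1'(0)+\eta<m_1'(1-c)-\eta$. **Theorem.** For every $\epsilon>0$ let $$L(\epsilon,g)=\{(x,y):\ x\in[m_1'(0)+\eta,\,m_1'(1-c)-\eta],\ |y-g(x)|\le\epsilon\}.$$ Then, in both cases (A) and (B), $\lim_{n_1,n_2\to\infty}\mathbb P[\mathcal C_{n_1,n_2}\subset L(\epsilon,g)]=1$. Moreover, suppose that the null hypothesis holds: $m_1(t)=m_2(t+c_0)+d$ for all $t\in(0,1-c_0)$, with constants $c_0\in(0,1)$, $d\in\mathbb R$. Then, without assuming that $c$ is well defined and positive, and with the differentiability of $(m_1')^{-1},(m_2')^{-1}$ required on $(m_1'(0),m_1'(1-c_0))$, one has $c=c_0$, $g=0$ on $(m_1'(0),m_1'(1-c_0))$, and, in both cases (A) and (B) and for every $\epsilon>0$,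 $\lim_{n_1,n_2\to\infty}\mathbb P[\mathcal C_{n_1,n_2}\subset L(\epsilon,0)]=1$. -/

import Mathlib

open Set Filter Topology MeasureTheory ProbabilityTheory Asymptotics
open scoped ENNReal NNReal

noncomputable section

namespace CurveShift

/-! ### Regression functions -/

/-- The derivative of a function on `[0,1]` (one-sided at the end points). -/
def slope (m : ℝ → ℝ) (x : ℝ) : ℝ := derivWithin m (Icc 0 1) x

/-- The inverse `(m')⁻¹` of the derivative `m' : [0,1] → ℝ`; it is meaningful on `m' '' [0,1]`. -/
def slopeInv (m : ℝ → ℝ) : ℝ → ℝ := Function.invFunOn (slope m) (Icc 0 1)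

/-- Membership in `C^{2,1}[0,1]`. -/
def IsC21 (m : ℝ → ℝ) : Prop :=
  ContDiffOn ℝ 2 m (Icc 0 1) ∧
    ∃ C : ℝ≥0, LipschitzOnWith C (iteratedDerivWithin 2 m (Icc 0 1)) (Icc 0 1)

/-- `g = ((m₁')⁻¹)' - ((m₂')⁻¹)'`; here and below `m 0`, `m 1` stand for `m₁`, `m₂`. -/
def gDiff (m : Fin 2 → ℝ → ℝ) (x : ℝ) : ℝ :=
  deriv (slopeInv (m 0)) x - deriv (slopeInv (m 1)) x

/-- The null hypothesis with shift `c` and vertical shift `d`. -/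
def NullHypothesis (m : Fin 2 → ℝ → ℝ) (c d : ℝ) : Prop :=
  c ∈ Ioo (0 : ℝ) 1 ∧ ∀ t ∈ Ioo (0 : ℝ) (1 - c), m 0 t = m 1 (t + c) + d

/-- The preliminary shift `(m₂')⁻¹(m₁'(0))`. -/
def preShift (m : Fin 2 → ℝ → ℝ) : ℝ := slopeInv (m 1) (slope (m 0) 0)

/-- The shift `c`: the average of `(m₂')⁻¹(m₁'(u)) - u` over `u ∈ [0, 1 - preShift]`. -/
def popShift (m : Fin 2 → ℝ → ℝ) : ℝ :=
  1 / (1 - preShift m) *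
    ∫ u in (0 : ℝ)..(1 - preShift m), (slopeInv (m 1) (slope (m 0) u) - u)

/-- The inverses `(m_s')⁻¹` are differentiable on `(m₁'(0), m₁'(1-c))`, so that `g` exists there. -/
def InvDifferentiable (m : Fin 2 → ℝ → ℝ) (c : ℝ) : Prop :=
  ∀ s, ∀ t ∈ Ioo (slope (m 0) 0) (slope (m 0) (1 - c)), DifferentiableAt ℝ (slopeInv (m s)) t

/-- The shift is well defined and positive: `m₁'(0) = m₂'(x)` for some `x ∈ [0,1)`, the points
`m₁'(1 - preShift)` and `m₁'(1 - popShift)` belong to the range of `m₂'`, and `popShift > 0`. -/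
structure ShiftWellDefined (m : Fin 2 → ℝ → ℝ) : Prop where
  start : slope (m 0) 0 ∈ slope (m 1) '' Ico 0 1
  stop_pre : slope (m 0) (1 - preShift m) ∈ slope (m 1) '' Icc 0 1
  pos : 0 < popShift m
  stop_pop : slope (m 0) (1 - popShift m) ∈ slope (m 1) '' Icc 0 1

/-! ### Locally stationary errors -/

/-- The history `(x_i, x_{i-1}, x_{i-2}, …)` of a two-sided sequence up to time `i`. -/
def past (x : ℤ → ℝ) (i : ℤ) : ℕ → ℝ := fun j => x (i - j)

/-- The filter `G_s(t, ·)` applied to the history of the `s`-th coordinate up to time `i`. -/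
def filt (G : Fin 2 → ℝ → (ℕ → ℝ) → ℝ) (x : ℤ → Fin 2 → ℝ) (s : Fin 2) (t : ℝ) (i : ℤ) : ℝ :=
  G s t (past (fun j => x j s) i)

/-- The vector `𝐆(t, 𝓕_i)`, with the Euclidean norm. -/
def filtVec (G : Fin 2 → ℝ → (ℕ → ℝ) → ℝ) (x : ℤ → Fin 2 → ℝ) (t : ℝ) (i : ℤ) :
    EuclideanSpace ℝ (Fin 2) := WithLp.toLp 2 fun s => filt G x s t i

variable {Ω : Type*} [MeasurableSpace Ω]

/-- The physical dependence measure `δ₄(k)`. The second factor of `P ⊗ P` carries the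
independent copy of the innovations; the innovation at time `0` is replaced by its copy. -/
def physDep (P : Measure Ω) (ε : ℤ → Ω → Fin 2 → ℝ) (G : Fin 2 → ℝ → (ℕ → ℝ) → ℝ)
    (k : ℕ) : ℝ≥0∞ :=
  ⨆ t ∈ Icc (0 : ℝ) 1, eLpNorm (fun p : Ω × Ω =>
    filtVec G (fun i => ε i p.1) t k -
      filtVec G (Function.update (fun i => ε i p.1) 0 (ε 0 p.2)) t k) 4 (P.prod P)

/-- The matrix `Σ²(t) = ∑_{k ≥ 0} E[𝐆(t, 𝓕_0) 𝐆(t, 𝓕_k)ᵀ]`. -/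
def longRunVar (P : Measure Ω) (ε : ℤ → Ω → Fin 2 → ℝ) (G : Fin 2 → ℝ → (ℕ → ℝ) → ℝ)
    (t : ℝ) : Matrix (Fin 2) (Fin 2) ℝ :=
  Matrix.of fun r s =>
    ∑' k : ℕ, ∫ ω, filt G (fun i => ε i ω) r t 0 * filt G (fun i => ε i ω) s t k ∂P

/-- The assumptions on the errors. -/
structure LocallyStationary (P : Measure Ω) (ε : ℤ → Ω → Fin 2 → ℝ)
    (G : Fin 2 → ℝ → (ℕ → ℝ) → ℝ) : Prop where
  innov_measurable : ∀ i, Measurable (ε i)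
  innov_indep : iIndepFun ε P
  innov_ident : ∀ i, IdentDistrib (ε i) (ε 0) P P
  filter_measurable :
    ∀ s, Measurable fun p : Icc (0 : ℝ) 1 × (ℕ → ℝ) => G s (p.1 : ℝ) p.2
  mean_zero : ∀ s, ∀ t ∈ Icc (0 : ℝ) 1, ∫ ω, filt G (fun i => ε i ω) s t 0 ∂P = 0
  moment : ⨆ t ∈ Icc (0 : ℝ) 1, eLpNorm (fun ω => filtVec G (fun i => ε i ω) t 0) 4 P < ⊤
  increments : ⨆ t ∈ Icc (0 : ℝ) 1, ⨆ s ∈ Ioc t 1, eLpNorm (fun ω =>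
    filtVec G (fun i => ε i ω) t 0 - filtVec G (fun i => ε i ω) s 0) 4 P < ⊤
  geometric_decay : ∃ ρ ∈ Ioo (0 : ℝ) 1, ∃ C : ℝ, ∀ k : ℕ,
    physDep P ε G k ≤ ENNReal.ofReal (C * ρ ^ k)
  nondegenerate : ∃ ν₀ : ℝ, 0 < ν₀ ∧ ∀ t ∈ Icc (0 : ℝ) 1,
    (longRunVar P ε G t - ν₀ • (1 : Matrix (Fin 2) (Fin 2) ℝ)).PosDef
  diagonal : ∀ t ∈ Icc (0 : ℝ) 1, (longRunVar P ε G t).IsDiag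

/-- The observations `Y_{i,s} = m_s(i/n_s) + G_s(i/n_s, 𝓕_{i,s})`. -/
def obs (m : Fin 2 → ℝ → ℝ) (G : Fin 2 → ℝ → (ℕ → ℝ) → ℝ) (n : Fin 2 → ℕ)
    (x : ℤ → Fin 2 → ℝ) (s : Fin 2) (i : ℕ) : ℝ :=
  m s ((i : ℝ) / n s) + filt G x s ((i : ℝ) / n s) i

/-! ### Kernels and bandwidths -/

/-- Assumptions on the kernel of the local linear estimator. Differentiability is only required
on `[-1,1]` (one-sided at the end points), which includes functions that are twice differentiable
on the whole line. -/
structure IsSmoothingKernel (K : ℝ → ℝ) : Prop where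
  symm : ∀ x, K (-x) = K x
  supp : Function.support K ⊆ Icc (-1) 1
  diff : DifferentiableOn ℝ K (Icc (-1) 1)
  diff_two : DifferentiableOn ℝ (derivWithin K (Icc (-1) 1)) (Icc (-1) 1)
  integral_one : ∫ x in (-1 : ℝ)..1, K x = 1
  second_moment_pos : 0 < ∫ x in (-1 : ℝ)..1, K x * x ^ 2

/-- Assumptions on the kernel of the density step: an even density supported in `[-1,1]` and
continuous there. -/
structure IsDensityKernel (Kd : ℝ → ℝ) : Prop where
  even : ∀ x, Kd (-x) = Kd x
  nonneg : ∀ x, 0 ≤ Kd x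
  supp : Function.support Kd ⊆ Icc (-1) 1
  cont : ContinuousOn Kd (Icc (-1) 1)
  integral_one : ∫ x in (-1 : ℝ)..1, Kd x = 1

/-- `π'_n` for sample size `n` and bandwidth `b`. -/
def ratePi' (n : ℕ) (b : ℝ) : ℝ :=
  (n : ℝ) ^ (1 / 4 : ℝ) * Real.log n ^ 2 / (n * b ^ 2) + b ^ 2

/-- `π_n` for sample size `n` and bandwidth `b`. -/
def ratePi (n : ℕ) (b : ℝ) : ℝ :=
  Real.log n / (Real.sqrt (n * b) * b) +
    (n : ℝ) ^ (1 / 4 : ℝ) * Real.log n ^ 2 / (n * b ^ 2) + b ^ 2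

/-- `ω̄_n` for sample size `n` and bandwidth `b`. -/
def rateOmega (n : ℕ) (b : ℝ) : ℝ :=
  Real.log n / (Real.sqrt (n * b) * b) +
    (n : ℝ) ^ (1 / 4 : ℝ) * Real.log n ^ 2 / (n * b ^ 2) + b

/-- The conditions on the bandwidths `b s`, `h s` and the integer `N`, all of which may depend on
the pair `n = (n₁, n₂)` of sample sizes; limits are taken as both sample sizes tend to infinity. -/
structure BandwidthConditions (b h : Fin 2 → (Fin 2 → ℕ) → ℝ) (N : (Fin 2 → ℕ) → ℕ) : Prop where
  b_pos : ∀ s n, 0 < b s n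
  h_pos : ∀ s n, 0 < h s n
  N_pos : ∀ n, 0 < N n
  pi_small : ∀ s, (fun n => ratePi (n s) (b s n)) =o[atTop] (fun n => h s n)
  nb_sq : ∀ s, Tendsto (fun n : Fin 2 → ℕ => (n s : ℝ) * b s n ^ 2) atTop atTop
  nb_four : ∀ s, Tendsto (fun n : Fin 2 → ℕ => (n s : ℝ) * b s n ^ 4 * Real.log (n s) *
    (ratePi' (n s) (b s n) / b s n + ratePi (n s) (b s n) ^ 3 / h s n ^ 3 + h s n +
      1 / (N n * h s n)) ^ 2) atTop (𝓝 0)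
  omega_small : ∀ s, Tendsto (fun n : Fin 2 → ℕ =>
    rateOmega (n s) (b s n) * b s n ^ (-(1 / 2) : ℝ) * Real.log (n s) ^ 2) atTop (𝓝 0)

/-! ### Estimators -/

/-- The local linear least squares criterion at `t`. -/
def llObjective (K : ℝ → ℝ) (n : ℕ) (b : ℝ) (Y : ℕ → ℝ) (t : ℝ) (β : ℝ × ℝ) : ℝ :=
  ∑ i ∈ Finset.Icc 1 n,
    (Y i - β.1 - β.2 * ((i : ℝ) / n - t)) ^ 2 * K (((i : ℝ) / n - t) / b)

/-- A minimizer of the criterion (arbitrary if there is none). -/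
def llArgmin (K : ℝ → ℝ) (n : ℕ) (b : ℝ) (Y : ℕ → ℝ) (t : ℝ) : ℝ × ℝ :=
  Classical.epsilon fun β => ∀ β', llObjective K n b Y t β ≤ llObjective K n b Y t β'

/-- The estimator of `m'`: the local linear slope on `[b, 1-b]`, extended by its values at `b`
and `1 - b`. -/
def slopeHat (K : ℝ → ℝ) (n : ℕ) (b : ℝ) (Y : ℕ → ℝ) (t : ℝ) : ℝ :=
  (llArgmin K n b Y (max b (min t (1 - b)))).2

/-- The estimator of `((m')⁻¹)'` built from an estimator `p` of `m'`. -/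
def fHat (Kd : ℝ → ℝ) (N : ℕ) (h : ℝ) (p : ℝ → ℝ) (t : ℝ) : ℝ :=
  1 / (N * h) * ∑ i ∈ Finset.Icc 1 N, Kd ((p ((i : ℝ) / N) - t) / h)

/-- The estimator of `(m₂')⁻¹` built from an estimator `f` of its derivative;
`x₀` is the left end point `m₂'(0)`. -/
def gHat (x₀ : ℝ) (f : ℝ → ℝ) (x : ℝ) : ℝ := ∫ t in x₀..x, f t

/-- The estimator of the shift built from `q = ĝ₂` and `p = m̂₁'`. -/
def cHat (q p : ℝ → ℝ) : ℝ :=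
  1 / (1 - q (p 0)) * ∫ u in (0 : ℝ)..(1 - q (p 0)), (q (p u) - u)

/-- The collection of plotted points: those `(t_ℓ, D(t_ℓ))` with `t_ℓ ∈ (a + η, b - η)`. -/
def plotted {L : ℕ} (D : ℝ → ℝ) (a b η : ℝ) (t : Fin L → ℝ) : Set (ℝ × ℝ) :=
  {z | ∃ l, t l ∈ Ioo (a + η) (b - η) ∧ z = (t l, D (t l))}

/-- The band of width `ε` around the graph of `g` over `[a + η, b - η]`. -/
def band (a b η ε : ℝ) (g : ℝ → ℝ) : Set (ℝ × ℝ) :=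
  {z | z.1 ∈ Icc (a + η) (b - η) ∧ |z.2 - g z.1| ≤ ε}

/-- All deterministic ingredients of the procedure. -/
structure Procedure where
  /-- kernel of the local linear estimator -/
  K : ℝ → ℝ
  /-- kernel of the density step -/
  Kd : ℝ → ℝ
  /-- bandwidths of the local linear estimators -/
  b : Fin 2 → (Fin 2 → ℕ) → ℝ
  /-- bandwidths of the density step -/
  h : Fin 2 → (Fin 2 → ℕ) → ℝ
  /-- number of evaluation points of the density step -/
  N : (Fin 2 → ℕ) → ℕ

namespace Procedure

variable (T : Procedure) (m : Fin 2 → ℝ → ℝ) (n : Fin 2 → ℕ) (Y : Fin 2 → ℕ → ℝ)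

/-- `m̂_s'` -/
def mHat (s : Fin 2) : ℝ → ℝ := slopeHat T.K (n s) (T.b s n) (Y s)

/-- `f̂_s` -/
def fEst (s : Fin 2) : ℝ → ℝ := fHat T.Kd (T.N n) (T.h s n) (T.mHat n Y s)

/-- `ĉ` -/
def cEst : ℝ := cHat (gHat (slope (m 1) 0) (T.fEst n Y 1)) (T.mHat n Y 0)

/-- `â = m̂₁'(0)` -/
def aEst : ℝ := T.mHat n Y 0 0

/-- `b̂ = m̂₁'(1 - ĉ)` -/
def bEst : ℝ := T.mHat n Y 0 (1 - T.cEst m n Y)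

/-- The set of plotted points for the evaluation points `t`. -/
def points {L : ℕ} (η : ℝ) (t : Fin L → ℝ) : Set (ℝ × ℝ) :=
  plotted (fun x => T.fEst n Y 0 x - T.fEst n Y 1 x) (T.aEst n Y) (T.bEst m n Y) η t

/-- Evaluation points at the relative positions `θ` in the interval `(â + η, b̂ - η)`. -/
def relPoints {L : ℕ} (η : ℝ) (θ : Fin L → ℝ) : Fin L → ℝ := fun l =>
  (1 - θ l) * (T.aEst n Y + η) + θ l * (T.bEst m n Y - η)

/-- With probability tending to one (as `n₁, n₂ → ∞`) the plotted points lie in the `δ`-band around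
the graph of `g` over `[m₁'(0) + η, m₁'(1-c) - η]`, for every `δ > 0`, every fixed finite set of
evaluation points, and, if that interval is nondegenerate, every finite set of evaluation points at
fixed relative positions (for instance equally spaced) in the estimated interval. -/
def PointsInBand (P : Measure Ω) (ε : ℤ → Ω → Fin 2 → ℝ) (G : Fin 2 → ℝ → (ℕ → ℝ) → ℝ)
    (η c : ℝ) (g : ℝ → ℝ) : Prop :=
  ∀ δ : ℝ, 0 < δ → ∀ L : ℕ,
    (∀ t : Fin L → ℝ, Tendsto (fun n : Fin 2 → ℕ => P {ω |
        T.points m n (obs m G n fun i => ε i ω) η t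
          ⊆ band (slope (m 0) 0) (slope (m 0) (1 - c)) η δ g}) atTop (𝓝 1)) ∧
    (slope (m 0) 0 + η < slope (m 0) (1 - c) - η →
      ∀ θ : Fin L → ℝ, (∀ l, θ l ∈ Ioo (0 : ℝ) 1) → Tendsto (fun n : Fin 2 → ℕ => P {ω |
        T.points m n (obs m G n fun i => ε i ω) η
            (T.relPoints m n (obs m G n fun i => ε i ω) η θ)
          ⊆ band (slope (m 0) 0) (slope (m 0) (1 - c)) η δ g}) atTop (𝓝 1))

end Procedure

end CurveShift

end

namespace CurveShift

/-! The plotted points depend on the data only through the two estimated slopes `m̂_s'`. If the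
slope errors are at most `τ h` on `[b, 1 - b]` and at most `τ` on `[0, 1]`, with `τ` small but
fixed, then for large samples the points lie in the band by pure analysis.
`Procedure.ImpliedBySlopes` expresses such implications, and `ImpliedBySlopes.tendsto` turns them
into probabilities tending to one by means of a single probabilistic result,
`tendsto_measureReal_slope_error`.

For that result, the normal equations express the slope error as a bias of order `b² + 1/n` plus
kernel-weighted error sums divided by `n b²`. Summation by parts bounds these weighted sums, for all
centres at once, by the largest unweighted error sum over a window of length at most `2nb`
(`IsSmoothingKernel.exists_abs_llArgmin_sub_le`). All these sums are of order `√(nb) log n` with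
high probability (`exists_window_bound`): truncate the errors at `n^(5/16)`; freeze the innovations
older than a multiple of `log n`, which costs little because dependence decays geometrically; apply
a Chernoff bound along residue classes modulo the block length, where the blocks are independent;
and take a union over at most `n²` windows. The slope error is then of order `π_n = o(h)`.

On the analytic side, `f̂_s(t)` is a Riemann sum for `∫ K_d((m_s'(u) - t)/h) du / h`. Linearising
`m_s'` near the point where it equals `t` gives `1 / m_s''` there, which is the derivative of the
inverse (`IsDensityKernel.exists_abs_fHat_sub_le`); the division by `h` inside the kernel is the
reason why slope errors `o(h)` are needed. The function `ĝ₂` is an average of smoothed indicators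
that `m̂₂'(i/N)` lies between `m₂'(0)` and `x`, so plain uniform consistency of the slopes suffices
for it (`IsDensityKernel.exists_abs_gHat_sub_le`), and `ĉ` and `b̂` follow by continuity.
Consistency of `f̂_s` holds locally uniformly in `t`, as random evaluation points require.

Under the null hypothesis `m₁'(u) = m₂'(u + c₀)`, so the two inverses differ by a constant, and the
general statement applies with `g = 0`. -/

/-! ### Decoupling a function of an i.i.d. sequence from the remote past -/

/-- The first `K` coordinates of `y`, followed by the remaining coordinates of `z`. -/
def splice (K : ℕ) (y z : ℕ → ℝ) : ℕ → ℝ := fun j => if j < K then y j else z j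

lemma measurable_splice (K : ℕ) :
    Measurable fun p : (ℕ → ℝ) × (ℕ → ℝ) => splice K p.1 p.2 := by
  refine measurable_pi_iff.2 fun j => ?_
  by_cases h : j < K <;> simp only [splice, h, if_true, if_false] <;> fun_prop

/-- Neighbouring cuts differ in one coordinate, so the effect of replacing a whole tail telescopes
into effects of single replacements. -/
lemma splice_eq_update (K : ℕ) (y z : ℕ → ℝ) :
    splice K y z = Function.update (splice (K + 1) y z) K (z K) := by
  ext j
  rcases lt_trichotomy j K with h | h | h
  · simp [splice, h, h.ne, Nat.lt_succ_of_lt h]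
  · subst h; simp [splice]
  · simp [splice, h.ne', not_lt.2 h.le, not_lt.2 (Nat.succ_le_of_lt h)]

section Canonical

variable (ν : Measure ℝ) [IsProbabilityMeasure ν]

/-- The law of an i.i.d. family. -/
noncomputable abbrev iidLaw (ι : Type*) : Measure (ι → ℝ) := Measure.infinitePi fun _ : ι => ν

/-- Two independent sequences as one family indexed by `Bool × ℕ`. -/
def pairSel (p : (ℕ → ℝ) × (ℕ → ℝ)) (a : Bool × ℕ) : ℝ := bif a.1 then p.2 a.2 else p.1 a.2

lemma measurable_pairSel : Measurable pairSel := by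
  refine measurable_pi_iff.2 fun a => ?_
  rcases a with ⟨a, j⟩
  cases a <;> simp only [pairSel, cond_true, cond_false] <;> fun_prop

lemma map_pairSel :
    ((iidLaw ν ℕ).prod (iidLaw ν ℕ)).map pairSel = iidLaw ν (Bool × ℕ) := by
  have h1 := Measure.infinitePi_map_curry (ι := Bool) (κ := ℕ) (fun _ _ => ν)
  have h2 := Measure.infinitePi_map_eval_prod (ι := Bool) (Ω := fun _ => ℕ → ℝ)
    (P := fun _ => iidLaw ν ℕ) (i := false) (j := true) (by decide)
  rw [← h2, ← h1, Measure.map_map measurable_pairSel (by fun_prop),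
    Measure.map_map (measurable_pairSel.comp (by fun_prop)) (by fun_prop)]
  convert Measure.map_id
  ext x ⟨a, j⟩
  cases a <;> rfl

lemma map_pairSel_comp {α : Type*} {φ : α → Bool × ℕ} (hφ : φ.Injective) :
    ((iidLaw ν ℕ).prod (iidLaw ν ℕ)).map (fun p i => pairSel p (φ i)) = iidLaw ν α := by
  have h := Measure.map_infinitePi_infinitePi_of_inj (P := fun _ : Bool × ℕ => ν) hφ
  refine Eq.trans ?_ h
  change _ = (iidLaw ν (Bool × ℕ)).map _
  rw [← map_pairSel, Measure.map_map (by fun_prop) measurable_pairSel]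
  rfl

variable {ν}

/-- The dependence of `g` on its `k`-th coordinate in `L¹`. -/
noncomputable def coordDep (ν : Measure ℝ) [IsProbabilityMeasure ν] (g : (ℕ → ℝ) → ℝ) (k : ℕ) : ℝ≥0∞ :=
  ∫⁻ p, ‖g p.1 - g (Function.update p.1 k p.2)‖ₑ ∂((iidLaw ν ℕ).prod ν)

/-- The dependence of `g` on all coordinates from `K` on, in `L¹`. -/
noncomputable def tailDep (ν : Measure ℝ) [IsProbabilityMeasure ν] (g : (ℕ → ℝ) → ℝ) (K : ℕ) : ℝ≥0∞ :=
  ∫⁻ p, ‖g p.1 - g (splice K p.1 p.2)‖ₑ ∂((iidLaw ν ℕ).prod (iidLaw ν ℕ))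

lemma measurable_update_pair {α : Type*} [MeasurableSpace α] (k : ℕ) {f : α → ℕ → ℝ} {h : α → ℝ}
    (hf : Measurable f) (hh : Measurable h) :
    Measurable fun p => Function.update (f p) k (h p) := by
  refine measurable_pi_iff.2 fun j => ?_
  by_cases hj : j = k
  · subst hj; simpa using hh
  · simp only [Function.update_of_ne hj]
    exact (measurable_pi_apply j).comp hf

/-- Distinct coordinates of two independent i.i.d. sequences always form one i.i.d. family, so the
expectation cannot depend on which ones are selected. -/
lemma lintegral_pairSel {α : Type*} {φ ψ : α → Bool × ℕ} (hφ : φ.Injective) (hψ : ψ.Injective)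
    {H : (α → ℝ) → ℝ≥0∞} (hH : Measurable H) :
    ∫⁻ p, H (fun i => pairSel p (φ i)) ∂((iidLaw ν ℕ).prod (iidLaw ν ℕ)) =
      ∫⁻ p, H (fun i => pairSel p (ψ i)) ∂((iidLaw ν ℕ).prod (iidLaw ν ℕ)) := by
  have hm : ∀ χ : α → Bool × ℕ, Measurable fun p i => pairSel p (χ i) := fun χ =>
    measurable_pi_iff.2 fun i => (measurable_pi_apply (χ i)).comp measurable_pairSel
  rw [← lintegral_map hH (hm φ), ← lintegral_map hH (hm ψ), map_pairSel_comp ν hφ,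
    map_pairSel_comp ν hψ]

/-- The sequence `splice (K + 1) p.1 p.2` does not involve `p.2 K`; hence this value is a fresh
innovation, independent of the spliced sequence, which is itself i.i.d. -/
lemma lintegral_splice_update {g : (ℕ → ℝ) → ℝ} (hg : Measurable g) (K : ℕ) :
    ∫⁻ p, ‖g (splice (K + 1) p.1 p.2) -
        g (Function.update (splice (K + 1) p.1 p.2) K (p.2 K))‖ₑ
      ∂((iidLaw ν ℕ).prod (iidLaw ν ℕ)) = coordDep ν g K := by
  let H : (Option ℕ → ℝ) → ℝ≥0∞ := fun v =>
    ‖g (fun j => v (some j)) - g (Function.update (fun j => v (some j)) K (v none))‖ₑ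
  have hH : Measurable H := by
    have h1 : Measurable fun v : Option ℕ → ℝ => fun j : ℕ => v (some j) := by fun_prop
    have h2 : Measurable fun v : Option ℕ → ℝ => v none := by fun_prop
    exact ((hg.comp h1).sub (hg.comp (measurable_update_pair K h1 h2))).enorm
  -- The index `none` stands for the fresh value; `φ` reads the spliced sequence, `ψ` the first
  -- sequence alone.
  let φ : Option ℕ → Bool × ℕ := fun o => o.elim (true, K) fun j => (decide (K + 1 ≤ j), j)
  let ψ : Option ℕ → Bool × ℕ := fun o => o.elim (true, K) fun j => (false, j)
  have hφ : φ.Injective := by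
    rintro (_ | i) (_ | j) h
    · rfl
    · simp only [φ, Option.elim, Prod.mk.injEq] at h
      obtain ⟨h1, rfl⟩ := h
      simp at h1
    · simp only [φ, Option.elim, Prod.mk.injEq] at h
      obtain ⟨h1, rfl⟩ := h
      simp at h1
    · simp only [φ, Option.elim, Prod.mk.injEq] at h
      rw [h.2]
  have hψ : ψ.Injective := by
    rintro (_ | i) (_ | j) h <;> simp_all [ψ]
  have key := lintegral_pairSel (ν := ν) hφ hψ hH
  have e1 : ∀ p : (ℕ → ℝ) × (ℕ → ℝ), H (fun i => pairSel p (φ i)) =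
      ‖g (splice (K + 1) p.1 p.2) -
        g (Function.update (splice (K + 1) p.1 p.2) K (p.2 K))‖ₑ := by
    intro p
    have : (fun j => pairSel p (φ (some j))) = splice (K + 1) p.1 p.2 := by
      ext j
      by_cases h : j < K + 1
      · have h' : ¬ K < j := by omega
        simp [φ, pairSel, splice, h, h']
      · have h' : K < j := by omega
        simp [φ, pairSel, splice, h, h']
    simp only [H, this]
    rfl
  have e2 : ∀ p : (ℕ → ℝ) × (ℕ → ℝ), H (fun i => pairSel p (ψ i)) =
      ‖g p.1 - g (Function.update p.1 K (p.2 K))‖ₑ := fun p => rfl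
  simp only [e1, e2] at key
  rw [key, coordDep]
  have hprod : (iidLaw ν ℕ).prod ν =
      ((iidLaw ν ℕ).prod (iidLaw ν ℕ)).map (Prod.map id fun z : ℕ → ℝ => z K) := by
    rw [← Measure.map_prod_map _ _ measurable_id (measurable_pi_apply K), Measure.map_id,
      Measure.infinitePi_map_eval]
  rw [hprod, lintegral_map]
  · rfl
  · exact ((hg.comp measurable_fst).sub
      (hg.comp (measurable_update_pair K measurable_fst measurable_snd))).enorm
  · exact measurable_id.prodMap (measurable_pi_apply K)

/-- Triangle inequality through `splice (K + 1)`: the remaining step replaces coordinate `K` only.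
-/
lemma tailDep_le_add {g : (ℕ → ℝ) → ℝ} (hg : Measurable g) (K : ℕ) :
    tailDep ν g K ≤ tailDep ν g (K + 1) + coordDep ν g K := by
  have hs := measurable_splice (K + 1)
  rw [← lintegral_splice_update hg K, tailDep, tailDep, ← lintegral_add_left]
  · refine lintegral_mono fun p => ?_
    rw [splice_eq_update K p.1 p.2]
    refine le_trans (le_of_eq ?_) (enorm_add_le _ _)
    congr 1
    ring
  · exact ((hg.comp measurable_fst).sub (hg.comp hs)).enorm

lemma lintegral_comp_splice (K : ℕ) {H : (ℕ → ℝ) → ℝ≥0∞} (hH : Measurable H) :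
    ∫⁻ p, H (splice K p.1 p.2) ∂((iidLaw ν ℕ).prod (iidLaw ν ℕ)) = ∫⁻ y, H y ∂(iidLaw ν ℕ) := by
  let φ : ℕ → Bool × ℕ := fun j => (decide (K ≤ j), j)
  have hφ : φ.Injective := fun i j h => (Prod.mk.inj h).2
  have h := map_pairSel_comp ν hφ
  have e : (fun (p : (ℕ → ℝ) × (ℕ → ℝ)) i => pairSel p (φ i)) = fun p => splice K p.1 p.2 := by
    ext p j
    by_cases h : j < K
    · simp [φ, pairSel, splice, h, not_le.2 h]
    · simp [φ, pairSel, splice, h, not_lt.1 h]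
  rw [e] at h
  rw [← lintegral_map hH (measurable_splice K), h]

lemma iSup_piLE_nat : ⨆ K, (Filtration.piLE (X := fun _ : ℕ => ℝ)) K = MeasurableSpace.pi := by
  refine le_antisymm (iSup_le fun K => Filtration.piLE.le K) ?_
  refine iSup_le fun j => le_trans ?_ (le_iSup _ j)
  change MeasurableSpace.comap _ _ ≤ MeasurableSpace.comap _ _
  have : (fun y : ℕ → ℝ => y j) = (fun v : Iic j → ℝ => v ⟨j, self_mem_Iic⟩) ∘ Preorder.restrictLe j := rfl
  rw [this, ← MeasurableSpace.comap_comp]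
  exact MeasurableSpace.comap_mono (Measurable.comap_le (by fun_prop))

/-- The conditional expectation given the first coordinates is unaffected by replacing the others,
so `tailDep` is at most twice the `L¹` distance of `g` from it, and this tends to zero by Lévy's
upward theorem. -/
lemma tendsto_tailDep {g : (ℕ → ℝ) → ℝ} (hg : Measurable g) (hi : Integrable g (iidLaw ν ℕ)) :
    Tendsto (fun K => tailDep ν g (K + 1)) atTop (𝓝 0) := by
  set Q := iidLaw ν ℕ
  have hL := hi.tendsto_eLpNorm_condExp (ℱ := Filtration.piLE (X := fun _ : ℕ => ℝ))
    (by rw [iSup_piLE_nat]; exact hg.stronglyMeasurable)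
  have hbd : ∀ K, tailDep ν g (K + 1) ≤
      2 * eLpNorm (Q[g | Filtration.piLE (X := fun _ : ℕ => ℝ) K] - g) 1 Q := by
    intro K
    set f := Q[g | Filtration.piLE (X := fun _ : ℕ => ℝ) K] with hf
    have hfs : StronglyMeasurable[Filtration.piLE (X := fun _ : ℕ => ℝ) K] f :=
      stronglyMeasurable_condExp
    have hfm : Measurable f := (hfs.mono (Filtration.piLE.le K)).measurable
    have hdep := hfs.dependsOn_of_piLE
    -- The σ-algebra with index `K` includes coordinate `K` itself, whence the cut at `K + 1`.
    have hfeq : ∀ y z, f (splice (K + 1) y z) = f y := fun y z => hdep fun j hj => by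
      simp [splice, Nat.lt_succ_of_le hj]
    have hm : Measurable fun y => ‖(f - g) y‖ₑ := (hfm.sub hg).enorm
    rw [eLpNorm_one_eq_lintegral_enorm, two_mul]
    have h1 : ∫⁻ p, ‖(f - g) p.1‖ₑ ∂(Q.prod Q) = ∫⁻ y, ‖(f - g) y‖ₑ ∂Q := by
      rw [← lintegral_map (μ := Q.prod Q) (g := Prod.fst) hm measurable_fst]
      congr 1
      exact Measure.fst_prod
    have h2 := lintegral_comp_splice (ν := ν) (K + 1) hm
    calc tailDep ν g (K + 1)
        ≤ ∫⁻ p, (‖(f - g) p.1‖ₑ + ‖(f - g) (splice (K + 1) p.1 p.2)‖ₑ) ∂(Q.prod Q) := by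
          refine lintegral_mono fun p => ?_
          have : g p.1 - g (splice (K + 1) p.1 p.2) =
              (f - g) (splice (K + 1) p.1 p.2) - (f - g) p.1 := by
            simp only [Pi.sub_apply, hfeq]; ring
          rw [this, add_comm ‖(f - g) p.1‖ₑ]
          exact enorm_sub_le
      _ = _ := by
          rw [lintegral_add_left (f := fun p : (ℕ → ℝ) × (ℕ → ℝ) => ‖(f - g) p.1‖ₑ)
            (hm.comp measurable_fst), h1, h2]
  refine tendsto_of_tendsto_of_tendsto_of_le_of_le tendsto_const_nhds ?_ (fun _ => zero_le) hbd
  simpa using ENNReal.Tendsto.const_mul hL (Or.inr (by simp : (2 : ℝ≥0∞) ≠ ⊤))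

/-- Single replacements telescope from `K` to `K + J`. The rest `tailDep ν g (K + J)` vanishes as `J
→ ∞`; without this limit, finitely many replacements would say nothing about an infinite tail. -/
lemma tailDep_le_tsum {g : (ℕ → ℝ) → ℝ} (hg : Measurable g) (hi : Integrable g (iidLaw ν ℕ))
    (K : ℕ) : tailDep ν g K ≤ ∑' k, coordDep ν g (K + k) := by
  have h : ∀ J, tailDep ν g K ≤ tailDep ν g (K + J) + ∑ k ∈ Finset.range J, coordDep ν g (K + k) := by
    intro J
    induction J with
    | zero => simp
    | succ J ih =>
      rw [Finset.sum_range_succ]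
      refine ih.trans ?_
      have := tailDep_le_add (ν := ν) hg (K + J)
      calc _ ≤ (tailDep ν g (K + J + 1) + coordDep ν g (K + J)) +
            ∑ k ∈ Finset.range J, coordDep ν g (K + k) := by gcongr
        _ = _ := by rw [← add_assoc K J 1]; ring
  have ht : Tendsto (fun J => tailDep ν g (K + J)) atTop (𝓝 0) := by
    have := tendsto_tailDep (ν := ν) hg hi
    have h2 := (tendsto_add_atTop_iff_nat (f := fun K => tailDep ν g K) 1).1 this
    have h3 := (tendsto_add_atTop_iff_nat (f := fun J => tailDep ν g J) K).2 h2
    simpa [add_comm] using h3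
  refine ge_of_tendsto (x := atTop) (f := fun J => tailDep ν g (K + J) + ∑' k, coordDep ν g (K + k))
    (by simpa using ht.add_const _) (Eventually.of_forall fun J => (h J).trans ?_)
  gcongr
  exact ENNReal.sum_le_tsum _

/-- A function of an i.i.d. sequence can be approximated in `L¹` by freezing the remote
coordinates. -/
lemma exists_frozen_tail {g : (ℕ → ℝ) → ℝ} (hg : Measurable g) (hi : Integrable g (iidLaw ν ℕ))
    {C ρ : ℝ} (hC : 0 ≤ C) (hρ : ρ ∈ Ioo (0 : ℝ) 1)
    (hdep : ∀ k, coordDep ν g k ≤ ENNReal.ofReal (C * ρ ^ k)) (K : ℕ) :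
    ∃ z : ℕ → ℝ, ∫⁻ y, ‖g y - g (splice K y z)‖ₑ ∂(iidLaw ν ℕ) ≤
      ENNReal.ofReal (C * (1 - ρ)⁻¹ * ρ ^ K) := by
  have hsum : HasSum (fun k : ℕ => C * ρ ^ (K + k)) (C * (1 - ρ)⁻¹ * ρ ^ K) := by
    have := (hasSum_geometric_of_lt_one hρ.1.le hρ.2).mul_left (C * ρ ^ K)
    have e : (fun k : ℕ => C * ρ ^ (K + k)) = fun k => C * ρ ^ K * ρ ^ k := by
      funext k; rw [pow_add, mul_assoc]
    rw [e, mul_right_comm]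
    exact this
  have hle : tailDep ν g K ≤ ENNReal.ofReal (C * (1 - ρ)⁻¹ * ρ ^ K) := by
    refine (tailDep_le_tsum hg hi K).trans ((ENNReal.tsum_le_tsum fun k => hdep (K + k)).trans ?_)
    rw [← ENNReal.ofReal_tsum_of_nonneg (fun k => mul_nonneg hC (pow_nonneg hρ.1.le _))
      hsum.summable, hsum.tsum_eq]
  have hm : Measurable fun p : (ℕ → ℝ) × (ℕ → ℝ) => ‖g p.1 - g (splice K p.1 p.2)‖ₑ :=
    ((hg.comp measurable_fst).sub (hg.comp (measurable_splice K))).enorm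
  rw [tailDep, lintegral_prod_symm _ hm.aemeasurable] at hle
  -- The bound holds on average over the replacing tail, hence for some deterministic tail. Freezing
  -- it leaves a function of the first `K` coordinates only.
  obtain ⟨z, hz⟩ := exists_le_lintegral (μ := iidLaw ν ℕ)
    (f := fun z => ∫⁻ y, ‖g y - g (splice K y z)‖ₑ ∂(iidLaw ν ℕ))
    (Measurable.aemeasurable (hm.lintegral_prod_left'))
  exact ⟨z, hz.trans hle⟩

end Canonical

/-! ### An exponential inequality for `M`-dependent sequences -/

section Exponential

variable {Ω : Type*} [MeasurableSpace Ω] {P : Measure Ω} [IsProbabilityMeasure P]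

lemma integrable_of_abs_le {X : Ω → ℝ} (hX : Measurable X) {B : ℝ} (hB : ∀ ω, |X ω| ≤ B) :
    Integrable X P :=
  Integrable.of_bound hX.aestronglyMeasurable B (Eventually.of_forall fun ω => by simpa using hB ω)

lemma integrable_exp_of_abs_le {X : Ω → ℝ} (hX : Measurable X) {B : ℝ} (hB : ∀ ω, |X ω| ≤ B)
    (t : ℝ) : Integrable (fun ω => Real.exp (t * X ω)) P := by
  refine integrable_of_abs_le (by fun_prop) (B := Real.exp (|t| * B)) fun ω => ?_
  rw [abs_of_pos (Real.exp_pos _)]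
  refine Real.exp_le_exp.2 ((le_abs_self _).trans ?_)
  rw [abs_mul]
  exact mul_le_mul_of_nonneg_left (hB ω) (abs_nonneg t)

/-- Uses `e^x ≤ 1 + x + x²` for `|x| ≤ 1`; the linear term integrates to zero. -/
lemma mgf_le_exp_sq {X : Ω → ℝ} (hX : Measurable X) {B v t : ℝ} (hB : ∀ ω, |X ω| ≤ B)
    (h0 : ∫ ω, X ω ∂P = 0) (hv : ∫ ω, X ω ^ 2 ∂P ≤ v) (ht : |t| * B ≤ 1) :
    mgf X P t ≤ Real.exp (t ^ 2 * v) := by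
  have hi : Integrable X P := integrable_of_abs_le hX hB
  have hi2 : Integrable (fun ω => X ω ^ 2) P :=
    integrable_of_abs_le (by fun_prop) (B := B ^ 2) fun ω => by
      rw [abs_pow]; exact pow_le_pow_left₀ (abs_nonneg _) (hB ω) 2
  calc mgf X P t ≤ ∫ ω, (1 + t * X ω + t ^ 2 * X ω ^ 2) ∂P := by
        refine integral_mono (integrable_exp_of_abs_le hX hB t)
          (((integrable_const _).add (hi.const_mul t)).add (hi2.const_mul _)) fun ω => ?_
        have h1 : |t * X ω| ≤ 1 := by
          rw [abs_mul]
          exact (mul_le_mul_of_nonneg_left (hB ω) (abs_nonneg t)).trans ht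
        have := (abs_le.1 (Real.abs_exp_sub_one_sub_id_le h1)).2
        simp only
        nlinarith
    _ = 1 + t ^ 2 * ∫ ω, X ω ^ 2 ∂P := by
        have h1 : Integrable (fun ω => 1 + t * X ω) P := (integrable_const _).add (hi.const_mul t)
        rw [integral_add h1 (hi2.const_mul _),
          integral_add (integrable_const _) (hi.const_mul t), integral_const_mul,
          integral_const_mul, h0]
        simp
    _ ≤ 1 + t ^ 2 * v := by gcongr
    _ ≤ Real.exp (t ^ 2 * v) := by linarith [Real.add_one_le_exp (t ^ 2 * v)]

/-- The `M` summands may depend on each other. Convexity of `exp`, applied to the average of the `M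
* t * S r`, avoids any joint independence at the price of a factor `M` in the parameter. -/
lemma integral_exp_sum_le {M : ℕ} (hM : 0 < M) {S : ℕ → Ω → ℝ} {t : ℝ}
    (hi : ∀ r, Integrable (fun ω => Real.exp (M * t * S r ω)) P)
    (hi' : Integrable (fun ω => Real.exp (t * ∑ r ∈ Finset.range M, S r ω)) P) {c : ℝ}
    (hc : ∀ r < M, ∫ ω, Real.exp (M * t * S r ω) ∂P ≤ c) :
    ∫ ω, Real.exp (t * ∑ r ∈ Finset.range M, S r ω) ∂P ≤ c := by
  have hM' : (0 : ℝ) < M := by exact_mod_cast hM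
  calc ∫ ω, Real.exp (t * ∑ r ∈ Finset.range M, S r ω) ∂P
      ≤ ∫ ω, ∑ r ∈ Finset.range M, (1 / M : ℝ) * Real.exp (M * t * S r ω) ∂P := by
        refine integral_mono hi' (integrable_finsetSum _ fun r _ => (hi r).const_mul _) fun ω => ?_
        have := convexOn_exp.map_sum_le (t := Finset.range M) (w := fun _ => (1 / M : ℝ))
          (p := fun r => M * t * S r ω) (fun _ _ => by positivity) (by simp [hM'.ne'])
          (fun _ _ => mem_univ _)
        simp only [smul_eq_mul] at this
        refine le_trans (le_of_eq ?_) this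
        congr 1
        rw [Finset.mul_sum]
        refine Finset.sum_congr rfl fun r _ => ?_
        field_simp
    _ = ∑ r ∈ Finset.range M, (1 / M : ℝ) * ∫ ω, Real.exp (M * t * S r ω) ∂P := by
        rw [integral_finsetSum _ fun r _ => (hi r).const_mul _]
        simp_rw [integral_const_mul]
    _ ≤ ∑ r ∈ Finset.range M, (1 / M : ℝ) * c := by
        refine Finset.sum_le_sum fun r hr => ?_
        exact mul_le_mul_of_nonneg_left (hc r (Finset.mem_range.1 hr)) (by positivity)
    _ = c := by
        rw [Finset.sum_const, Finset.card_range, nsmul_eq_mul]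
        field_simp

/-- Chernoff bound for the sums of a centered bounded sequence that is independent along residue
classes modulo `M`. -/
lemma measure_sum_ge_le_exp {X : ℕ → Ω → ℝ} (hX : ∀ i, Measurable (X i)) {B v : ℝ}
    (hB : ∀ i ω, |X i ω| ≤ B) (h0 : ∀ i, ∫ ω, X i ω ∂P = 0) (hv : ∀ i, ∫ ω, X i ω ^ 2 ∂P ≤ v)
    {M : ℕ} (hM : 0 < M) (hind : ∀ r < M, iIndepFun (fun q => X (r + M * q)) P)
    {t : ℝ} (ht : 0 ≤ t) (htB : t * M * B ≤ 1) {j k : ℕ} (hjk : j ≤ k) (x : ℝ) :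
    P.real {ω | x ≤ ∑ i ∈ Finset.Icc j k, X i ω} ≤
      Real.exp (-t * x + (M * t) ^ 2 * v * (((k : ℝ) - j) / M + 2)) := by
  have hM' : (0 : ℝ) < M := by exact_mod_cast hM
  have hv0 : 0 ≤ v := (integral_nonneg fun ω => sq_nonneg (X 0 ω)).trans (hv 0)
  -- The quotients of the window's elements in the residue class `r`.
  let T : ℕ → Finset ℕ := fun r => (Finset.Icc (j / M) (k / M)).filter fun q =>
    j ≤ r + M * q ∧ r + M * q ≤ k
  let S : ℕ → Ω → ℝ := fun r ω => ∑ q ∈ T r, X (r + M * q) ω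
  have hsum : ∀ ω, ∑ i ∈ Finset.Icc j k, X i ω = ∑ r ∈ Finset.range M, S r ω := by
    intro ω
    rw [← Finset.sum_fiberwise_of_maps_to (t := Finset.range M) (g := fun i => i % M)
      (fun i _ => Finset.mem_range.2 (Nat.mod_lt _ hM))]
    refine Finset.sum_congr rfl fun r hr => ?_
    rw [Finset.mem_range] at hr
    refine Finset.sum_bij' (fun i _ => i / M) (fun q _ => r + M * q) ?_ ?_ ?_ ?_ ?_
    · intro i hi
      simp only [Finset.mem_filter, Finset.mem_Icc] at hi
      have := Nat.mod_add_div i M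
      rw [hi.2] at this
      simp only [T, Finset.mem_filter, Finset.mem_Icc, this]
      exact ⟨⟨Nat.div_le_div_right hi.1.1, Nat.div_le_div_right hi.1.2⟩, hi.1⟩
    · intro q hq
      simp only [T, Finset.mem_filter, Finset.mem_Icc] at hq
      simp only [Finset.mem_filter, Finset.mem_Icc]
      exact ⟨hq.2, by rw [Nat.add_mul_mod_self_left, Nat.mod_eq_of_lt hr]⟩
    · intro i hi
      simp only [Finset.mem_filter] at hi
      have := Nat.mod_add_div i M
      rwa [hi.2] at this
    · intro q _
      rw [Nat.add_mul_div_left _ _ hM, Nat.div_eq_of_lt hr, zero_add]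
    · intro i hi
      simp only [Finset.mem_filter] at hi
      have := Nat.mod_add_div i M
      rw [hi.2] at this
      rw [this]
  -- One of the two extra units counts an end point, the other pays for rounding `j / M` down.
  have hcard : ∀ r, ((T r).card : ℝ) ≤ ((k : ℝ) - j) / M + 2 := by
    intro r
    have h1 : (T r).card ≤ k / M + 1 - j / M := by
      refine (Finset.card_filter_le _ _).trans ?_
      simp
    have h2 : j / M ≤ k / M + 1 := (Nat.div_le_div_right hjk).trans (Nat.le_succ _)
    have h3 : ((T r).card : ℝ) ≤ ((k / M : ℕ) : ℝ) + 1 - ((j / M : ℕ) : ℝ) := by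
      have : ((T r).card : ℝ) ≤ ((k / M + 1 - j / M : ℕ) : ℝ) := by exact_mod_cast h1
      rwa [Nat.cast_sub h2, Nat.cast_add, Nat.cast_one] at this
    have h4 : ((k / M : ℕ) : ℝ) ≤ (k : ℝ) / M := Nat.cast_div_le
    have h5 : (j : ℝ) / M ≤ ((j / M : ℕ) : ℝ) + 1 := by
      rw [div_le_iff₀ hM']
      have := Nat.lt_div_mul_add (a := j) hM
      have h6 : (j : ℝ) < ((j / M * M + M : ℕ) : ℝ) := by exact_mod_cast this
      push_cast at h6
      linarith
    rw [sub_div]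
    linarith
  have hSm : ∀ r, Measurable (S r) := fun r => by fun_prop
  have hSb : ∀ r ω, |S r ω| ≤ (T r).card * B := by
    intro r ω
    refine (Finset.abs_sum_le_sum_abs _ _).trans ?_
    refine (Finset.sum_le_sum fun q _ => hB (r + M * q) ω).trans ?_
    simp
  have hmgf : ∀ r < M, ∫ ω, Real.exp (M * t * S r ω) ∂P ≤
      Real.exp ((M * t) ^ 2 * v * (((k : ℝ) - j) / M + 2)) := by
    intro r hr
    have e : (∑ q ∈ T r, fun ω => X (r + M * q) ω) = S r := by ext ω; simp [S]
    have h1 := (hind r hr).mgf_sum (t := M * t) (fun q => hX _) (T r)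
    change mgf (∑ q ∈ T r, fun ω => X (r + M * q) ω) P (M * t) = _ at h1
    rw [e] at h1
    change mgf (S r) P (M * t) ≤ _
    rw [h1]
    calc ∏ q ∈ T r, mgf (X (r + M * q)) P (M * t)
        ≤ ∏ q ∈ T r, Real.exp ((M * t) ^ 2 * v) := by
          refine Finset.prod_le_prod (fun _ _ => mgf_nonneg) fun q _ => ?_
          refine mgf_le_exp_sq (hX _) (hB _) (h0 _) (hv _) ?_
          rw [abs_of_nonneg (by positivity)]
          linarith
      _ = Real.exp ((T r).card * ((M * t) ^ 2 * v)) := by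
          rw [Finset.prod_const, Real.exp_nat_mul]
      _ ≤ _ := by
          refine Real.exp_le_exp.2 ?_
          rw [mul_comm]
          exact mul_le_mul_of_nonneg_left (hcard r) (by positivity)
  have hYm : Measurable fun ω => ∑ i ∈ Finset.Icc j k, X i ω := by fun_prop
  have hYb : ∀ ω, |∑ i ∈ Finset.Icc j k, X i ω| ≤ (Finset.Icc j k).card * B := by
    intro ω
    refine (Finset.abs_sum_le_sum_abs _ _).trans ?_
    refine (Finset.sum_le_sum fun i _ => hB i ω).trans ?_
    simp
  have hint := integrable_exp_of_abs_le (P := P) hYm hYb t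
  refine (measure_ge_le_exp_mul_mgf x ht hint).trans ?_
  rw [Real.exp_add]
  refine mul_le_mul_of_nonneg_left ?_ (Real.exp_pos _).le
  simp only [mgf, hsum]
  simp only [hsum] at hint
  exact integral_exp_sum_le hM (fun r => integrable_exp_of_abs_le (hSm r) (hSb r) _) hint hmgf

end Exponential

/-! ### Independence of disjoint blocks of innovations -/

section Blocks

variable {Ω : Type*} [MeasurableSpace Ω] {P : Measure Ω} [IsProbabilityMeasure P]
  {ν : Measure ℝ} [IsProbabilityMeasure ν] {ξ : ℤ → Ω → ℝ}

lemma map_iid_comp (hm : ∀ i, Measurable (ξ i)) (hi : iIndepFun ξ P) (hν : ∀ i, P.map (ξ i) = ν)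
    {α : Type*} {φ : α → ℤ} (hφ : φ.Injective) :
    P.map (fun ω a => ξ (φ a) ω) = iidLaw ν α := by
  have h := (hi.precomp hφ).map_fun_eq_infinitePi_map fun a => hm (φ a)
  have e : ∀ a, P.map (ξ (φ a)) = ν := fun a => hν _
  exact h.trans (by simp [iidLaw, e])

lemma map_past (hm : ∀ i, Measurable (ξ i)) (hi : iIndepFun ξ P) (hν : ∀ i, P.map (ξ i) = ν)
    (i : ℤ) : P.map (fun ω => past (fun j => ξ j ω) i) = iidLaw ν ℕ :=
  map_iid_comp hm hi hν (φ := fun j : ℕ => i - j) fun a b h => by simpa using h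

/-- Functions of the blocks of length `M` ending at times in a fixed residue class modulo `M` are
independent. -/
lemma iIndepFun_blocks (hm : ∀ i, Measurable (ξ i)) (hi : iIndepFun ξ P)
    (hν : ∀ i, P.map (ξ i) = ν) (M r : ℕ) {F : ℕ → (Fin M → ℝ) → ℝ} (hF : ∀ i, Measurable (F i)) :
    iIndepFun (fun q ω => F (r + M * q) fun l : Fin M => ξ (((r + M * q : ℕ) : ℤ) - (l : ℕ)) ω) P := by
  let φ : ℕ × Fin M → ℤ := fun a => ((r + M * a.1 : ℕ) : ℤ) - (a.2 : ℕ)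
  have hφ : φ.Injective := by
    rintro ⟨a, l⟩ ⟨b, l'⟩ h
    simp only [φ] at h
    push_cast at h
    have h1 := l.2
    have h2 := l'.2
    -- End points in one residue class are at least `M` apart and blocks have length `M`, so
    -- different blocks are disjoint.
    have hab : a = b := by
      by_contra hne
      rcases lt_or_gt_of_ne hne with hlt | hlt
      · have : (M : ℤ) * (a + 1) ≤ M * b := by
          exact mul_le_mul_of_nonneg_left (by exact_mod_cast hlt) (by positivity)
        nlinarith
      · have : (M : ℤ) * (b + 1) ≤ M * a := by
          exact mul_le_mul_of_nonneg_left (by exact_mod_cast hlt) (by positivity)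
        nlinarith
    subst hab
    have : (l : ℕ) = l' := by omega
    rw [Fin.ext this]
  have hlaw := map_iid_comp hm hi hν hφ
  have hblock : ∀ q, P.map (fun ω (l : Fin M) => ξ (φ (q, l)) ω) = iidLaw ν (Fin M) := fun q =>
    map_iid_comp hm hi hν (φ := fun l => φ (q, l)) fun l l' h => (Prod.mk.inj (hφ h)).2
  have hind : iIndepFun (fun q ω (l : Fin M) => ξ (φ (q, l)) ω) P := by
    -- Independence is read off the joint law: it is i.i.d. on `ℕ × Fin M`, and currying groups it
    -- into a product over blocks.
    rw [iIndepFun_iff_map_fun_eq_infinitePi_map fun q => measurable_pi_iff.2 fun l => hm _]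
    have hcur := Measure.infinitePi_map_curry (ι := ℕ) (κ := Fin M) (fun _ _ => ν)
    simp only [hblock]
    refine Eq.trans ?_ hcur
    change _ = (iidLaw ν (ℕ × Fin M)).map _
    rw [← hlaw, Measure.map_map (by fun_prop) (measurable_pi_iff.2 fun a => hm _)]
    rfl
  exact hind.comp (fun q => F (r + M * q)) fun q => hF _

end Blocks

/-! ### Maximal inequality for partial sums of a weakly dependent sequence -/

/-- Truncation at level `B`. -/
noncomputable def clamp (B x : ℝ) : ℝ := max (-B) (min x B)

lemma measurable_clamp (B : ℝ) : Measurable (clamp B) := by unfold clamp; fun_prop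

lemma abs_clamp_le {B : ℝ} (hB : 0 ≤ B) (x : ℝ) : |clamp B x| ≤ B := by
  unfold clamp
  exact abs_le.2 ⟨le_max_left _ _, max_le (by linarith) (min_le_right _ _)⟩

lemma clamp_of_abs_le {B x : ℝ} (h : |x| ≤ B) : clamp B x = x := by
  unfold clamp
  rw [min_eq_left (abs_le.1 h).2, max_eq_right (abs_le.1 h).1]

lemma abs_clamp_sub_clamp_le (B x y : ℝ) : |clamp B x - clamp B y| ≤ |x - y| := by
  unfold clamp
  refine (abs_max_sub_max_le_max _ _ _ _).trans ?_
  rw [sub_self, abs_zero]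
  refine max_le (abs_nonneg _) ((abs_min_sub_min_le_max _ _ _ _).trans ?_)
  rw [sub_self, abs_zero]
  exact max_le le_rfl (abs_nonneg _)

lemma abs_clamp_le_abs {B : ℝ} (hB : 0 ≤ B) (x : ℝ) : |clamp B x| ≤ |x| := by
  have := abs_clamp_sub_clamp_le B x 0
  rwa [clamp_of_abs_le (x := 0) (by simpa), sub_zero, sub_zero] at this

/-- Where truncation acts, `|x| > B`, so `|x| ≤ |x| (|x| / B)³`. A fourth moment thus controls the
truncation bias at rate `B⁻³`. -/
lemma abs_sub_clamp_le {B : ℝ} (hB : 0 < B) (x : ℝ) : |x - clamp B x| ≤ x ^ 4 / B ^ 3 := by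
  by_cases h : |x| ≤ B
  · rw [clamp_of_abs_le h, sub_self, abs_zero]; positivity
  · rw [not_le] at h
    have h1 : |x - clamp B x| ≤ |x| := by
      unfold clamp
      rcases le_total 0 x with h0 | h0
      · rw [abs_of_nonneg h0] at h ⊢
        rw [min_eq_right h.le, max_eq_right (by linarith), abs_of_nonneg (by linarith)]
        linarith
      · rw [abs_of_nonpos h0] at h ⊢
        rw [min_eq_left (by linarith), max_eq_left (by linarith), abs_of_nonpos (by linarith)]
        linarith
    refine h1.trans ?_
    rw [le_div_iff₀ (by positivity)]
    have h2 : x ^ 4 = |x| * |x| ^ 3 := by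
      rw [← Even.pow_abs (by decide : Even 4) x]; ring
    rw [h2]
    gcongr

section Maximal

variable {Ω : Type*} [MeasurableSpace Ω] {P : Measure Ω} [IsProbabilityMeasure P]
  {ν : Measure ℝ} [IsProbabilityMeasure ν] {ξ : ℤ → Ω → ℝ}

/-- A bound for all the windows of length at most `l`, for given truncation level, block length and
Chernoff parameter. -/
lemma measure_exists_window_le (hm : ∀ i, Measurable (ξ i)) (hi : iIndepFun ξ P)
    (hν : ∀ i, P.map (ξ i) = ν) {g : ℕ → (ℕ → ℝ) → ℝ} (hg : ∀ i, Measurable (g i))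
    (h0 : ∀ i, ∫ y, g i y ∂(iidLaw ν ℕ) = 0)
    (h4i : ∀ i, Integrable (fun y => g i y ^ 4) (iidLaw ν ℕ)) {A : ℝ}
    (h4 : ∀ i, ∫ y, g i y ^ 4 ∂(iidLaw ν ℕ) ≤ A) {C ρ : ℝ} (hC : 0 ≤ C) (hρ : ρ ∈ Ioo (0 : ℝ) 1)
    (hdep : ∀ i k, coordDep ν (g i) k ≤ ENNReal.ofReal (C * ρ ^ k))
    {M : ℕ} (hM : 0 < M) {B D t : ℝ} (hB : 0 < B) (hD : D = C * (1 - ρ)⁻¹ * ρ ^ M)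
    (ht : 0 ≤ t) (htB : t * M * (2 * B) ≤ 1) (n : ℕ) (l : ℝ) {x : ℝ}
    (hx : 0 ≤ x) :
    P.real {ω | ∃ j k : ℕ, 1 ≤ j ∧ k ≤ n ∧ (k : ℝ) - j ≤ l ∧
        x + 1 + n * (A / B ^ 3 + D) <
          |∑ i ∈ Finset.Icc j k, g i (past (fun a => ξ a ω) i)|} ≤
      n * (A / B ^ 4) + n * D +
        n ^ 2 * (2 * Real.exp (-t * x + (M * t) ^ 2 * (1 + A + 2 * B * D) * (l / M + 2))) := by
  have hD0 : 0 ≤ D := by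
    rw [hD]
    exact mul_nonneg (mul_nonneg hC (inv_nonneg.2 (by linarith [hρ.2]))) (pow_nonneg hρ.1.le _)
  have hgi : ∀ i, Integrable (g i) (iidLaw ν ℕ) := fun i => by
    refine Integrable.mono' ((integrable_const (1 : ℝ)).add (h4i i)) (hg i).aestronglyMeasurable
      (Eventually.of_forall fun y => ?_)
    rw [Real.norm_eq_abs]
    change |g i y| ≤ 1 + g i y ^ 4
    refine abs_le.2 ⟨?_, ?_⟩ <;> nlinarith [sq_nonneg (g i y ^ 2 - 1 / 2), sq_nonneg (g i y - 1 / 2),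
      sq_nonneg (g i y + 1 / 2)]
  have hg2i : ∀ i, Integrable (fun y => g i y ^ 2) (iidLaw ν ℕ) := fun i => by
    refine Integrable.mono' ((integrable_const (1 : ℝ)).add (h4i i))
      ((hg i).pow_const 2).aestronglyMeasurable (Eventually.of_forall fun y => ?_)
    rw [Real.norm_eq_abs, abs_of_nonneg (sq_nonneg _)]
    change g i y ^ 2 ≤ 1 + g i y ^ 4
    nlinarith [sq_nonneg (g i y ^ 2 - 1 / 2)]
  have hg2 : ∀ i, ∫ y, g i y ^ 2 ∂(iidLaw ν ℕ) ≤ 1 + A := fun i => by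
    calc ∫ y, g i y ^ 2 ∂(iidLaw ν ℕ) ≤ ∫ y, (1 + g i y ^ 4) ∂(iidLaw ν ℕ) := by
          refine integral_mono (hg2i i) ((integrable_const (1 : ℝ)).add (h4i i)) fun y => ?_
          nlinarith [sq_nonneg (g i y ^ 2 - 1 / 2)]
      _ = 1 + ∫ y, g i y ^ 4 ∂(iidLaw ν ℕ) := by
          rw [integral_add (integrable_const _) (h4i i)]; simp
      _ ≤ 1 + A := by linarith [h4 i]
  choose z hz using fun i => exists_frozen_tail (hg i) (hgi i) hC hρ (hdep i) M
  have hzm : ∀ i, Measurable fun y : ℕ → ℝ => splice M y (z i) := fun i =>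
    (measurable_splice M).comp (measurable_id.prodMk measurable_const)
  have hdm : ∀ i, Measurable fun y => g i y - g i (splice M y (z i)) := fun i =>
    (hg i).sub ((hg i).comp (hzm i))
  have hdi : ∀ i, Integrable (fun y => g i y - g i (splice M y (z i))) (iidLaw ν ℕ) := fun i =>
    ⟨(hdm i).aestronglyMeasurable, (hz i).trans_lt ENNReal.ofReal_lt_top⟩
  have hdD : ∀ i, ∫ y, |g i y - g i (splice M y (z i))| ∂(iidLaw ν ℕ) ≤ D := fun i => by
    have h := integral_norm_eq_lintegral_enorm (hdi i).1
    simp only [Real.norm_eq_abs] at h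
    rw [h]
    refine ENNReal.toReal_le_of_le_ofReal hD0 ?_
    rw [hD]
    exact hz i
  have hpm : ∀ i : ℤ, Measurable fun ω => past (fun a => ξ a ω) i := fun i =>
    measurable_pi_iff.2 fun j => hm _
  have htr : ∀ (i : ℕ) (f : (ℕ → ℝ) → ℝ), Measurable f →
      ∫ ω, f (past (fun a => ξ a ω) i) ∂P = ∫ y, f y ∂(iidLaw ν ℕ) := fun i f hf => by
    rw [← map_past hm hi hν i, integral_map (hpm i).aemeasurable hf.aestronglyMeasurable]
  have htri : ∀ (i : ℕ) (f : (ℕ → ℝ) → ℝ), Integrable f (iidLaw ν ℕ) →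
      Integrable (fun ω => f (past (fun a => ξ a ω) i)) P := fun i f hf => by
    rw [← map_past hm hi hν i] at hf
    exact hf.comp_measurable (hpm i)
  -- Frozen and truncated: a bounded function of the last `M` innovations.
  let w : ℕ → (ℕ → ℝ) → ℝ := fun i y => clamp B (g i (splice M y (z i)))
  have hwm : ∀ i, Measurable (w i) := fun i =>
    (measurable_clamp B).comp ((hg i).comp (hzm i))
  have hwb : ∀ i y, |w i y| ≤ B := fun i y => abs_clamp_le hB.le _
  have hwi : ∀ i, Integrable (w i) (iidLaw ν ℕ) := fun i => integrable_of_abs_le (hwm i) (hwb i)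
  have hcm : ∀ i, Measurable fun y => clamp B (g i y) := fun i => (measurable_clamp B).comp (hg i)
  have hci : ∀ i, Integrable (fun y => clamp B (g i y)) (iidLaw ν ℕ) := fun i =>
    integrable_of_abs_le (hcm i) fun y => abs_clamp_le hB.le _
  have hcw : ∀ i y, |clamp B (g i y) - w i y| ≤ |g i y - g i (splice M y (z i))| := fun i y =>
    abs_clamp_sub_clamp_le _ _ _
  let μ : ℕ → ℝ := fun i => ∫ y, w i y ∂(iidLaw ν ℕ)
  have hμB : ∀ i, |μ i| ≤ B := fun i => by
    have := norm_integral_le_of_norm_le_const (μ := iidLaw ν ℕ) (f := w i) (C := B)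
      (Eventually.of_forall fun y => by simpa using hwb i y)
    simpa using this
  -- As `g i` is centred, the mean of `w i` can only come from truncation (`A / B ^ 3`) and from
  -- freezing (`D`).
  have hμ : ∀ i, |μ i| ≤ A / B ^ 3 + D := fun i => by
    have e : μ i = -(∫ y, (g i y - clamp B (g i y)) ∂(iidLaw ν ℕ)) -
        ∫ y, (clamp B (g i y) - w i y) ∂(iidLaw ν ℕ) := by
      rw [integral_sub (hgi i) (hci i), integral_sub (hci i) (hwi i), h0 i]
      simp only [μ]
      ring
    have b1 : |∫ y, (g i y - clamp B (g i y)) ∂(iidLaw ν ℕ)| ≤ A / B ^ 3 := by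
      calc |∫ y, (g i y - clamp B (g i y)) ∂(iidLaw ν ℕ)|
          ≤ ∫ y, g i y ^ 4 / B ^ 3 ∂(iidLaw ν ℕ) := by
            rw [← Real.norm_eq_abs]
            exact norm_integral_le_of_norm_le ((h4i i).div_const _)
              (Eventually.of_forall fun y => abs_sub_clamp_le hB _)
        _ ≤ A / B ^ 3 := by
            rw [integral_div]
            exact div_le_div_of_nonneg_right (h4 i) (by positivity)
    have b2 : |∫ y, (clamp B (g i y) - w i y) ∂(iidLaw ν ℕ)| ≤ D := by
      rw [← Real.norm_eq_abs]
      exact (norm_integral_le_of_norm_le (hdi i).abs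
        (Eventually.of_forall fun y => hcw i y)).trans (hdD i)
    rw [e]
    have := abs_sub (-(∫ y, (g i y - clamp B (g i y)) ∂(iidLaw ν ℕ)))
      (∫ y, (clamp B (g i y) - w i y) ∂(iidLaw ν ℕ))
    rw [abs_neg] at this
    linarith
  -- Freezing changes the second moment of the truncated variable by at most `2 * B * D`: the
  -- squares of two numbers bounded by `B` differ by at most `2 * B` times their distance.
  have hw2 : ∀ i, ∫ y, (w i y - μ i) ^ 2 ∂(iidLaw ν ℕ) ≤ 1 + A + 2 * B * D := fun i => by
    have i2 : Integrable (fun y => w i y ^ 2) (iidLaw ν ℕ) :=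
      integrable_of_abs_le (B := B ^ 2) ((hwm i).pow_const 2) fun y => by
        rw [abs_pow]; exact pow_le_pow_left₀ (abs_nonneg _) (hwb i y) 2
    calc ∫ y, (w i y - μ i) ^ 2 ∂(iidLaw ν ℕ)
        = ∫ y, (w i y ^ 2 - 2 * μ i * w i y + μ i ^ 2) ∂(iidLaw ν ℕ) := by
          congr 1; ext y; ring
      _ = (∫ y, w i y ^ 2 ∂(iidLaw ν ℕ)) - μ i ^ 2 := by
          have i3 : Integrable (fun y => w i y ^ 2 - 2 * μ i * w i y) (iidLaw ν ℕ) :=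
            i2.sub ((hwi i).const_mul _)
          rw [integral_add i3 (integrable_const _), integral_sub i2 ((hwi i).const_mul _),
            integral_const_mul]
          simp only [integral_const, probReal_univ, one_smul]
          change _ - 2 * μ i * μ i + _ = _
          ring
      _ ≤ ∫ y, w i y ^ 2 ∂(iidLaw ν ℕ) := by linarith [sq_nonneg (μ i)]
      _ ≤ ∫ y, (g i y ^ 2 + 2 * B * |g i y - g i (splice M y (z i))|) ∂(iidLaw ν ℕ) := by
          refine integral_mono i2 ((hg2i i).add ((hdi i).abs.const_mul _)) fun y => ?_
          have a1 := abs_le.1 (hcw i y)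
          have a2 := abs_le.1 (hwb i y)
          have a3 : |clamp B (g i y)| ≤ B := abs_clamp_le hB.le _
          have a4 : clamp B (g i y) ^ 2 ≤ g i y ^ 2 := sq_le_sq.2 (abs_clamp_le_abs hB.le _)
          have a5 : w i y ^ 2 - clamp B (g i y) ^ 2 ≤
              2 * B * |g i y - g i (splice M y (z i))| := by
            calc w i y ^ 2 - clamp B (g i y) ^ 2
                ≤ |(w i y + clamp B (g i y)) * (clamp B (g i y) - w i y)| := by
                  rw [← abs_neg]
                  exact (le_of_eq (by ring)).trans (le_abs_self _)
              _ = |w i y + clamp B (g i y)| * |clamp B (g i y) - w i y| := abs_mul _ _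
              _ ≤ (2 * B) * |g i y - g i (splice M y (z i))| := by
                  refine mul_le_mul ?_ (hcw i y) (abs_nonneg _) (by positivity)
                  exact (abs_add_le _ _).trans (by linarith [hwb i y])
          simp only
          linarith
      _ ≤ 1 + A + 2 * B * D := by
          rw [integral_add (hg2i i) ((hdi i).abs.const_mul _), integral_const_mul]
          have := mul_le_mul_of_nonneg_left (hdD i) (by positivity : 0 ≤ 2 * B)
          linarith [hg2 i]
  let X : ℕ → Ω → ℝ := fun i ω => w i (past (fun a => ξ a ω) i) - μ i
  have hXm : ∀ i, Measurable (X i) := fun i => ((hwm i).comp (hpm i)).sub_const _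
  have hXb : ∀ i ω, |X i ω| ≤ 2 * B := fun i ω =>
    (abs_sub _ _).trans (by linarith [hwb i (past (fun a => ξ a ω) i), hμB i])
  have hX0 : ∀ i, ∫ ω, X i ω ∂P = 0 := fun i => by
    rw [htr i (fun y => w i y - μ i) ((hwm i).sub_const _), integral_sub (hwi i) (integrable_const _)]
    simp [μ]
  have hX2 : ∀ i, ∫ ω, X i ω ^ 2 ∂P ≤ 1 + A + 2 * B * D := fun i => by
    rw [htr i (fun y => (w i y - μ i) ^ 2) (((hwm i).sub_const _).pow_const 2)]
    exact hw2 i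
  -- `X i` written as a function of `M` innovations, in the form required by `iIndepFun_blocks`.
  let F : ℕ → (Fin M → ℝ) → ℝ := fun i v =>
    clamp B (g i fun j => if h : j < M then v ⟨j, h⟩ else z i j) - μ i
  have hF : ∀ i, Measurable (F i) := fun i => by
    refine ((measurable_clamp B).comp ((hg i).comp (measurable_pi_iff.2 fun j => ?_))).sub_const _
    by_cases h : j < M <;> simp only [h, dite_true, dite_false] <;> fun_prop
  have hXF : ∀ (i : ℕ) ω, X i ω = F i fun l : Fin M => ξ ((i : ℤ) - (l : ℕ)) ω := fun i ω => by
    simp only [X, F, w]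
    congr 3
  have hind : ∀ r < M, iIndepFun (fun q => X (r + M * q)) P := fun r _ => by
    have := iIndepFun_blocks hm hi hν M r hF
    refine this.congr fun q => Eventually.of_forall fun ω => ?_
    exact (hXF _ _).symm
  have hindneg : ∀ r < M, iIndepFun (fun q ω => -X (r + M * q) ω) P := fun r hr =>
    (hind r hr).comp (fun _ a => -a) fun _ => measurable_neg
  let E : ℕ → ℕ → ℝ := fun _ _ =>
    Real.exp (-t * x + (M * t) ^ 2 * (1 + A + 2 * B * D) * (l / M + 2))
  have hv0 : 0 ≤ 1 + A + 2 * B * D := (integral_nonneg fun ω => sq_nonneg (X 0 ω)).trans (hX2 0)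
  have hcher : ∀ j k : ℕ, j ≤ k → (k : ℝ) - j ≤ l →
      P.real {ω | x ≤ |∑ i ∈ Finset.Icc j k, X i ω|} ≤ 2 * E j k := fun j k hjk hl => by
    have hmono : Real.exp (-t * x + (M * t) ^ 2 * (1 + A + 2 * B * D) * (((k : ℝ) - j) / M + 2)) ≤
        E j k := by
      refine Real.exp_le_exp.2 ?_
      gcongr
    have c1 := (measure_sum_ge_le_exp hXm hXb hX0 hX2 hM hind ht htB hjk x).trans hmono
    have c2 := (measure_sum_ge_le_exp (X := fun i ω => -X i ω) (fun i => (hXm i).neg)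
      (fun i ω => by rw [abs_neg]; exact hXb i ω)
      (fun i => by rw [integral_neg, hX0 i, neg_zero])
      (fun i => by simpa using hX2 i) hM hindneg ht htB hjk x).trans hmono
    have hsub : {ω | x ≤ |∑ i ∈ Finset.Icc j k, X i ω|} ⊆
        {ω | x ≤ ∑ i ∈ Finset.Icc j k, X i ω} ∪ {ω | x ≤ ∑ i ∈ Finset.Icc j k, -X i ω} := by
      intro ω hω
      rcases le_abs.1 (show x ≤ |∑ i ∈ Finset.Icc j k, X i ω| from hω) with h | h
      · exact Or.inl h
      · right
        rw [mem_ofPred_eq, Finset.sum_neg_distrib]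
        exact h
    have := (measureReal_mono (μ := P) hsub).trans (measureReal_union_le _ _)
    linarith
  have hbig : ∀ i : ℕ, P.real {ω | B ^ 4 ≤ g i (past (fun a => ξ a ω) i) ^ 4} ≤ A / B ^ 4 :=
    fun i => by
    have := mul_meas_ge_le_integral_of_nonneg (μ := P)
      (f := fun ω => g i (past (fun a => ξ a ω) i) ^ 4)
      (Eventually.of_forall fun ω => by positivity) (htri i _ (h4i i)) (B ^ 4)
    rw [htr i _ ((hg i).pow_const 4)] at this
    rw [le_div_iff₀ (by positivity)]
    linarith [h4 i]
  let R : Ω → ℝ := fun ω => ∑ i ∈ Finset.Icc 1 n,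
    |g i (past (fun a => ξ a ω) i) - g i (splice M (past (fun a => ξ a ω) i) (z i))|
  have hRi : ∀ i ∈ Finset.Icc 1 n, Integrable (fun ω =>
      |g i (past (fun a => ξ a ω) i) - g i (splice M (past (fun a => ξ a ω) i) (z i))|) P :=
    fun i _ => (htri i _ (hdi i)).abs
  have hR : P.real {ω | 1 ≤ R ω} ≤ n * D := by
    have := mul_meas_ge_le_integral_of_nonneg (μ := P) (f := R)
      (Eventually.of_forall fun ω => Finset.sum_nonneg fun i _ => abs_nonneg _)
      (integrable_finsetSum _ hRi) 1
    rw [one_mul, integral_finsetSum _ hRi] at this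
    refine this.trans ?_
    calc _ ≤ ∑ i ∈ Finset.Icc 1 n, D := Finset.sum_le_sum fun i _ => by
          rw [htr i (fun y => |g i y - g i (splice M y (z i))|) (hdm i).abs]
          exact hdD i
      _ = n * D := by simp
  set bad : Set Ω := {ω | ∃ j k : ℕ, 1 ≤ j ∧ k ≤ n ∧ (k : ℝ) - j ≤ l ∧
        x + 1 + n * (A / B ^ 3 + D) <
          |∑ i ∈ Finset.Icc j k, g i (past (fun a => ξ a ω) i)|} with hbad
  let pairs : Finset (ℕ × ℕ) := (Finset.Icc 1 n ×ˢ Finset.Icc 1 n).filter fun a =>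
    a.1 ≤ a.2 ∧ (a.2 : ℝ) - a.1 ≤ l
  -- Off these events no truncation is active, the total freezing error is below `1` and every
  -- centred window sum is below `x`; only the means remain, at most `n * (A / B ^ 3 + D)` in total.
  have hsub : bad ⊆ (⋃ i ∈ Finset.Icc 1 n, {ω | B ^ 4 ≤ g i (past (fun a => ξ a ω) i) ^ 4}) ∪
      {ω | 1 ≤ R ω} ∪ ⋃ a ∈ pairs, {ω | x ≤ |∑ i ∈ Finset.Icc a.1 a.2, X i ω|} := by
    rintro ω ⟨j, k, hj, hk, hl, hlt⟩
    by_contra hno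
    simp only [mem_union, mem_iUnion, mem_ofPred_eq, not_or, not_exists, not_le] at hno
    obtain ⟨⟨n1, n2⟩, n3⟩ := hno
    have hjk : j ≤ k := by
      by_contra hjk
      rw [Finset.Icc_eq_empty hjk, Finset.sum_empty, abs_zero] at hlt
      have : 0 ≤ A / B ^ 3 + D := (abs_nonneg _).trans (hμ 0)
      have : 0 ≤ n * (A / B ^ 3 + D) := by positivity
      linarith
    have hs := n3 (j, k) (by
      simp only [pairs, Finset.mem_filter, Finset.mem_product, Finset.mem_Icc]
      exact ⟨⟨⟨hj, hjk.trans hk⟩, ⟨hj.trans hjk, hk⟩⟩, hjk, hl⟩)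
    simp only at hs
    have hIcc : Finset.Icc j k ⊆ Finset.Icc 1 n := Finset.Icc_subset_Icc hj hk
    have hdec : ∀ i ∈ Finset.Icc j k, |g i (past (fun a => ξ a ω) i) - X i ω| ≤
        |g i (past (fun a => ξ a ω) i) - g i (splice M (past (fun a => ξ a ω) i) (z i))| +
          (A / B ^ 3 + D) := fun i hik => by
      have hc : clamp B (g i (past (fun a => ξ a ω) i)) = g i (past (fun a => ξ a ω) i) := by
        refine clamp_of_abs_le ?_
        by_contra hcon
        rw [not_le] at hcon
        have := n1 i (hIcc hik)
        rw [← Even.pow_abs (by decide : Even 4) (g i _)] at this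
        exact absurd this (not_lt.2 (pow_le_pow_left₀ hB.le hcon.le 4))
      have := hcw i (past (fun a => ξ a ω) i)
      rw [hc] at this
      have e : g i (past (fun a => ξ a ω) i) - X i ω =
          (g i (past (fun a => ξ a ω) i) - w i (past (fun a => ξ a ω) i)) + μ i := by
        simp only [X]; ring
      rw [e]
      exact (abs_add_le _ _).trans (add_le_add this (hμ i))
    have hcount : ((Finset.Icc j k).card : ℝ) ≤ n := by
      have := Finset.card_le_card hIcc
      simp only [Nat.card_Icc, Nat.add_sub_cancel] at this
      rw [Nat.card_Icc]
      exact_mod_cast this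
    have hfin : |∑ i ∈ Finset.Icc j k, g i (past (fun a => ξ a ω) i)| ≤
        |∑ i ∈ Finset.Icc j k, X i ω| + (R ω + n * (A / B ^ 3 + D)) := by
      have e : ∑ i ∈ Finset.Icc j k, g i (past (fun a => ξ a ω) i) =
          ∑ i ∈ Finset.Icc j k, X i ω +
            ∑ i ∈ Finset.Icc j k, (g i (past (fun a => ξ a ω) i) - X i ω) := by
        rw [← Finset.sum_add_distrib]
        exact Finset.sum_congr rfl fun i _ => by ring
      rw [e]
      refine (abs_add_le _ _).trans (add_le_add le_rfl ?_)
      refine (Finset.abs_sum_le_sum_abs _ _).trans ((Finset.sum_le_sum hdec).trans ?_)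
      rw [Finset.sum_add_distrib, Finset.sum_const, nsmul_eq_mul]
      have h1 : 0 ≤ A / B ^ 3 + D := (abs_nonneg _).trans (hμ 0)
      exact add_le_add (Finset.sum_le_sum_of_subset_of_nonneg hIcc fun _ _ _ => abs_nonneg _)
        (mul_le_mul_of_nonneg_right hcount h1)
    linarith
  have hpairs : (pairs.card : ℝ) ≤ n ^ 2 := by
    have : pairs.card ≤ n * n := by
      refine (Finset.card_filter_le _ _).trans ?_
      simp
    rw [sq]
    exact_mod_cast this
  calc P.real bad ≤ _ := measureReal_mono hsub
    _ ≤ _ := (measureReal_union_le _ _).trans (add_le_add_left (measureReal_union_le _ _) _)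
    _ ≤ n * (A / B ^ 4) + n * D +
        n ^ 2 * (2 * Real.exp (-t * x + (M * t) ^ 2 * (1 + A + 2 * B * D) * (l / M + 2))) := by
      refine add_le_add (add_le_add ?_ hR) ?_
      · refine (measureReal_biUnion_finset_le _ _).trans ?_
        refine (Finset.sum_le_sum fun i _ => hbig i).trans ?_
        simp
      · refine (measureReal_biUnion_finset_le _ _).trans ?_
        refine (Finset.sum_le_sum fun a ha => hcher a.1 a.2 ?_ ?_).trans ?_
        · exact (Finset.mem_filter.1 ha).2.1
        · exact (Finset.mem_filter.1 ha).2.2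
        · simp only [E]
          rw [Finset.sum_const, nsmul_eq_mul]
          exact mul_le_mul_of_nonneg_right hpairs (by positivity)

end Maximal

/-! ### Choice of truncation level, block length and Chernoff parameter -/

section Maximal

variable {Ω : Type*} [MeasurableSpace Ω] {P : Measure Ω} [IsProbabilityMeasure P]
  {ν : Measure ℝ} [IsProbabilityMeasure ν] {ξ : ℤ → Ω → ℝ}

lemma tendsto_natCast_rpow_atTop {a : ℝ} (ha : 0 < a) :
    Tendsto (fun n : ℕ => (n : ℝ) ^ a) atTop atTop :=
  (tendsto_rpow_atTop ha).comp tendsto_natCast_atTop_atTop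

lemma eventually_mul_log_add_le (c : ℝ) {a : ℝ} (ha : 0 < a) :
    ∀ᶠ n : ℕ in atTop, 2 * (c * Real.log n + 1) ≤ (n : ℝ) ^ a := by
  have h1 : (fun x : ℝ => 2 * (c * Real.log x + 1)) =o[atTop] fun x => x ^ a := by
    refine IsLittleO.const_mul_left (IsLittleO.add
      ((isLittleO_log_rpow_atTop ha).const_mul_left c) ?_) 2
    exact isLittleO_const_left.2 (Or.inr (tendsto_norm_atTop_atTop.comp (tendsto_rpow_atTop ha)))
  have h2 := (h1.bound one_pos).natCast_atTop
  filter_upwards [h2] with n hn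
  rw [one_mul, Real.norm_eq_abs, Real.norm_eq_abs,
    abs_of_nonneg (Real.rpow_nonneg (Nat.cast_nonneg n) a)] at hn
  exact (le_abs_self _).trans hn

/-- With high probability the sums over all windows of length at most `l` are of order
`√l log n`. -/
lemma exists_window_bound (hm : ∀ i, Measurable (ξ i)) (hi : iIndepFun ξ P)
    (hν : ∀ i, P.map (ξ i) = ν) {g : ℕ → ℕ → (ℕ → ℝ) → ℝ} (hg : ∀ n i, Measurable (g n i))
    (h0 : ∀ n i, ∫ y, g n i y ∂(iidLaw ν ℕ) = 0)
    (h4i : ∀ n i, Integrable (fun y => g n i y ^ 4) (iidLaw ν ℕ)) {A : ℝ}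
    (h4 : ∀ n i, ∫ y, g n i y ^ 4 ∂(iidLaw ν ℕ) ≤ A) {C ρ : ℝ} (hC : 0 ≤ C)
    (hρ : ρ ∈ Ioo (0 : ℝ) 1)
    (hdep : ∀ n i k, coordDep ν (g n i) k ≤ ENNReal.ofReal (C * ρ ^ k)) :
    ∃ c > 0, ∃ r : ℕ → ℝ, Tendsto r atTop (𝓝 0) ∧ ∀ᶠ n : ℕ in atTop, ∀ l : ℝ,
      (n : ℝ) ^ (3 / 4 : ℝ) ≤ l →
      P.real {ω | ∃ j k : ℕ, 1 ≤ j ∧ k ≤ n ∧ (k : ℝ) - j ≤ l ∧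
        c * (Real.sqrt l * Real.log n) <
          |∑ i ∈ Finset.Icc j k, g n i (past (fun a => ξ a ω) i)|} ≤ r n := by
  have hA : 0 ≤ A := (integral_nonneg fun y => by positivity).trans (h4 0 0)
  have hlρ : Real.log ρ < 0 := Real.log_neg hρ.1 hρ.2
  -- With this constant, blocks of length at least `c1 * log n` give `ρ ^ M ≤ n⁻²`.
  set c1 : ℝ := 2 / -Real.log ρ with hc1
  have hc1' : 0 < c1 := div_pos two_pos (by linarith)
  set K0 : ℝ := C * (1 - ρ)⁻¹ with hK0
  have hK0' : 0 ≤ K0 := mul_nonneg hC (inv_nonneg.2 (by linarith [hρ.2]))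
  -- The variance term of the Chernoff exponent is at most `(2 + A) * c1 * log n` up to a constant.
  -- This leaves `-3 log n`, enough against the `n²` windows.
  set c2 : ℝ := 3 + (2 + A) * c1 with hc2
  have hc2' : 0 < c2 := by positivity
  refine ⟨c2 + 1, by linarith, fun n => A * (n : ℝ) ^ (-(1 / 4) : ℝ) +
    (K0 + 2 * Real.exp (3 * (2 + A))) * ((n : ℝ))⁻¹, ?_, ?_⟩
  · have t1 : Tendsto (fun n : ℕ => (n : ℝ) ^ (-(1 / 4) : ℝ)) atTop (𝓝 0) :=
      (tendsto_rpow_neg_atTop (by norm_num : (0 : ℝ) < 1 / 4)).comp tendsto_natCast_atTop_atTop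
    have t2 : Tendsto (fun n : ℕ => ((n : ℝ))⁻¹) atTop (𝓝 0) := tendsto_inv_atTop_nhds_zero_nat
    simpa using (t1.const_mul A).add (t2.const_mul (K0 + 2 * Real.exp (3 * (2 + A))))
  have ev1 := eventually_mul_log_add_le c1 (a := 1 / 16) (by norm_num)
  have ev2 := (tendsto_natCast_rpow_atTop (a := 5 / 16) (by norm_num)).eventually_ge_atTop (1 + A + K0)
  have ev3 := (tendsto_natCast_atTop_atTop (R := ℝ)).eventually_ge_atTop (2 * K0)
  have ev4 := (Real.tendsto_log_atTop.comp (tendsto_natCast_atTop_atTop (R := ℝ))).eventually_ge_atTop 1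
  filter_upwards [ev1, ev2, ev3, ev4, eventually_ge_atTop 1] with n e1 e2 e3 e4 e5 l hl
  simp only [Function.comp_apply] at e4
  have hN1 : (1 : ℝ) ≤ n := by exact_mod_cast e5
  set x : ℝ := (n : ℝ) with hx
  have hx0 : 0 < x := by linarith
  have hl0 : 0 < l := (Real.rpow_pos_of_pos hx0 _).trans_le hl
  have hsl : x ^ (3 / 8 : ℝ) ≤ Real.sqrt l := by
    refine Real.le_sqrt_of_sq_le ?_
    rw [← Real.rpow_natCast, ← Real.rpow_mul hx0.le]
    refine le_trans (le_of_eq ?_) hl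
    norm_num
  have hslpos : 0 < Real.sqrt l := Real.sqrt_pos.2 hl0
  set M : ℕ := ⌈c1 * Real.log x⌉₊ with hM
  have hM0 : 0 < M := Nat.ceil_pos.2 (by positivity)
  have hMle : (M : ℝ) ≤ c1 * Real.log x + 1 := (Nat.ceil_lt_add_one (by positivity)).le
  have hMge : c1 * Real.log x ≤ M := Nat.le_ceil _
  -- The exponent `5/16` meets three demands: `n / B⁴ = n^(-1/4)` tends to zero, `n / B³ = n^(1/16)`
  -- is negligible against `√l ≥ n^(3/8)`, and `M * 2B ≤ n^(1/16) * n^(5/16) ≤ √l` admits the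
  -- parameter `t = 1/√l`.
  set B : ℝ := x ^ (5 / 16 : ℝ) with hB
  have hB1 : 1 ≤ B := Real.one_le_rpow hN1 (by norm_num)
  have hB0 : 0 < B := by linarith
  set D : ℝ := K0 * ρ ^ M with hD
  have hρM : ρ ^ M ≤ (x ^ 2)⁻¹ := by
    rw [← Real.exp_log hρ.1, ← Real.exp_nat_mul, ← Real.exp_log (by positivity : 0 < (x ^ 2)⁻¹),
      Real.log_inv, Real.log_pow]
    refine Real.exp_le_exp.2 ?_
    have : c1 * Real.log x * Real.log ρ = -(2 * Real.log x) := by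
      rw [hc1, div_neg, neg_mul, neg_mul, mul_right_comm, div_mul_cancel₀ _ hlρ.ne]
    have h2 := mul_le_mul_of_nonpos_right hMge hlρ.le
    push_cast
    linarith
  have hDle : D ≤ K0 * (x ^ 2)⁻¹ := mul_le_mul_of_nonneg_left hρM hK0'
  have hD0 : 0 ≤ D := mul_nonneg hK0' (pow_nonneg hρ.1.le _)
  have h2MB : M * (2 * B) ≤ Real.sqrt l := by
    refine le_trans ?_ hsl
    have : x ^ (3 / 8 : ℝ) = x ^ (1 / 16 : ℝ) * B := by
      rw [hB, ← Real.rpow_add hx0]; norm_num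
    rw [this]
    nlinarith
  set t : ℝ := (Real.sqrt l)⁻¹ with ht
  have ht0 : 0 ≤ t := inv_nonneg.2 hslpos.le
  have htB : t * M * (2 * B) ≤ 1 := by
    rw [ht, mul_assoc, inv_mul_le_iff₀ hslpos, mul_one]
    exact h2MB
  -- The deterministic offsets are absorbed by one additional multiple of `√l log n`.
  have hoff : c2 * (Real.sqrt l * Real.log x) + 1 + x * (A / B ^ 3 + D) ≤
      (c2 + 1) * (Real.sqrt l * Real.log x) := by
    have b1 : x * (A / B ^ 3) = A * x ^ (1 / 16 : ℝ) := by
      have : x = x ^ (1 / 16 : ℝ) * B ^ 3 := by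
        rw [hB, ← Real.rpow_natCast, ← Real.rpow_mul hx0.le, ← Real.rpow_add hx0]
        norm_num
      rw [mul_div_assoc', div_eq_iff (by positivity)]
      nth_rewrite 1 [this]
      ring
    have b2 : x * D ≤ K0 := by
      have : x * D ≤ x * (K0 * (x ^ 2)⁻¹) := mul_le_mul_of_nonneg_left hDle hx0.le
      refine this.trans ?_
      have e : x * (K0 * (x ^ 2)⁻¹) = K0 / x := by field_simp
      rw [e]
      exact div_le_self hK0' hN1
    have b3 : 1 ≤ x ^ (1 / 16 : ℝ) := Real.one_le_rpow hN1 (by norm_num)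
    have b4 : 1 + A * x ^ (1 / 16 : ℝ) + K0 ≤ x ^ (3 / 8 : ℝ) := by
      have : x ^ (3 / 8 : ℝ) = x ^ (1 / 16 : ℝ) * B := by
        rw [hB, ← Real.rpow_add hx0]; norm_num
      rw [this]
      nlinarith
    have b5 : Real.sqrt l ≤ Real.sqrt l * Real.log x := le_mul_of_one_le_right hslpos.le e4
    rw [mul_add, b1]
    linarith
  have key := measure_exists_window_le hm hi hν (hg n) (h0 n) (h4i n) (h4 n) hC hρ (hdep n) hM0 hB0
    (D := D) (t := t) (by rw [hD]) ht0 htB n l (x := c2 * (Real.sqrt l * Real.log x)) (by positivity)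
  refine (measureReal_mono ?_).trans (key.trans ?_)
  · rintro ω ⟨j, k, hj, hk, hjk, hlt⟩
    exact ⟨j, k, hj, hk, hjk, hoff.trans_lt hlt⟩
  have p1 : x * (A / B ^ 4) = A * x ^ (-(1 / 4) : ℝ) := by
    have : x = x ^ (-(1 / 4) : ℝ) * B ^ 4 := by
      rw [hB, ← Real.rpow_natCast, ← Real.rpow_mul hx0.le, ← Real.rpow_add hx0]
      norm_num
    rw [mul_div_assoc', div_eq_iff (by positivity)]
    nth_rewrite 1 [this]
    ring
  have p2 : x * D ≤ K0 * x⁻¹ := by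
    have : x * D ≤ x * (K0 * (x ^ 2)⁻¹) := mul_le_mul_of_nonneg_left hDle hx0.le
    refine this.trans (le_of_eq ?_)
    field_simp
  have p3 : x ^ 2 * (2 * Real.exp (-t * (c2 * (Real.sqrt l * Real.log x)) +
      (M * t) ^ 2 * (1 + A + 2 * B * D) * (l / M + 2))) ≤ 2 * Real.exp (3 * (2 + A)) * x⁻¹ := by
    have q1 : -t * (c2 * (Real.sqrt l * Real.log x)) = -(c2 * Real.log x) := by
      rw [ht]; field_simp
    have hMr : (0 : ℝ) < M := by exact_mod_cast hM0
    have q2 : (M * t) ^ 2 * (l / M + 2) = M + 2 * (M * t) ^ 2 := by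
      have : t ^ 2 = l⁻¹ := by rw [ht, inv_pow, Real.sq_sqrt hl0.le]
      rw [mul_pow, this]; field_simp
    have q3 : M * t ≤ 1 := by
      have : t * M ≤ t * M * (2 * B) := le_mul_of_one_le_right (by positivity) (by linarith)
      linarith
    have q4 : 1 + A + 2 * B * D ≤ 2 + A := by
      have : B ≤ x := by
        rw [hB]
        calc x ^ (5 / 16 : ℝ) ≤ x ^ (1 : ℝ) := Real.rpow_le_rpow_of_exponent_le hN1 (by norm_num)
          _ = x := Real.rpow_one x
      have h1 : 2 * B * D ≤ 2 * x * (K0 * (x ^ 2)⁻¹) := by gcongr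
      have h2 : 2 * x * (K0 * (x ^ 2)⁻¹) = 2 * K0 / x := by field_simp
      have h3 : 2 * K0 / x ≤ 1 := by rw [div_le_one hx0]; exact e3
      linarith
    have q5 : (M * t) ^ 2 * (1 + A + 2 * B * D) * (l / M + 2) ≤
        (2 + A) * (c1 * Real.log x + 3) := by
      rw [mul_right_comm, q2, mul_comm]
      have : (M * t) ^ 2 ≤ 1 := pow_le_one₀ (by positivity) q3
      refine mul_le_mul q4 (by linarith) (by positivity) (by positivity)
    calc x ^ 2 * (2 * Real.exp (-t * (c2 * (Real.sqrt l * Real.log x)) +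
          (M * t) ^ 2 * (1 + A + 2 * B * D) * (l / M + 2)))
        ≤ x ^ 2 * (2 * Real.exp (-(3 : ℕ) * Real.log x + 3 * (2 + A))) := by
          refine mul_le_mul_of_nonneg_left (mul_le_mul_of_nonneg_left (Real.exp_le_exp.2 ?_)
            two_pos.le) (by positivity)
          rw [q1, hc2]
          push_cast
          linarith
      _ = 2 * Real.exp (3 * (2 + A)) * x⁻¹ := by
          rw [Real.exp_add, neg_mul, Real.exp_neg, Real.exp_nat_mul, Real.exp_log hx0]
          field_simp
  rw [p1]
  linarith

end Maximal

/-! ### Transfer of the maximal inequality to the regression errors -/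

section Errors

variable {Ω : Type*} [MeasurableSpace Ω] {P : Measure Ω} [IsProbabilityMeasure P]
  {ε : ℤ → Ω → Fin 2 → ℝ} {G : Fin 2 → ℝ → (ℕ → ℝ) → ℝ}

lemma abs_filt_le_norm (x : ℤ → Fin 2 → ℝ) (s : Fin 2) (t : ℝ) (i : ℤ) :
    ‖filt G x s t i‖ₑ ≤ ‖filtVec G x t i‖ₑ := by
  have h := PiLp.norm_apply_le (filtVec G x t i) s
  rw [← ofReal_norm, ← ofReal_norm]
  exact ENNReal.ofReal_le_ofReal h

lemma abs_filt_sub_le_norm (x y : ℤ → Fin 2 → ℝ) (s : Fin 2) (t : ℝ) (i : ℤ) :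
    ‖filt G x s t i - filt G y s t i‖ₑ ≤ ‖filtVec G x t i - filtVec G y t i‖ₑ := by
  have h := PiLp.norm_apply_le (filtVec G x t i - filtVec G y t i) s
  rw [← ofReal_norm, ← ofReal_norm]
  exact ENNReal.ofReal_le_ofReal h

/-- With high probability the sums of the errors over all windows of length at most `l` are of order
`√l log n`. -/
lemma LocallyStationary.exists_window_bound (herr : LocallyStationary P ε G) (s : Fin 2) :
    ∃ c > 0, ∃ r : ℕ → ℝ, Tendsto r atTop (𝓝 0) ∧ ∀ᶠ n : ℕ in atTop, ∀ l : ℝ,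
      (n : ℝ) ^ (3 / 4 : ℝ) ≤ l →
      P.real {ω | ∃ j k : ℕ, 1 ≤ j ∧ k ≤ n ∧ (k : ℝ) - j ≤ l ∧
        c * (Real.sqrt l * Real.log n) <
          |∑ i ∈ Finset.Icc j k, filt G (fun a => ε a ω) s ((i : ℝ) / n) i|} ≤ r n := by
  let ξ : ℤ → Ω → ℝ := fun i ω => ε i ω s
  have hξm : ∀ i, Measurable (ξ i) := fun i => (measurable_pi_apply s).comp (herr.innov_measurable i)
  have hξi : iIndepFun ξ P :=
    herr.innov_indep.comp (fun _ v => v s) fun _ => measurable_pi_apply s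
  let ν : Measure ℝ := P.map (ξ 0)
  have : IsProbabilityMeasure ν := Measure.isProbabilityMeasure_map (hξm 0).aemeasurable
  have hν : ∀ i, P.map (ξ i) = ν := fun i =>
    ((herr.innov_ident i).comp (measurable_pi_apply s)).map_eq
  have hpm : ∀ i : ℤ, Measurable fun ω => past (fun a => ξ a ω) i := fun i =>
    measurable_pi_iff.2 fun j => hξm _
  have hlaw := map_past hξm hξi hν
  have hGm : ∀ t ∈ Icc (0 : ℝ) 1, Measurable (G s t) := fun t ht => by
    exact (herr.filter_measurable s).comp
      ((measurable_const (a := (⟨t, ht⟩ : Icc (0 : ℝ) 1))).prodMk measurable_id)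
  have hmean : ∀ t ∈ Icc (0 : ℝ) 1, ∫ y, G s t y ∂(iidLaw ν ℕ) = 0 := fun t ht => by
    rw [← hlaw 0, integral_map (hpm 0).aemeasurable (hGm t ht).aestronglyMeasurable]
    exact herr.mean_zero s t ht
  set A' := ⨆ t ∈ Icc (0 : ℝ) 1, eLpNorm (fun ω => filtVec G (fun i => ε i ω) t 0) 4 P with hA'
  have hA'top : A' < ⊤ := herr.moment
  have h4 : ∀ t ∈ Icc (0 : ℝ) 1, eLpNorm (G s t) 4 (iidLaw ν ℕ) ≤ A' := fun t ht => by
    rw [← hlaw 0, eLpNorm_map_measure (hGm t ht).aestronglyMeasurable (hpm 0).aemeasurable]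
    refine le_trans ?_ (le_iSup₂ (f := fun t (_ : t ∈ Icc (0 : ℝ) 1) =>
      eLpNorm (fun ω => filtVec G (fun i => ε i ω) t 0) 4 P) t ht)
    exact eLpNorm_mono_enorm fun ω => abs_filt_le_norm _ s t 0
  have h4L : ∀ t ∈ Icc (0 : ℝ) 1, MemLp (G s t) 4 (iidLaw ν ℕ) := fun t ht =>
    ⟨(hGm t ht).aestronglyMeasurable, (h4 t ht).trans_lt hA'top⟩
  have h4i : ∀ t ∈ Icc (0 : ℝ) 1, Integrable (fun y => G s t y ^ 4) (iidLaw ν ℕ) := fun t ht => by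
    have := (h4L t ht).integrable_norm_pow (p := 4) (by norm_num)
    simpa [Even.pow_abs (by decide : Even 4)] using this
  have h4b : ∀ t ∈ Icc (0 : ℝ) 1, ∫ y, G s t y ^ 4 ∂(iidLaw ν ℕ) ≤ (A' ^ (4 : ℝ)).toReal := fun t ht => by
    have e := eLpNorm_nnreal_pow_eq_lintegral (f := G s t) (μ := iidLaw ν ℕ) (p := 4) (by norm_num)
    rw [integral_eq_lintegral_of_nonneg_ae (Eventually.of_forall fun y => by positivity)
      ((hGm t ht).pow_const 4).aestronglyMeasurable]
    refine ENNReal.toReal_mono (ENNReal.rpow_ne_top_of_nonneg (by norm_num) hA'top.ne) ?_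
    have e2 : ∀ y, ENNReal.ofReal (G s t y ^ 4) = ‖G s t y‖ₑ ^ (((4 : ℝ≥0)) : ℝ) := fun y => by
      rw [← Even.pow_abs (by decide : Even 4), ENNReal.ofReal_pow (abs_nonneg _),
        ← Real.enorm_eq_ofReal_abs]
      norm_num
    simp only [e2]
    rw [← e]
    have := ENNReal.rpow_le_rpow (h4 t ht) (by norm_num : (0 : ℝ) ≤ 4)
    simpa using this
  obtain ⟨ρ, hρ, C, hdec⟩ := herr.geometric_decay
  -- The innovation at time `0` is coordinate `k` of the history up to time `k`. The `L¹` norm of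
  -- one component is at most the `L⁴` norm of the vector.
  have hdep : ∀ t ∈ Icc (0 : ℝ) 1, ∀ k, coordDep ν (G s t) k ≤ ENNReal.ofReal (max C 0 * ρ ^ k) := by
    intro t ht k
    refine le_trans ?_ ((hdec k).trans (ENNReal.ofReal_le_ofReal
      (mul_le_mul_of_nonneg_right (le_max_left _ _) (pow_nonneg hρ.1.le _))))
    have hprod : (iidLaw ν ℕ).prod ν = (P.prod P).map
        (Prod.map (fun ω => past (fun a => ξ a ω) k) (ξ 0)) := by
      rw [← Measure.map_prod_map _ _ (hpm k) (hξm 0), hlaw k]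
    have hdm : Measurable fun p : (ℕ → ℝ) × ℝ =>
        G s t p.1 - G s t (Function.update p.1 k p.2) :=
      ((hGm t ht).comp measurable_fst).sub
        ((hGm t ht).comp (measurable_update_pair k measurable_fst measurable_snd))
    have hmap := (hpm k).prodMap (hξm 0)
    rw [coordDep, hprod, lintegral_map hdm.enorm hmap]
    change ∫⁻ p : Ω × Ω, ‖G s t (past (fun a => ξ a p.1) k) -
        G s t (Function.update (past (fun a => ξ a p.1) k) k (ξ 0 p.2))‖ₑ ∂(P.prod P) ≤ _
    rw [← eLpNorm_one_eq_lintegral_enorm]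
    refine (eLpNorm_le_eLpNorm_of_exponent_le (q := 4) (by norm_num)
      (hdm.comp hmap).aestronglyMeasurable).trans ?_
    refine le_trans (eLpNorm_mono_enorm fun p => ?_) (le_iSup₂ (f := fun t (_ : t ∈ Icc (0 : ℝ) 1) =>
      eLpNorm (fun p : Ω × Ω => filtVec G (fun i => ε i p.1) t k -
        filtVec G (Function.update (fun i => ε i p.1) 0 (ε 0 p.2)) t k) 4 (P.prod P)) t ht)
    refine le_trans (le_of_eq ?_) (abs_filt_sub_le_norm _ _ s t k)
    have : past (fun j => Function.update (fun i => ε i p.1) 0 (ε 0 p.2) j s) k =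
        Function.update (past (fun a => ξ a p.1) k) k (ξ 0 p.2) := by
      ext j
      by_cases hj : j = k
      · subst hj; simp [past, ξ]
      · have : (k : ℤ) - j ≠ 0 := by omega
        simp [past, ξ, hj, Function.update_of_ne this]
    simp only [filt, this]
    rfl
  -- The filter is controlled on `[0,1]` only, so the time `i / n` is capped at `1`; inside the
  -- windows, where `i ≤ n`, the cap has no effect.
  have hcl : ∀ n i : ℕ, min ((i : ℝ) / n) 1 ∈ Icc (0 : ℝ) 1 := fun n i =>
    ⟨le_min (by positivity) zero_le_one, min_le_right _ _⟩
  obtain ⟨c, hc, r, hr, hev⟩ := CurveShift.exists_window_bound hξm hξi hν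
    (g := fun n i => G s (min ((i : ℝ) / n) 1)) (fun n i => hGm _ (hcl n i))
    (fun n i => hmean _ (hcl n i)) (fun n i => h4i _ (hcl n i)) (fun n i => h4b _ (hcl n i))
    (le_max_right C 0) hρ (fun n i => hdep _ (hcl n i))
  refine ⟨c, hc, r, hr, ?_⟩
  filter_upwards [hev] with n hn l hl
  refine (measureReal_mono ?_).trans (hn l hl)
  rintro ω ⟨j, k, hj, hk, hjk, hlt⟩
  refine ⟨j, k, hj, hk, hjk, hlt.trans_le (le_of_eq ?_)⟩
  congr 1
  refine Finset.sum_congr rfl fun i hi => ?_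
  have : (i : ℝ) / n ≤ 1 := by
    refine div_le_one_of_le₀ ?_ (Nat.cast_nonneg n)
    exact_mod_cast (Finset.mem_Icc.1 hi).2.trans hk
  rw [min_eq_left this]
  rfl

end Errors

/-! ### Regression functions: derivatives and Taylor expansion -/

/-- The second derivative on `[0,1]`. -/
noncomputable def curv (m : ℝ → ℝ) (x : ℝ) : ℝ := iteratedDerivWithin 2 m (Icc 0 1) x

section Regularity

variable {m : ℝ → ℝ}

lemma IsC21.hasDerivWithinAt (hm : IsC21 m) {x : ℝ} (hx : x ∈ Icc (0 : ℝ) 1) :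
    HasDerivWithinAt m (slope m x) (Icc 0 1) x :=
  ((hm.1.differentiableOn (by norm_num)) x hx).hasDerivWithinAt

lemma curv_eq (x : ℝ) : curv m x = derivWithin (slope m) (Icc 0 1) x := by
  rw [curv, iteratedDerivWithin_succ, iteratedDerivWithin_one]
  rfl

lemma IsC21.hasDerivWithinAt_slope (hm : IsC21 m) {x : ℝ} (hx : x ∈ Icc (0 : ℝ) 1) :
    HasDerivWithinAt (slope m) (curv m x) (Icc 0 1) x := by
  have h := hm.1.differentiableOn_iteratedDerivWithin (m := 1) (by norm_num)
    (uniqueDiffOn_Icc zero_lt_one)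
  rw [iteratedDerivWithin_one] at h
  rw [curv_eq]
  exact (h x hx).hasDerivWithinAt

lemma IsC21.continuousOn_slope (hm : IsC21 m) : ContinuousOn (slope m) (Icc 0 1) := fun _ hx =>
  (hm.hasDerivWithinAt_slope hx).continuousWithinAt

lemma IsC21.exists_lipschitz (hm : IsC21 m) :
    ∃ C : ℝ, 0 < C ∧ (∀ x ∈ Icc (0 : ℝ) 1, ∀ y ∈ Icc (0 : ℝ) 1, |curv m x - curv m y| ≤ C * |x - y|) ∧
      ∀ x ∈ Icc (0 : ℝ) 1, |curv m x| ≤ C := by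
  obtain ⟨K, hK⟩ := hm.2
  refine ⟨K + |curv m 0| + 1, by positivity, fun x hx y hy => ?_, fun x hx => ?_⟩
  · have := hK.dist_le_mul x hx y hy
    rw [Real.dist_eq, Real.dist_eq] at this
    refine this.trans (mul_le_mul_of_nonneg_right ?_ (abs_nonneg _))
    linarith [abs_nonneg (curv m 0)]
  · have := hK.dist_le_mul x hx 0 (by simp)
    rw [Real.dist_eq, Real.dist_eq, sub_zero, abs_of_nonneg hx.1] at this
    have h2 : (K : ℝ) * x ≤ K := mul_le_of_le_one_right K.2 hx.2
    have h3 := abs_sub_abs_le_abs_sub (curv m x) (curv m 0)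
    change |curv m x - curv m 0| ≤ _ at this
    linarith

/-- Mean value inequality with the derivative bounded only between the two points, so that applying
it to remainders produces Taylor estimates. -/
lemma abs_sub_le_of_hasDerivWithinAt {f f' : ℝ → ℝ}
    (hf : ∀ x ∈ Icc (0 : ℝ) 1, HasDerivWithinAt f (f' x) (Icc 0 1) x) {u y B : ℝ}
    (hu : u ∈ Icc (0 : ℝ) 1) (hy : y ∈ Icc (0 : ℝ) 1) (hB : ∀ x ∈ uIcc u y, |f' x| ≤ B) :
    |f y - f u| ≤ B * |y - u| := by
  have hsub : uIcc u y ⊆ Icc 0 1 := uIcc_subset_Icc hu hy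
  have := (convex_uIcc u y).norm_image_sub_le_of_norm_hasDerivWithin_le
    (fun x hx => (hf x (hsub hx)).mono hsub) (fun x hx => hB x hx) left_mem_uIcc right_mem_uIcc
  simpa using this

lemma abs_sub_le_of_mem_uIcc {u x y : ℝ} (h : x ∈ uIcc u y) : |x - u| ≤ |y - u| := by
  rw [← Real.dist_eq, ← Real.dist_eq, dist_comm x, dist_comm y]
  exact Real.dist_left_le_of_mem_uIcc h

lemma IsC21.abs_slope_sub_le (hm : IsC21 m) {C : ℝ} (hC : ∀ x ∈ Icc (0 : ℝ) 1, |curv m x| ≤ C)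
    {u y : ℝ} (hu : u ∈ Icc (0 : ℝ) 1) (hy : y ∈ Icc (0 : ℝ) 1) :
    |slope m y - slope m u| ≤ C * |y - u| :=
  abs_sub_le_of_hasDerivWithinAt (fun _ hx => hm.hasDerivWithinAt_slope hx) hu hy fun x hx =>
    hC x (uIcc_subset_Icc hu hy hx)

lemma IsC21.abs_slope_taylor_le (hm : IsC21 m) {C : ℝ} (hC0 : 0 ≤ C)
    (hC : ∀ x ∈ Icc (0 : ℝ) 1, ∀ y ∈ Icc (0 : ℝ) 1, |curv m x - curv m y| ≤ C * |x - y|)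
    {u y : ℝ} (hu : u ∈ Icc (0 : ℝ) 1) (hy : y ∈ Icc (0 : ℝ) 1) :
    |slope m y - slope m u - curv m u * (y - u)| ≤ C * |y - u| ^ 2 := by
  have h := abs_sub_le_of_hasDerivWithinAt (f := fun x => slope m x - curv m u * (x - u))
    (f' := fun x => curv m x - curv m u) (B := C * |y - u|) (fun x hx => by
      have h1 := (hm.hasDerivWithinAt_slope hx).sub
        ((((hasDerivAt_id x).sub_const u).const_mul (curv m u)).hasDerivWithinAt)
      rw [mul_one] at h1
      exact h1) hu hy fun x hx => by
      refine (hC x (uIcc_subset_Icc hu hy hx) u hu).trans ?_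
      exact mul_le_mul_of_nonneg_left (abs_sub_le_of_mem_uIcc hx) hC0
  simp only [sub_self, mul_zero, sub_zero] at h
  rw [sub_right_comm, sq, ← mul_assoc]
  exact h

/-- The derivative of the remainder is the remainder of `abs_slope_taylor_le`. The constant is not
sharp; only the cubic order matters. -/
lemma IsC21.abs_taylor_le (hm : IsC21 m) {C : ℝ} (hC0 : 0 ≤ C)
    (hC : ∀ x ∈ Icc (0 : ℝ) 1, ∀ y ∈ Icc (0 : ℝ) 1, |curv m x - curv m y| ≤ C * |x - y|)
    {u y : ℝ} (hu : u ∈ Icc (0 : ℝ) 1) (hy : y ∈ Icc (0 : ℝ) 1) :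
    |m y - m u - slope m u * (y - u) - curv m u / 2 * (y - u) ^ 2| ≤ C * |y - u| ^ 3 := by
  have h := abs_sub_le_of_hasDerivWithinAt
    (f := fun x => m x - slope m u * (x - u) - curv m u / 2 * (x - u) ^ 2)
    (f' := fun x => slope m x - slope m u - curv m u * (x - u)) (B := C * |y - u| ^ 2)
    (fun x hx => by
      have h1 := ((hm.hasDerivWithinAt hx).sub
        ((((hasDerivAt_id x).sub_const u).const_mul (slope m u)).hasDerivWithinAt)).sub
        (((((hasDerivAt_id x).sub_const u).pow 2).const_mul (curv m u / 2)).hasDerivWithinAt)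
      refine h1.congr_deriv ?_
      norm_num
      ring) hu hy fun x hx => by
      refine (hm.abs_slope_taylor_le hC0 hC hu (uIcc_subset_Icc hu hy hx)).trans ?_
      exact mul_le_mul_of_nonneg_left
        (pow_le_pow_left₀ (abs_nonneg _) (abs_sub_le_of_mem_uIcc hx) 2) hC0
  simp only [sub_self, mul_zero, sub_zero, ne_eq, OfNat.ofNat_ne_zero, not_false_eq_true,
    zero_pow] at h
  have e : m y - m u - slope m u * (y - u) - curv m u / 2 * (y - u) ^ 2 =
      m y - slope m u * (y - u) - curv m u / 2 * (y - u) ^ 2 - m u := by ring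
  rw [e, pow_succ |y - u| 2, ← mul_assoc]
  exact h

end Regularity

/-! ### Summation by parts and Riemann sums -/

lemma sum_mul_eq_by_parts (a e : ℕ → ℝ) {p q : ℕ} (hpq : p ≤ q) :
    ∑ i ∈ Finset.Icc p q, a i * e i = a q * ∑ i ∈ Finset.Icc p q, e i -
      ∑ k ∈ Finset.Ico p q, (a (k + 1) - a k) * ∑ i ∈ Finset.Icc p k, e i := by
  induction q, hpq using Nat.le_induction with
  | base => simp
  | succ q hq ih =>
    rw [Finset.sum_Icc_succ_top (Nat.le_succ_of_le hq), Finset.sum_Icc_succ_top (Nat.le_succ_of_le hq),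
      Finset.sum_Ico_succ_top hq, ih]
    ring

/-- By Abel summation, weights with small increments cost only their end value plus their total
variation. A bound on plain partial sums thus serves all kernel weights simultaneously. -/
lemma abs_sum_mul_le_of_partial_sums {a e : ℕ → ℝ} {p q : ℕ} (hpq : p ≤ q) {W d R : ℝ}
    (hW : |a q| ≤ W) (hd : ∀ k, p ≤ k → k < q → |a (k + 1) - a k| ≤ d)
    (hR : ∀ k, p ≤ k → k ≤ q → |∑ i ∈ Finset.Icc p k, e i| ≤ R) :
    |∑ i ∈ Finset.Icc p q, a i * e i| ≤ (W + ((q : ℝ) - p) * d) * R := by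
  have hR0 : 0 ≤ R := (abs_nonneg _).trans (hR q hpq le_rfl)
  rw [sum_mul_eq_by_parts a e hpq, add_mul]
  refine (abs_sub _ _).trans (add_le_add ?_ ?_)
  · rw [abs_mul]
    exact mul_le_mul hW (hR q hpq le_rfl) (abs_nonneg _) ((abs_nonneg _).trans hW)
  · refine (Finset.abs_sum_le_sum_abs _ _).trans ?_
    calc _ ≤ ∑ k ∈ Finset.Ico p q, d * R := by
          refine Finset.sum_le_sum fun k hk => ?_
          rw [Finset.mem_Ico] at hk
          rw [abs_mul]
          have := hd k hk.1 hk.2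
          exact mul_le_mul this (hR k hk.1 hk.2.le) (abs_nonneg _) ((abs_nonneg _).trans this)
      _ = _ := by
          rw [Finset.sum_const, Nat.card_Ico, nsmul_eq_mul, Nat.cast_sub hpq]
          ring

/-- A bound for the oscillation of a function supported in `[-1,1]`: `ω` in the interior and `W` near
the end points. -/
noncomputable def oscBound (ω W η : ℝ) (y : ℝ) : ℝ :=
  (Icc (-1 : ℝ) 1).indicator (fun _ => ω) y + (Icc (-1 - η) (-1 + η)).indicator (fun _ => W) y +
    (Icc (1 - η) (1 + η)).indicator (fun _ => W) y

/-- `F` may jump at `±1`. Two points on different sides of such a jump are both within `η` of it,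
and there the crude bound `W` is used; elsewhere the modulus of continuity applies, or both values
vanish. -/
lemma abs_sub_le_oscBound {F : ℝ → ℝ} {ω W η : ℝ} (hω0 : 0 ≤ ω) (hsupp : ∀ x, x ∉ Icc (-1 : ℝ) 1 → F x = 0)
    (hW : ∀ x, |F x| ≤ W)
    (hω : ∀ x ∈ Icc (-1 : ℝ) 1, ∀ y ∈ Icc (-1 : ℝ) 1, |x - y| ≤ η → |F x - F y| ≤ ω)
    {x y : ℝ} (hxy : |x - y| ≤ η) : |F x - F y| ≤ oscBound ω W η y := by
  have hW0 : 0 ≤ W := (abs_nonneg _).trans (hW 0)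
  have i1 : 0 ≤ (Icc (-1 : ℝ) 1).indicator (fun _ => ω) y := indicator_nonneg (fun _ _ => hω0) _
  have i2 : 0 ≤ (Icc (-1 - η) (-1 + η)).indicator (fun _ => W) y :=
    indicator_nonneg (fun _ _ => hW0) _
  have i3 : 0 ≤ (Icc (1 - η) (1 + η)).indicator (fun _ => W) y :=
    indicator_nonneg (fun _ _ => hW0) _
  have hab := abs_le.1 hxy
  have near : (x < -1 ∧ -1 ≤ y ∨ y < -1 ∧ -1 ≤ x) ∨ (1 < x ∧ y ≤ 1 ∨ 1 < y ∧ x ≤ 1) →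
      W ≤ oscBound ω W η y := by
    rintro (h | h)
    · have : y ∈ Icc (-1 - η) (-1 + η) := by
        rcases h with h | h <;> exact ⟨by linarith, by linarith⟩
      rw [oscBound, indicator_of_mem this]
      linarith
    · have : y ∈ Icc (1 - η) (1 + η) := by
        rcases h with h | h <;> exact ⟨by linarith, by linarith⟩
      rw [oscBound, indicator_of_mem this]
      linarith
  by_cases hx : x ∈ Icc (-1 : ℝ) 1 <;> by_cases hy : y ∈ Icc (-1 : ℝ) 1
  · refine (hω x hx y hy hxy).trans ?_
    rw [oscBound, indicator_of_mem hy]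
    linarith
  · rw [hsupp y hy, sub_zero]
    refine (hW x).trans (near ?_)
    rw [mem_Icc, not_and_or, not_le, not_le] at hy
    rcases hy with hy | hy
    · exact Or.inl (Or.inr ⟨hy, hx.1⟩)
    · exact Or.inr (Or.inr ⟨hy, hx.2⟩)
  · rw [hsupp x hx, zero_sub, abs_neg]
    refine (hW y).trans (near ?_)
    rw [mem_Icc, not_and_or, not_le, not_le] at hx
    rcases hx with hx | hx
    · exact Or.inl (Or.inl ⟨hx, hy.1⟩)
    · exact Or.inr (Or.inl ⟨hx, hy.2⟩)
  · rw [hsupp x hx, hsupp y hy, sub_zero, abs_zero]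
    exact add_nonneg (add_nonneg i1 i2) i3

lemma integrable_indicator_Icc (a b c : ℝ) : Integrable ((Icc a b).indicator fun _ => c) := by
  refine IntegrableOn.integrable_indicator ?_ measurableSet_Icc
  exact integrableOn_const (by simp)

lemma integral_indicator_Icc {a b : ℝ} (hab : a ≤ b) (c : ℝ) :
    ∫ y, (Icc a b).indicator (fun _ => c) y = c * (b - a) := by
  rw [integral_indicator measurableSet_Icc, setIntegral_const]
  simp [hab, mul_comm]

lemma integrable_oscBound (ω W η : ℝ) : Integrable (oscBound ω W η) :=
  ((integrable_indicator_Icc _ _ _).add (integrable_indicator_Icc _ _ _)).add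
    (integrable_indicator_Icc _ _ _)

lemma integral_oscBound (ω W : ℝ) {η : ℝ} (hη : 0 ≤ η) :
    ∫ y, oscBound ω W η y = 2 * ω + 4 * W * η := by
  unfold oscBound
  have h1 : Integrable fun y => (Icc (-1 : ℝ) 1).indicator (fun _ => ω) y +
      (Icc (-1 - η) (-1 + η)).indicator (fun _ => W) y :=
    (integrable_indicator_Icc _ _ _).add (integrable_indicator_Icc _ _ _)
  rw [integral_add h1 (integrable_indicator_Icc _ _ _),
    integral_add (integrable_indicator_Icc _ _ _) (integrable_indicator_Icc _ _ _),
    integral_indicator_Icc (by norm_num), integral_indicator_Icc (by linarith),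
    integral_indicator_Icc (by linarith)]
  ring

/-- Comparison of a sum over a grid of step `d` with an integral. -/
lemma abs_sum_sub_integral_le {F ψ : ℝ → ℝ} (hF : Integrable F) (hψ : Integrable ψ)
    {d y₀ : ℝ} (hd : 0 < d) (n : ℕ) {a : ℕ → ℝ} (hψ0 : ∀ y, 0 ≤ ψ y)
    (h : ∀ i ∈ Finset.Icc 1 n, ∀ y ∈ Icc (y₀ + ((i : ℝ) - 1) * d) (y₀ + i * d), |a i - F y| ≤ ψ y) :
    |d * ∑ i ∈ Finset.Icc 1 n, a i - ∫ y in y₀..(y₀ + n * d), F y| ≤ ∫ y, ψ y := by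
  have hstep : ∀ k : ℕ, y₀ + (k : ℝ) * d ≤ y₀ + ((k + 1 : ℕ) : ℝ) * d := fun k => by
    push_cast; linarith
  have hsplit : ∀ {f : ℝ → ℝ}, Integrable f → ∫ y in y₀..(y₀ + n * d), f y =
      ∑ k ∈ Finset.range n, ∫ y in (y₀ + (k : ℝ) * d)..(y₀ + ((k + 1 : ℕ) : ℝ) * d), f y := by
    intro f hf
    rw [intervalIntegral.sum_integral_adjacent_intervals (a := fun k : ℕ => y₀ + (k : ℝ) * d)
      fun k _ => hf.intervalIntegrable]
    simp
  have hsum : ∑ i ∈ Finset.Icc 1 n, a i = ∑ k ∈ Finset.range n, a (k + 1) := by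
    rw [Finset.range_eq_Ico, Finset.sum_Ico_add' (fun i => a i) 0 n 1]
    rfl
  rw [hsplit hF, hsum, Finset.mul_sum, ← Finset.sum_sub_distrib]
  calc _ ≤ ∑ k ∈ Finset.range n, |d * a (k + 1) -
        ∫ y in (y₀ + (k : ℝ) * d)..(y₀ + ((k + 1 : ℕ) : ℝ) * d), F y| :=
        Finset.abs_sum_le_sum_abs _ _
    _ ≤ ∑ k ∈ Finset.range n, ∫ y in (y₀ + (k : ℝ) * d)..(y₀ + ((k + 1 : ℕ) : ℝ) * d), ψ y := by
        refine Finset.sum_le_sum fun k hk => ?_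
        have e : d * a (k + 1) = ∫ y in (y₀ + (k : ℝ) * d)..(y₀ + ((k + 1 : ℕ) : ℝ) * d), a (k + 1) := by
          rw [intervalIntegral.integral_const, smul_eq_mul]
          push_cast
          ring
        rw [e, ← intervalIntegral.integral_sub intervalIntegrable_const hF.intervalIntegrable,
          ← Real.norm_eq_abs]
        refine (intervalIntegral.norm_integral_le_integral_norm (hstep k)).trans ?_
        refine intervalIntegral.integral_mono_on (hstep k)
          (intervalIntegrable_const.sub hF.intervalIntegrable).norm hψ.intervalIntegrable
          fun y hy => ?_
        refine h (k + 1) (by rw [Finset.mem_range] at hk; simp; omega) y ?_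
        push_cast at hy ⊢
        rwa [add_sub_cancel_right]
    _ = ∫ y in y₀..(y₀ + n * d), ψ y := (hsplit hψ).symm
    _ ≤ ∫ y, ψ y := by
        rw [intervalIntegral.integral_of_le (by nlinarith [Nat.cast_nonneg (α := ℝ) n])]
        exact setIntegral_le_integral hψ (Eventually.of_forall hψ0)

/-! ### The local linear estimator of the derivative -/

section Kernel

/-- A function supported in `[-1,1]` that is bounded and Lipschitz there with constant `W`. -/
structure IsLipWeight (W : ℝ) (F : ℝ → ℝ) : Prop where
  zero : ∀ x, x ∉ Icc (-1 : ℝ) 1 → F x = 0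
  bound : ∀ x, |F x| ≤ W
  lip : ∀ x ∈ Icc (-1 : ℝ) 1, ∀ y ∈ Icc (-1 : ℝ) 1, |F x - F y| ≤ W * |x - y|

variable {F : ℝ → ℝ} {W : ℝ}

lemma measurable_of_continuousOn_Icc (h0 : ∀ x, x ∉ Icc (-1 : ℝ) 1 → F x = 0)
    (hc : ContinuousOn F (Icc (-1) 1)) : Measurable F := by
  have hproj : Continuous fun x : ℝ => F (max (-1) (min x 1)) :=
    hc.comp_continuous (by fun_prop) fun x =>
      ⟨le_max_left _ _, max_le (by norm_num) (min_le_right _ _)⟩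
  have : F = (Icc (-1 : ℝ) 1).indicator fun x => F (max (-1) (min x 1)) := by
    ext x
    by_cases hx : x ∈ Icc (-1 : ℝ) 1
    · rw [indicator_of_mem hx, min_eq_left hx.2, max_eq_right hx.1]
    · rw [indicator_of_notMem hx, h0 x hx]
  rw [this]
  exact hproj.measurable.indicator measurableSet_Icc

lemma integrable_of_continuousOn_Icc (h0 : ∀ x, x ∉ Icc (-1 : ℝ) 1 → F x = 0)
    (hc : ContinuousOn F (Icc (-1) 1)) : Integrable F := by
  have : F = (Icc (-1 : ℝ) 1).indicator F := by
    ext x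
    by_cases hx : x ∈ Icc (-1 : ℝ) 1
    · rw [indicator_of_mem hx]
    · rw [indicator_of_notMem hx, h0 x hx]
  rw [this]
  exact hc.integrableOn_Icc.integrable_indicator measurableSet_Icc

lemma intervalIntegral_eq_of_support (h0 : ∀ x, x ∉ Icc (-1 : ℝ) 1 → F x = 0) {a b : ℝ}
    (ha : a ≤ -1) (hb : 1 ≤ b) : ∫ y in a..b, F y = ∫ y in (-1 : ℝ)..1, F y := by
  have key : ∀ {a b : ℝ}, a ≤ -1 → 1 ≤ b → ∫ y in a..b, F y = ∫ y, F y := fun {a b} ha hb => by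
    rw [intervalIntegral.integral_of_le (by linarith), ← integral_Icc_eq_integral_Ioc]
    refine setIntegral_eq_integral_of_forall_compl_eq_zero fun x hx => h0 x fun h => hx ?_
    exact ⟨ha.trans h.1, h.2.trans hb⟩
  rw [key ha hb, key le_rfl le_rfl]

namespace IsLipWeight

lemma continuousOn (h : IsLipWeight W F) : ContinuousOn F (Icc (-1) 1) := by
  have : LipschitzOnWith W.toNNReal F (Icc (-1) 1) := LipschitzOnWith.of_dist_le_mul fun x hx y hy => by
    rw [Real.dist_eq, Real.dist_eq, Real.coe_toNNReal _ ((abs_nonneg _).trans (h.bound 0))]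
    exact h.lip x hx y hy
  exact this.continuousOn

/-- The factor `4` is `3`, the Lipschitz constant of `x ^ k` on `[-1,1]` for `k ≤ 3`, plus `1` for
`F` itself. -/
lemma pow_mul (h : IsLipWeight W F) {k : ℕ} (hk : k ≤ 3) :
    IsLipWeight (4 * W) fun x => x ^ k * F x where
  zero x hx := by simp only [h.zero x hx, mul_zero]
  bound x := by
    have hW : 0 ≤ W := (abs_nonneg _).trans (h.bound 0)
    by_cases hx : x ∈ Icc (-1 : ℝ) 1
    · rw [abs_mul, abs_pow]
      have : |x| ^ k ≤ 1 := pow_le_one₀ (abs_nonneg _) (abs_le.2 hx)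
      calc |x| ^ k * |F x| ≤ 1 * W := mul_le_mul this (h.bound x) (abs_nonneg _) zero_le_one
        _ ≤ 4 * W := by linarith
    · simp only [h.zero x hx, mul_zero, abs_zero]; linarith
  lip x hx y hy := by
    have hW : 0 ≤ W := (abs_nonneg _).trans (h.bound 0)
    have hx1 : |x| ≤ 1 := abs_le.2 hx
    have hy1 : |y| ≤ 1 := abs_le.2 hy
    have h1 : |x ^ k - y ^ k| ≤ 3 * |x - y| := by
      have h3 := abs_pow_sub_pow_le x y k
      have h4 : max |x| |y| ^ (k - 1) ≤ 1 := pow_le_one₀ (le_max_of_le_left (abs_nonneg _))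
        (max_le hx1 hy1)
      have h5 : (k : ℝ) ≤ 3 := by exact_mod_cast hk
      calc _ ≤ |x - y| * k * max |x| |y| ^ (k - 1) := h3
        _ ≤ |x - y| * 3 * 1 := by gcongr
        _ = 3 * |x - y| := by ring
    have e : x ^ k * F x - y ^ k * F y = (x ^ k - y ^ k) * F x + y ^ k * (F x - F y) := by ring
    rw [e]
    refine (abs_add_le _ _).trans ?_
    rw [abs_mul, abs_mul, abs_pow]
    have h2 : |y| ^ k ≤ 1 := pow_le_one₀ (abs_nonneg _) hy1
    calc _ ≤ 3 * |x - y| * W + 1 * (W * |x - y|) := by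
          gcongr
          · exact h.bound x
          · exact h.lip x hx y hy
      _ = 4 * W * |x - y| := by ring

end IsLipWeight

lemma IsSmoothingKernel.exists_isLipWeight {K : ℝ → ℝ} (hK : IsSmoothingKernel K) :
    ∃ W : ℝ, 0 < W ∧ IsLipWeight W K := by
  have h0 : ∀ x, x ∉ Icc (-1 : ℝ) 1 → K x = 0 := fun x hx => by
    by_contra h
    exact hx (hK.supp h)
  obtain ⟨B1, hB1⟩ := isCompact_Icc.exists_bound_of_continuousOn hK.diff.continuousOn
  obtain ⟨B2, hB2⟩ := isCompact_Icc.exists_bound_of_continuousOn hK.diff_two.continuousOn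
  refine ⟨|B1| + |B2| + 1, by positivity, h0, fun x => ?_, fun x hx y hy => ?_⟩
  · by_cases hx : x ∈ Icc (-1 : ℝ) 1
    · have := hB1 x hx
      rw [Real.norm_eq_abs] at this
      linarith [le_abs_self B1, abs_nonneg B2]
    · rw [h0 x hx, abs_zero]; positivity
  · have := (convex_Icc (-1 : ℝ) 1).norm_image_sub_le_of_norm_derivWithin_le hK.diff hB2 hy hx
    rw [Real.norm_eq_abs, Real.norm_eq_abs] at this
    refine this.trans (mul_le_mul_of_nonneg_right ?_ (abs_nonneg _))
    linarith [le_abs_self B2, abs_nonneg B1]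

end Kernel

/-! ### Kernel-weighted sums over the design points -/

section Sums

variable {F : ℝ → ℝ} {W : ℝ} {n : ℕ} {b u : ℝ}

/-- A Riemann sum of step `1 / (n * b)`: the interior oscillation contributes `2 * W` steps and the
two possible jumps `4 * W` steps. For `u ∈ [b, 1 - b]` the grid covers the whole support. -/
lemma IsLipWeight.abs_sum_sub_le (hF : IsLipWeight W F) (hn : 0 < n) (hb : 0 < b)
    (hu : u ∈ Icc b (1 - b)) :
    |∑ i ∈ Finset.Icc 1 n, F (((i : ℝ) / n - u) / b) - n * b * ∫ x in (-1 : ℝ)..1, F x| ≤ 6 * W := by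
  have hn' : (0 : ℝ) < n := by exact_mod_cast hn
  have hW : 0 ≤ W := (abs_nonneg _).trans (hF.bound 0)
  set d : ℝ := 1 / (n * b) with hd
  have hd0 : 0 < d := by positivity
  have hgrid : ∀ i : ℕ, ((i : ℝ) / n - u) / b = -u / b + i * d := fun i => by
    rw [hd]; field_simp; ring
  have key := abs_sum_sub_integral_le (F := F) (ψ := oscBound (W * d) W d)
    (integrable_of_continuousOn_Icc hF.zero hF.continuousOn) (integrable_oscBound _ _ _)
    (d := d) (y₀ := -u / b) hd0 n (a := fun i => F (((i : ℝ) / n - u) / b)) (fun y => by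
      refine add_nonneg (add_nonneg ?_ ?_) ?_ <;>
        exact indicator_nonneg (fun _ _ => by positivity) _)
    (fun i hi y hy => by
      refine abs_sub_le_oscBound (by positivity) hF.zero hF.bound (fun x hx y hy hxy => ?_) ?_
      · exact (hF.lip x hx y hy).trans (mul_le_mul_of_nonneg_left hxy hW)
      · rw [hgrid, abs_le]
        constructor <;> linarith [hy.1, hy.2])
  rw [integral_oscBound _ _ hd0.le, intervalIntegral_eq_of_support hF.zero
    (by rw [neg_div, neg_le_neg_iff, one_le_div hb]; exact hu.1)
    (by
      have : -u / b + n * d = (1 - u) / b := by rw [hd]; field_simp; ring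
      rw [this, one_le_div hb]; linarith [hu.2])] at key
  have h2 : |∑ i ∈ Finset.Icc 1 n, F (((i : ℝ) / n - u) / b) - n * b * ∫ x in (-1 : ℝ)..1, F x| =
      n * b * |d * ∑ i ∈ Finset.Icc 1 n, F (((i : ℝ) / n - u) / b) - ∫ x in (-1 : ℝ)..1, F x| := by
    rw [← abs_of_pos (by positivity : 0 < n * b), ← abs_mul, abs_of_pos (by positivity : 0 < n * b),
      mul_sub, ← mul_assoc]
    have : n * b * d = 1 := by rw [hd]; field_simp
    rw [this, one_mul]
  rw [h2]
  calc _ ≤ n * b * (2 * (W * d) + 4 * W * d) := mul_le_mul_of_nonneg_left key (by positivity)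
    _ = 6 * W := by rw [hd]; field_simp; ring

/-- The design points that receive weight are consecutive, as summation by parts requires. -/
lemma exists_window (hn : 0 < n) (hb : 0 < b) (hu : u ∈ Icc b (1 - b)) :
    ∃ p q : ℕ, 1 ≤ p ∧ q ≤ n ∧ (q : ℝ) - p ≤ 2 * (n * b) ∧
      (∀ i ∈ Finset.Icc p q, ((i : ℝ) / n - u) / b ∈ Icc (-1 : ℝ) 1) ∧
      ∀ i ∈ Finset.Icc 1 n, ((i : ℝ) / n - u) / b ∈ Icc (-1 : ℝ) 1 → i ∈ Finset.Icc p q := by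
  have hn' : (0 : ℝ) < n := by exact_mod_cast hn
  have hub : 0 ≤ n * (u + b) := by have := hu.1; nlinarith
  have hiff : ∀ i : ℕ, ((i : ℝ) / n - u) / b ∈ Icc (-1 : ℝ) 1 ↔
      n * (u - b) ≤ i ∧ (i : ℝ) ≤ n * (u + b) := fun i => by
    rw [mem_Icc, le_div_iff₀ hb, div_le_iff₀ hb]
    constructor
    · rintro ⟨h1, h2⟩
      have h3 : u - b ≤ (i : ℝ) / n := by linarith
      have h4 : (i : ℝ) / n ≤ u + b := by linarith
      rw [le_div_iff₀ hn'] at h3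
      rw [div_le_iff₀ hn'] at h4
      constructor <;> linarith
    · rintro ⟨h1, h2⟩
      have h3 : u - b ≤ (i : ℝ) / n := by rw [le_div_iff₀ hn']; linarith
      have h4 : (i : ℝ) / n ≤ u + b := by rw [div_le_iff₀ hn']; linarith
      constructor <;> linarith
  refine ⟨max 1 ⌈n * (u - b)⌉₊, ⌊n * (u + b)⌋₊, le_max_left _ _, ?_, ?_, ?_, ?_⟩
  · refine Nat.floor_le_of_le ?_
    have := hu.2; nlinarith
  · have h1 : n * (u - b) ≤ ((max 1 ⌈n * (u - b)⌉₊ : ℕ) : ℝ) := (Nat.le_ceil _).trans (by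
      exact_mod_cast le_max_right _ _)
    have h2 := Nat.floor_le hub
    linarith
  · intro i hi
    rw [Finset.mem_Icc, max_le_iff] at hi
    exact (hiff i).2 ⟨Nat.ceil_le.1 hi.1.2, (Nat.le_floor_iff hub).1 hi.2⟩
  · intro i hi h
    rw [hiff] at h
    rw [Finset.mem_Icc] at hi ⊢
    exact ⟨max_le hi.1 (Nat.ceil_le.2 h.1), (Nat.le_floor_iff hub).2 h.2⟩

lemma IsLipWeight.sum_eq_window (hF : IsLipWeight W F) {p q : ℕ} (hp : 1 ≤ p) (hq : q ≤ n)
    (hw : ∀ i ∈ Finset.Icc 1 n, ((i : ℝ) / n - u) / b ∈ Icc (-1 : ℝ) 1 → i ∈ Finset.Icc p q)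
    (e : ℕ → ℝ) :
    ∑ i ∈ Finset.Icc 1 n, F (((i : ℝ) / n - u) / b) * e i =
      ∑ i ∈ Finset.Icc p q, F (((i : ℝ) / n - u) / b) * e i := by
  symm
  refine Finset.sum_subset (Finset.Icc_subset_Icc hp hq) fun i hi hi' => ?_
  rw [hF.zero _ fun h => hi' (hw i hi h), zero_mul]

/-- Summation by parts: the end weight is at most `W`, and at most `2 * (n * b)` increments of size
`W / (n * b)` add `2 * W`. -/
lemma IsLipWeight.abs_sum_mul_le (hF : IsLipWeight W F) (hn : 0 < n) (hb : 0 < b)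
    (hu : u ∈ Icc b (1 - b)) {e : ℕ → ℝ} {R : ℝ} (hR0 : 0 ≤ R)
    (hR : ∀ j k : ℕ, 1 ≤ j → k ≤ n → (k : ℝ) - j ≤ 2 * (n * b) → |∑ i ∈ Finset.Icc j k, e i| ≤ R) :
    |∑ i ∈ Finset.Icc 1 n, F (((i : ℝ) / n - u) / b) * e i| ≤ 3 * W * R := by
  have hn' : (0 : ℝ) < n := by exact_mod_cast hn
  have hW : 0 ≤ W := (abs_nonneg _).trans (hF.bound 0)
  obtain ⟨p, q, hp, hq, hpq, hin, hw⟩ := exists_window hn hb hu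
  rw [hF.sum_eq_window hp hq hw]
  by_cases hle : p ≤ q
  · have key := abs_sum_mul_le_of_partial_sums (a := fun i => F (((i : ℝ) / n - u) / b)) (e := e) hle
      (W := W) (d := W * (1 / (n * b))) (R := R) (hF.bound _) (fun k h1 h2 => by
        have i1 := hin k (Finset.mem_Icc.2 ⟨h1, h2.le⟩)
        have i2 := hin (k + 1) (Finset.mem_Icc.2 ⟨h1.trans (Nat.le_succ _), h2⟩)
        refine (hF.lip _ i2 _ i1).trans (le_of_eq ?_)
        congr 1
        have : (((k + 1 : ℕ) : ℝ) / n - u) / b - ((k : ℝ) / n - u) / b = 1 / (n * b) := by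
          push_cast; field_simp; ring
        rw [this, abs_of_pos (by positivity)])
      (fun k h1 h2 => hR p k hp (h2.trans hq) (by
        have : (k : ℝ) ≤ q := by exact_mod_cast h2
        linarith))
    refine key.trans ?_
    have : W + ((q : ℝ) - p) * (W * (1 / (n * b))) ≤ 3 * W := by
      have h1 : ((q : ℝ) - p) * (W * (1 / (n * b))) ≤ 2 * (n * b) * (W * (1 / (n * b))) := by gcongr
      have h2 : 2 * (n * b) * (W * (1 / (n * b))) = 2 * W := by field_simp
      linarith
    exact mul_le_mul_of_nonneg_right this hR0
  · rw [Finset.Icc_eq_empty hle, Finset.sum_empty, abs_zero]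
    positivity

lemma IsLipWeight.abs_sum_mul_le_of_bound (hF : IsLipWeight W F) (hn : 0 < n) (hb : 0 < b)
    (hu : u ∈ Icc b (1 - b)) {e : ℕ → ℝ} {R : ℝ} (hR0 : 0 ≤ R)
    (hR : ∀ i ∈ Finset.Icc 1 n, ((i : ℝ) / n - u) / b ∈ Icc (-1 : ℝ) 1 → |e i| ≤ R) :
    |∑ i ∈ Finset.Icc 1 n, F (((i : ℝ) / n - u) / b) * e i| ≤ (2 * (n * b) + 1) * (W * R) := by
  have hW : 0 ≤ W := (abs_nonneg _).trans (hF.bound 0)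
  obtain ⟨p, q, hp, hq, hpq, hin, hw⟩ := exists_window hn hb hu
  rw [hF.sum_eq_window hp hq hw]
  have h0 : 0 ≤ 2 * (n * b) := by positivity
  refine (Finset.abs_sum_le_sum_abs _ _).trans ?_
  calc _ ≤ ∑ i ∈ Finset.Icc p q, W * R := by
        refine Finset.sum_le_sum fun i hi => ?_
        rw [abs_mul]
        exact mul_le_mul (hF.bound _) (hR i (Finset.Icc_subset_Icc hp hq hi) (hin i hi))
          (abs_nonneg _) hW
    _ ≤ (2 * (n * b) + 1) * (W * R) := by
        rw [Finset.sum_const, nsmul_eq_mul, Nat.card_Icc]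
        refine mul_le_mul_of_nonneg_right ?_ (by positivity)
        rcases le_total p (q + 1) with h | h
        · rw [Nat.cast_sub h]; push_cast; linarith
        · rw [Nat.sub_eq_zero_of_le h]; push_cast; linarith

end Sums

/-! ### Minimisers of a quadratic polynomial in two variables -/

section Quadratic

/-- Completing the square. Uniqueness of the second component is what makes the unspecified choice
in `llArgmin` harmless. -/
lemma exists_argmin_quadratic {f : ℝ × ℝ → ℝ} {q B0 B1 A0 A1 A2 : ℝ}
    (hf : ∀ β, f β = q - 2 * β.1 * B0 - 2 * β.2 * B1 + β.1 ^ 2 * A0 + 2 * β.1 * β.2 * A1 +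
      β.2 ^ 2 * A2) (hA0 : 0 < A0) (hD : 0 < A0 * A2 - A1 ^ 2) :
    (∃ β, ∀ β', f β ≤ f β') ∧
      ∀ β, (∀ β', f β ≤ f β') → β.2 = (A0 * B1 - A1 * B0) / (A0 * A2 - A1 ^ 2) := by
  set D := A0 * A2 - A1 ^ 2 with hDdef
  set β₀ : ℝ × ℝ := ((A2 * B0 - A1 * B1) / D, (A0 * B1 - A1 * B0) / D) with hβ₀
  have e1 : A0 * β₀.1 + A1 * β₀.2 = B0 := by
    simp only [hβ₀]; field_simp; rw [hDdef]; ring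
  have e2 : A1 * β₀.1 + A2 * β₀.2 = B1 := by
    simp only [hβ₀]; field_simp; rw [hDdef]; ring
  have hsq : ∀ β, A0 * (f β - f β₀) =
      (A0 * (β.1 - β₀.1) + A1 * (β.2 - β₀.2)) ^ 2 + D * (β.2 - β₀.2) ^ 2 := fun β => by
    rw [hf, hf, hDdef, ← e1, ← e2]; ring
  refine ⟨⟨β₀, fun β => ?_⟩, fun β hβ => ?_⟩
  · have : 0 ≤ A0 * (f β - f β₀) := by rw [hsq]; positivity
    nlinarith [nonneg_of_mul_nonneg_right this hA0]
  · have h1 : A0 * (f β - f β₀) ≤ 0 := mul_nonpos_of_nonneg_of_nonpos hA0.le (by linarith [hβ β₀])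
    rw [hsq] at h1
    have h2 : D * (β.2 - β₀.2) ^ 2 ≤ 0 := by
      linarith [sq_nonneg (A0 * (β.1 - β₀.1) + A1 * (β.2 - β₀.2))]
    have h3 : (β.2 - β₀.2) ^ 2 ≤ 0 := nonpos_of_mul_nonpos_right h2 hD
    have h4 : β.2 - β₀.2 = 0 := by
      have := le_antisymm h3 (sq_nonneg _)
      exact pow_eq_zero_iff (two_ne_zero) |>.1 this
    have : β.2 = β₀.2 := by linarith
    rw [this]

end Quadratic

/-! ### Design sums, normal equations and the error of the local slope -/

section LocalLinear

variable {K : ℝ → ℝ} {n : ℕ} {b : ℝ}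

/-- The `k`-th weighted sum of the local design, with responses `Y`. -/
noncomputable def designSum (K : ℝ → ℝ) (n : ℕ) (b u : ℝ) (k : ℕ) (Y : ℕ → ℝ) : ℝ :=
  ∑ i ∈ Finset.Icc 1 n, (((i : ℝ) / n - u) / b) ^ k * K (((i : ℝ) / n - u) / b) * Y i

lemma designSum_add (u : ℝ) (k : ℕ) (Y Z : ℕ → ℝ) :
    designSum K n b u k (fun i => Y i + Z i) = designSum K n b u k Y + designSum K n b u k Z := by
  simp only [designSum, mul_add, Finset.sum_add_distrib]

lemma designSum_const_mul_pow (u : ℝ) (k j : ℕ) (a : ℝ) :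
    designSum K n b u k (fun i => a * (((i : ℝ) / n - u) / b) ^ j) =
      a * designSum K n b u (k + j) fun _ => 1 := by
  simp only [designSum, Finset.mul_sum]
  refine Finset.sum_congr rfl fun i _ => ?_
  rw [pow_add]; ring

lemma measurable_designSum (hK : Measurable K) (k : ℕ) (Y : ℕ → ℝ) :
    Measurable fun u => designSum K n b u k Y := by
  unfold designSum
  fun_prop

lemma llObjective_eq (hb : b ≠ 0) (Y : ℕ → ℝ) (u : ℝ) (β : ℝ × ℝ) :
    llObjective K n b Y u β = designSum K n b u 0 (fun i => Y i ^ 2) -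
      2 * β.1 * designSum K n b u 0 Y - 2 * β.2 * (b * designSum K n b u 1 Y) +
      β.1 ^ 2 * designSum K n b u 0 (fun _ => 1) +
      2 * β.1 * β.2 * (b * designSum K n b u 1 fun _ => 1) +
      β.2 ^ 2 * (b ^ 2 * designSum K n b u 2 fun _ => 1) := by
  simp only [llObjective, designSum, Finset.mul_sum, ← Finset.sum_add_distrib,
    ← Finset.sum_sub_distrib]
  refine Finset.sum_congr rfl fun i _ => ?_
  field_simp
  ring

lemma IsSmoothingKernel.integral_odd {K : ℝ → ℝ} (hK : IsSmoothingKernel K) {k : ℕ} (hk : Odd k) :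
    ∫ x in (-1 : ℝ)..1, x ^ k * K x = 0 := by
  have h := intervalIntegral.integral_comp_neg (a := -1) (b := 1) fun x => x ^ k * K x
  simp only [hk.neg_pow, hK.symm, neg_mul, neg_neg, intervalIntegral.integral_neg] at h
  linarith

lemma IsSmoothingKernel.measurable {K : ℝ → ℝ} (hK : IsSmoothingKernel K) : Measurable K := by
  obtain ⟨W, _, hW⟩ := hK.exists_isLipWeight
  exact measurable_of_continuousOn_Icc hW.zero hW.continuousOn

/-- The design sums of order `0,…,3` agree up to a constant with multiples of the moments of `K`. -/
lemma IsSmoothingKernel.exists_designSum_bounds {K : ℝ → ℝ} (hK : IsSmoothingKernel K) :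
    ∃ κ C₀ : ℝ, 0 < κ ∧ 0 < C₀ ∧ IsLipWeight C₀ K ∧ (∀ k ≤ 3, IsLipWeight C₀ fun x => x ^ k * K x) ∧
      ∀ (n : ℕ) (b u : ℝ), 0 < n → 0 < b → u ∈ Icc b (1 - b) →
        |designSum K n b u 0 (fun _ => 1) - n * b| ≤ C₀ ∧
        |designSum K n b u 1 fun _ => 1| ≤ C₀ ∧
        |designSum K n b u 2 (fun _ => 1) - n * b * κ| ≤ C₀ ∧
        |designSum K n b u 3 fun _ => 1| ≤ C₀ := by
  obtain ⟨W, hW0, hW⟩ := hK.exists_isLipWeight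
  -- A common constant: the weights need `4 * W`, their Riemann sums `6 * (4 * W)`.
  have mono : ∀ {F W'}, IsLipWeight W' F → W' ≤ 24 * W → IsLipWeight (24 * W) F := fun hF h =>
    ⟨hF.zero, fun x => (hF.bound x).trans h, fun x hx y hy =>
      (hF.lip x hx y hy).trans (mul_le_mul_of_nonneg_right h (abs_nonneg _))⟩
  refine ⟨∫ x in (-1 : ℝ)..1, K x * x ^ 2, 24 * W, hK.second_moment_pos, by positivity,
    mono hW (by linarith), fun k hk => mono (hW.pow_mul hk) (by linarith), fun n b u hn hb hu => ?_⟩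
  have key : ∀ k ≤ 3, |designSum K n b u k (fun _ => 1) -
      n * b * ∫ x in (-1 : ℝ)..1, x ^ k * K x| ≤ 24 * W := fun k hk => by
    have := (hW.pow_mul hk).abs_sum_sub_le hn hb hu
    simp only [designSum, mul_one]
    linarith
  have k0 := key 0 (by norm_num)
  have k1 := key 1 (by norm_num)
  have k2 := key 2 (by norm_num)
  have k3 := key 3 le_rfl
  rw [hK.integral_odd (by decide), mul_zero, sub_zero] at k1 k3
  simp only [pow_zero, one_mul, hK.integral_one, mul_one] at k0
  simp only [mul_comm (_ ^ 2) (K _)] at k2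
  exact ⟨k0, k1, k2, k3⟩

/-- For a large number of design points per window the local linear slope is given by the normal
equations. -/
lemma IsSmoothingKernel.exists_llArgmin_eq {K : ℝ → ℝ} (hK : IsSmoothingKernel K) :
    ∃ κ C₀ v₀ : ℝ, 0 < κ ∧ 0 < C₀ ∧ 1 ≤ v₀ ∧ (∀ k ≤ 3, IsLipWeight C₀ fun x => x ^ k * K x) ∧
      ∀ (n : ℕ) (b u : ℝ), v₀ ≤ n * b → 0 < b → u ∈ Icc b (1 - b) →
        designSum K n b u 0 (fun _ => 1) ≤ 2 * (n * b) ∧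
        |designSum K n b u 1 fun _ => 1| ≤ C₀ ∧
        |designSum K n b u 2 (fun _ => 1)| ≤ 2 * κ * (n * b) ∧
        |designSum K n b u 3 fun _ => 1| ≤ C₀ ∧ C₀ ≤ n * b ∧
        0 < designSum K n b u 0 (fun _ => 1) ∧
        κ * (n * b) ^ 2 / 8 ≤ designSum K n b u 0 (fun _ => 1) * designSum K n b u 2 (fun _ => 1) -
          designSum K n b u 1 (fun _ => 1) ^ 2 ∧
        ∀ Y, (llArgmin K n b Y u).2 =
          (designSum K n b u 0 (fun _ => 1) * (b * designSum K n b u 1 Y) -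
            b * designSum K n b u 1 (fun _ => 1) * designSum K n b u 0 Y) /
          (designSum K n b u 0 (fun _ => 1) * (b ^ 2 * designSum K n b u 2 fun _ => 1) -
            (b * designSum K n b u 1 fun _ => 1) ^ 2) := by
  obtain ⟨κ, C₀, hκ, hC₀, -, hF, hS⟩ := hK.exists_designSum_bounds
  -- With `v = n * b`, the summands of the threshold ensure in turn `v ≥ 1`, `S0 ≥ v / 2`, `S2 ≥ κ *
  -- v / 2` and `S1² ≤ κ * v / 8`, so that the determinant is at least `κ * v² / 8`.
  refine ⟨κ, C₀, 1 + 2 * C₀ + 2 * C₀ / κ + 8 * C₀ ^ 2 / κ, hκ, hC₀, ?_, hF, fun n b u hv hb hu => ?_⟩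
  · have h1 : 0 ≤ 2 * C₀ / κ := by positivity
    have h2 : 0 ≤ 8 * C₀ ^ 2 / κ := by positivity
    linarith
  set v : ℝ := n * b with hvdef
  have a1 : 0 ≤ 2 * C₀ / κ := by positivity
  have a2 : 0 ≤ 8 * C₀ ^ 2 / κ := by positivity
  have v1 : 1 ≤ v := by linarith
  have v2 : 2 * C₀ ≤ v := by linarith
  have v3 : 2 * C₀ ≤ v * κ := by rw [← div_le_iff₀ hκ]; linarith
  have v4 : 8 * C₀ ^ 2 ≤ v * κ := by rw [← div_le_iff₀ hκ]; linarith
  have hn : 0 < n := by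
    rcases Nat.eq_zero_or_pos n with h | h
    · rw [hvdef, h] at v1; simp at v1; linarith
    · exact h
  obtain ⟨s0, s1, s2, s3⟩ := hS n b u hn hb hu
  set S0 := designSum K n b u 0 fun _ => 1
  set S1 := designSum K n b u 1 fun _ => 1
  set S2 := designSum K n b u 2 fun _ => 1
  rw [abs_le] at s0 s2
  have p0 : v / 2 ≤ S0 := by linarith
  have p2 : v * κ / 2 ≤ S2 := by linarith
  have hS0 : 0 < S0 := by linarith
  have hΔ : κ * v ^ 2 / 8 ≤ S0 * S2 - S1 ^ 2 := by
    have q1 : v / 2 * (v * κ / 2) ≤ S0 * S2 := mul_le_mul p0 p2 (by positivity) hS0.le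
    have q2 : S1 ^ 2 ≤ C₀ ^ 2 := sq_le_sq.2 (by rwa [abs_of_pos hC₀])
    have q3 : v * κ ≤ v * κ * v := le_mul_of_one_le_right (by positivity) v1
    nlinarith
  refine ⟨by linarith, s1, ?_, s3, by linarith, hS0, hΔ, fun Y => ?_⟩
  · rw [abs_of_nonneg (by nlinarith)]; linarith
  have hΔ0 : 0 < S0 * S2 - S1 ^ 2 := lt_of_lt_of_le (by positivity) hΔ
  have hmin := exists_argmin_quadratic (f := llObjective K n b Y u) (llObjective_eq hb.ne' Y u) hS0
    (by
      have : S0 * (b ^ 2 * S2) - (b * S1) ^ 2 = b ^ 2 * (S0 * S2 - S1 ^ 2) := by ring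
      rw [this]; positivity)
  -- A minimizer exists, so the chosen pair is one, and uniqueness identifies its slope.
  exact hmin.2 _ (Classical.epsilon_spec hmin.1)

/-- Uniform error bound for the local linear estimator of the derivative, in terms of the partial
sums of the errors over windows of length `2nb`. -/
lemma IsSmoothingKernel.exists_abs_llArgmin_sub_le {K m : ℝ → ℝ} (hK : IsSmoothingKernel K)
    (hm : IsC21 m) :
    ∃ C v₀ : ℝ, 0 < C ∧ ∀ (n : ℕ) (b R : ℝ) (e : ℕ → ℝ), v₀ ≤ n * b → 0 < b → 0 ≤ R →
      (∀ j k : ℕ, 1 ≤ j → k ≤ n → (k : ℝ) - j ≤ 2 * (n * b) → |∑ i ∈ Finset.Icc j k, e i| ≤ R) →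
      ∀ u ∈ Icc b (1 - b), ∀ Y : ℕ → ℝ, (∀ i ∈ Finset.Icc 1 n, Y i = m ((i : ℝ) / n) + e i) →
        |(llArgmin K n b Y u).2 - slope m u| ≤ C * (b ^ 2 + 1 / n + R / (n * b ^ 2)) := by
  obtain ⟨κ, C₀, v₀, hκ, hC₀, hv₀, hF, hS⟩ := hK.exists_llArgmin_eq
  obtain ⟨L, hL, hLip, hbd⟩ := hm.exists_lipschitz
  refine ⟨8 / κ * (L * C₀ * (1 + κ) + 9 * C₀ * L + 9 * C₀), v₀, by positivity,
    fun n b R e hv hb hR0 hR u hu Y hY => ?_⟩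
  obtain ⟨s0, s1, s2, s3, hCv, hS0, hΔ, hform⟩ := hS n b u hv hb hu
  have v1 : 1 ≤ n * b := hv₀.trans hv
  have hn : 0 < n := by
    rcases Nat.eq_zero_or_pos n with h | h
    · rw [h] at v1; simp at v1; linarith
    · exact h
  have hn' : (0 : ℝ) < n := by exact_mod_cast hn
  have hu01 : u ∈ Icc (0 : ℝ) 1 := ⟨hb.le.trans hu.1, hu.2.trans (by linarith)⟩
  let r : ℕ → ℝ := fun i => m ((i : ℝ) / n) - m u - slope m u * ((i : ℝ) / n - u) -
    curv m u / 2 * ((i : ℝ) / n - u) ^ 2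
  have hsplit : ∀ k, designSum K n b u k Y = m u * (designSum K n b u k fun _ => 1) +
      slope m u * b * (designSum K n b u (k + 1) fun _ => 1) +
      curv m u / 2 * b ^ 2 * (designSum K n b u (k + 2) fun _ => 1) +
      (designSum K n b u k r + designSum K n b u k e) := fun k => by
    have e1 : designSum K n b u k Y = designSum K n b u k fun i =>
        (m u * (((i : ℝ) / n - u) / b) ^ 0 + slope m u * b * (((i : ℝ) / n - u) / b) ^ 1 +
          curv m u / 2 * b ^ 2 * (((i : ℝ) / n - u) / b) ^ 2) + (r i + e i) := by
      refine Finset.sum_congr rfl fun i hi => ?_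
      rw [hY i hi]
      simp only [r]
      congr 1
      field_simp
      ring
    rw [e1, designSum_add, designSum_add, designSum_add, designSum_add, designSum_const_mul_pow,
      designSum_const_mul_pow, designSum_const_mul_pow]
    rfl
  have hT : ∀ k ≤ 3, |designSum K n b u k r + designSum K n b u k e| ≤
      3 * C₀ * (n * b * (L * b ^ 3) + R) := fun k hk => by
    have t1 := (hF k hk).abs_sum_mul_le_of_bound hn hb hu (e := r) (R := L * b ^ 3) (by positivity)
      fun i hi hx => by
        have hi1 : (i : ℝ) / n ∈ Icc (0 : ℝ) 1 := by
          rw [Finset.mem_Icc] at hi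
          refine ⟨by positivity, div_le_one_of_le₀ ?_ hn'.le⟩
          exact_mod_cast hi.2
        refine (hm.abs_taylor_le hL.le hLip hu01 hi1).trans ?_
        refine mul_le_mul_of_nonneg_left (pow_le_pow_left₀ (abs_nonneg _) ?_ 3) hL.le
        have := abs_le.2 hx
        rwa [abs_div, abs_of_pos hb, div_le_one hb] at this
    have t2 := (hF k hk).abs_sum_mul_le hn hb hu hR0 hR
    refine (abs_add_le _ _).trans ((add_le_add t1 t2).trans ?_)
    have : (2 * (n * b) + 1) * (C₀ * (L * b ^ 3)) ≤ 3 * (n * b) * (C₀ * (L * b ^ 3)) :=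
      mul_le_mul_of_nonneg_right (by linarith) (by positivity)
    linarith
  have hT0 := hT 0 (by norm_num)
  have hT1 := hT 1 (by norm_num)
  rw [hform Y, hsplit 0, hsplit 1]
  simp only [zero_add, Nat.reduceAdd]
  set S0 := designSum K n b u 0 fun _ => 1
  set S1 := designSum K n b u 1 fun _ => 1
  set S2 := designSum K n b u 2 fun _ => 1
  set S3 := designSum K n b u 3 fun _ => 1
  set T0 := designSum K n b u 0 r + designSum K n b u 0 e
  set T1 := designSum K n b u 1 r + designSum K n b u 1 e
  set Tb := 3 * C₀ * (n * b * (L * b ^ 3) + R) with hTb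
  set v : ℝ := n * b with hvdef
  have hv0 : 0 < v := by linarith
  have hTb0 : 0 ≤ Tb := by positivity
  have hΔ0 : 0 < S0 * S2 - S1 ^ 2 := lt_of_lt_of_le (by positivity) hΔ
  -- The odd moments of the kernel vanish, so `S1` and `S3` stay bounded and `S0 * S3 - S1 * S2` is
  -- of order `v`, not `v²`. Hence the curvature contributes only `1 / n` to the slope error.
  have hnum : |curv m u / 2 * b ^ 2 * (S0 * S3 - S1 * S2) + (S0 * T1 - S1 * T0)| ≤
      v * (L * C₀ * (1 + κ) * b ^ 2 + 3 * Tb) := by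
    have q1 : |S0 * S3 - S1 * S2| ≤ 2 * v * C₀ + C₀ * (2 * κ * v) := by
      refine (abs_sub _ _).trans (add_le_add ?_ ?_)
      · rw [abs_mul, abs_of_pos hS0]
        exact mul_le_mul s0 s3 (abs_nonneg _) (by positivity)
      · rw [abs_mul]
        exact mul_le_mul s1 s2 (abs_nonneg _) (by positivity)
    have q2 : |S0 * T1 - S1 * T0| ≤ 2 * v * Tb + v * Tb := by
      refine (abs_sub _ _).trans (add_le_add ?_ ?_)
      · rw [abs_mul, abs_of_pos hS0]
        exact mul_le_mul s0 hT1 (abs_nonneg _) (by positivity)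
      · rw [abs_mul]
        exact mul_le_mul (s1.trans hCv) hT0 (abs_nonneg _) (by positivity)
    have q3 : |curv m u / 2 * b ^ 2| ≤ L / 2 * b ^ 2 := by
      rw [abs_mul, abs_div, abs_of_pos (by positivity : 0 < b ^ 2), abs_two]
      have := hbd u hu01
      gcongr
    refine (abs_add_le _ _).trans ?_
    rw [abs_mul]
    calc _ ≤ L / 2 * b ^ 2 * (2 * v * C₀ + C₀ * (2 * κ * v)) + (2 * v * Tb + v * Tb) := by gcongr
      _ = _ := by ring
  -- The constant part of the regression function cancels and the linear part reproduces the true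
  -- slope exactly.
  have hform2 : (S0 * (b * (m u * S1 + slope m u * b * S2 + curv m u / 2 * b ^ 2 * S3 + T1)) -
        b * S1 * (m u * S0 + slope m u * b * S1 + curv m u / 2 * b ^ 2 * S2 + T0)) /
        (S0 * (b ^ 2 * S2) - (b * S1) ^ 2) - slope m u =
      (curv m u / 2 * b ^ 2 * (S0 * S3 - S1 * S2) + (S0 * T1 - S1 * T0)) /
        (b * (S0 * S2 - S1 ^ 2)) := by
    have : S0 * (b ^ 2 * S2) - (b * S1) ^ 2 = b ^ 2 * (S0 * S2 - S1 ^ 2) := by ring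
    rw [this]
    field_simp
    ring
  rw [hform2, abs_div, abs_of_pos (by positivity : 0 < b * (S0 * S2 - S1 ^ 2))]
  calc _ ≤ v * (L * C₀ * (1 + κ) * b ^ 2 + 3 * Tb) / (b * (κ * v ^ 2 / 8)) := by gcongr
    _ = 8 / κ * (L * C₀ * (1 + κ) * (1 / n) + 9 * C₀ * L * b ^ 2 + 9 * C₀ * (R / (n * b ^ 2))) := by
        rw [hTb, hvdef]
        field_simp
        ring
    _ ≤ _ := by
        rw [mul_assoc (8 / κ) (_ + _ + _)]
        refine mul_le_mul_of_nonneg_left ?_ (by positivity)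
        have w1 : 0 ≤ L * C₀ * (1 + κ) := by positivity
        have w2 : 0 ≤ 9 * C₀ * L := by positivity
        have w3 : 0 ≤ 9 * C₀ := by positivity
        have x1 : 0 ≤ b ^ 2 := by positivity
        have x2 : (0 : ℝ) ≤ 1 / n := by positivity
        have x3 : 0 ≤ R / (n * b ^ 2) := by positivity
        nlinarith [mul_nonneg w1 x1, mul_nonneg w1 x3, mul_nonneg w2 x2, mul_nonneg w2 x3,
          mul_nonneg w3 x1, mul_nonneg w3 x2]

/-- The estimated slope is integrated in the definition of `ĉ`, but a choice of minimizers carries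
no regularity; the explicit formula supplies measurability. -/
lemma IsSmoothingKernel.exists_measurable_slopeHat {K : ℝ → ℝ} (hK : IsSmoothingKernel K) :
    ∃ v₀ : ℝ, ∀ (n : ℕ) (b : ℝ) (Y : ℕ → ℝ), v₀ ≤ n * b → 0 < b → b ≤ 1 / 2 →
      Measurable (slopeHat K n b Y) := by
  obtain ⟨κ, C₀, v₀, -, -, -, -, hS⟩ := hK.exists_llArgmin_eq
  refine ⟨v₀, fun n b Y hv hb hb2 => ?_⟩
  have hcl : ∀ t : ℝ, max b (min t (1 - b)) ∈ Icc b (1 - b) := fun t =>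
    ⟨le_max_left _ _, max_le (by linarith) (min_le_right _ _)⟩
  have e : slopeHat K n b Y = (fun u => (designSum K n b u 0 (fun _ => 1) * (b * designSum K n b u 1 Y) -
            b * designSum K n b u 1 (fun _ => 1) * designSum K n b u 0 Y) /
          (designSum K n b u 0 (fun _ => 1) * (b ^ 2 * designSum K n b u 2 fun _ => 1) -
            (b * designSum K n b u 1 fun _ => 1) ^ 2)) ∘ fun t => max b (min t (1 - b)) := by
    ext t
    exact (hS n b _ hv hb (hcl t)).2.2.2.2.2.2.2 Y
  have hd := fun k Y => measurable_designSum (n := n) (b := b) hK.measurable k Y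
  rw [e]
  refine Measurable.comp ?_ (by fun_prop)
  exact (((hd _ _).mul ((hd _ _).const_mul b)).sub (((hd _ _).const_mul b).mul (hd _ _))).div
    (((hd _ _).mul ((hd _ _).const_mul _)).sub (((hd _ _).const_mul b).pow_const 2))

end LocalLinear

/-! ### The density step -/

section Density

variable {Kd : ℝ → ℝ}

lemma IsDensityKernel.eq_zero (hKd : IsDensityKernel Kd) {x : ℝ} (hx : x ∉ Icc (-1 : ℝ) 1) :
    Kd x = 0 := by
  by_contra h
  exact hx (hKd.supp h)

lemma IsDensityKernel.integrable (hKd : IsDensityKernel Kd) : Integrable Kd :=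
  integrable_of_continuousOn_Icc (fun _ => hKd.eq_zero) hKd.cont

lemma IsDensityKernel.exists_bound (hKd : IsDensityKernel Kd) : ∃ W : ℝ, 0 < W ∧ ∀ x, |Kd x| ≤ W := by
  obtain ⟨B, hB⟩ := isCompact_Icc.exists_bound_of_continuousOn hKd.cont
  refine ⟨|B| + 1, by positivity, fun x => ?_⟩
  by_cases hx : x ∈ Icc (-1 : ℝ) 1
  · have := hB x hx
    rw [Real.norm_eq_abs] at this
    linarith [le_abs_self B]
  · rw [hKd.eq_zero hx, abs_zero]; positivity

lemma IsDensityKernel.exists_modulus (hKd : IsDensityKernel Kd) {ω : ℝ} (hω : 0 < ω) :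
    ∃ η > 0, ∀ x ∈ Icc (-1 : ℝ) 1, ∀ y ∈ Icc (-1 : ℝ) 1, |x - y| ≤ η → |Kd x - Kd y| ≤ ω := by
  have := isCompact_Icc.uniformContinuousOn_of_continuous hKd.cont
  rw [Metric.uniformContinuousOn_iff] at this
  obtain ⟨η, hη, h⟩ := this ω hω
  refine ⟨η / 2, by positivity, fun x hx y hy hxy => (h x hx y hy ?_).le⟩
  rw [Real.dist_eq]; linarith

lemma not_mem_Icc_of_lt_abs {x : ℝ} (h : 1 < |x|) : x ∉ Icc (-1 : ℝ) 1 := fun hx =>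
  absurd (abs_le.2 hx) (not_le.2 h)

set_option maxHeartbeats 1000000 in
/-- Local uniform consistency of the density step at an interior point with positive second
derivative. -/
lemma IsDensityKernel.exists_abs_fHat_sub_le (hKd : IsDensityKernel Kd) {m : ℝ → ℝ} (hm : IsC21 m)
    (hmono : StrictMonoOn (slope m) (Icc 0 1)) {v : ℝ} (hv : v ∈ Ioo (0 : ℝ) 1)
    (hD : 0 < curv m v) {δ : ℝ} (hδ : 0 < δ) :
    ∃ κ > 0, ∃ τ > 0, ∀ (N : ℕ) (h b t : ℝ) (p : ℝ → ℝ), 0 < N → 0 < h → h < τ → b < τ →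
      1 / (N * h) < τ → (∀ u ∈ Icc (0 : ℝ) 1, |p u - slope m u| ≤ τ) →
      (∀ u ∈ Icc b (1 - b), |p u - slope m u| ≤ τ * h) → |t - slope m v| < κ →
      |fHat Kd N h p t - 1 / curv m v| ≤ δ := by
  obtain ⟨L, hL, hLip, -⟩ := hm.exists_lipschitz
  obtain ⟨W, hW, hWb⟩ := hKd.exists_bound
  set D := curv m v with hDdef
  obtain ⟨η₀, hη₀, hmod⟩ := hKd.exists_modulus (ω := δ * D / 4) (by positivity)
  -- Makes the jump part `4 * W * η` of the oscillation integral at most `δ * D / 2`.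
  set η := min η₀ (δ * D / (8 * W)) with hη
  have hη0 : 0 < η := lt_min hη₀ (by positivity)
  -- Relative linearisation error: `η * D / 12` keeps kernel arguments within `η / 3` for `|u - w| ≤
  -- 4 * h / D`, and `D / 4` keeps more distant points outside the support.
  set e := min (D / 4) (η * D / 12) with he
  have he0 : 0 < e := lt_min (by positivity) (by positivity)
  have heD : e ≤ D / 4 := min_le_left _ _
  have heη : e ≤ η * D / 12 := min_le_right _ _
  -- Within `r` of `v` the second derivative differs from `D` by at most `e`; the other two bounds
  -- keep this neighbourhood away from `0` and `1`.
  set r := min (e / L) (min (v / 2) ((1 - v) / 2)) with hr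
  have hv1 : 0 < 1 - v := by linarith [hv.2]
  have hr0 : 0 < r := lt_min (by positivity) (lt_min (by linarith [hv.1]) (by linarith))
  have hrL : L * r ≤ e := by
    rw [← le_div_iff₀' hL]; exact min_le_left _ _
  have hrv : r ≤ v / 2 := (min_le_right _ _).trans (min_le_left _ _)
  have hrv' : r ≤ (1 - v) / 2 := (min_le_right _ _).trans (min_le_right _ _)
  have hI : Icc (v - r) (v + r) ⊆ Icc 0 1 := Icc_subset_Icc (by linarith [hv.1]) (by linarith [hv.2])
  have m1 : slope m (v + r / 2) < slope m (v + r) := hmono (hI ⟨by linarith, by linarith⟩)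
    (hI ⟨by linarith, by linarith⟩) (by linarith)
  have m2 : slope m (v - r) < slope m (v - r / 2) := hmono (hI ⟨by linarith, by linarith⟩)
    (hI ⟨by linarith, by linarith⟩) (by linarith)
  have m3 : slope m v < slope m (v + r / 2) := hmono (hI ⟨by linarith, by linarith⟩)
    (hI ⟨by linarith, by linarith⟩) (by linarith)
  have m4 : slope m (v - r / 2) < slope m v := hmono (hI ⟨by linarith, by linarith⟩)
    (hI ⟨by linarith, by linarith⟩) (by linarith)
  -- By strict monotonicity, slopes outside the `r`-neighbourhood differ by at least `γ` from slopes
  -- inside the `r / 2`-neighbourhood.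
  set γ := min (slope m (v + r) - slope m (v + r / 2)) (slope m (v - r / 2) - slope m (v - r)) with hγ
  have hγ0 : 0 < γ := lt_min (by linarith) (by linarith)
  obtain ⟨τ, hτ0, hτ1, hτη, hτD, hτγ, hτr, hτr', hτD1⟩ : ∃ τ > 0, τ ≤ 1 ∧ τ ≤ η / 3 ∧ D * τ ≤ η / 3 ∧
      τ < γ / 2 ∧ τ ≤ D * r / 8 ∧ τ ≤ r ∧ D * τ ≤ 1 := by
    have : ∀ᶠ τ in 𝓝[>] (0 : ℝ), τ ≤ 1 ∧ τ ≤ η / 3 ∧ D * τ ≤ η / 3 ∧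
      τ < γ / 2 ∧ τ ≤ D * r / 8 ∧ τ ≤ r ∧ D * τ ≤ 1 := by
      have t0 : Tendsto (fun τ : ℝ => τ) (𝓝[>] 0) (𝓝 0) := nhdsWithin_le_nhds
      have t1 : Tendsto (fun τ : ℝ => D * τ) (𝓝[>] 0) (𝓝 0) := by simpa using t0.const_mul D
      filter_upwards [t0.eventually_le_const (zero_lt_one (α := ℝ)),
        t0.eventually_le_const (by positivity : 0 < η / 3),
        t1.eventually_le_const (by positivity : 0 < η / 3),
        t0.eventually_lt_const (by positivity : 0 < γ / 2),
        t0.eventually_le_const (by positivity : 0 < D * r / 8), t0.eventually_le_const hr0,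
        t1.eventually_le_const (zero_lt_one (α := ℝ))] with τ h1 h2 h3 h4 h5 h6 h7
      exact ⟨h1, h2, h3, h4, h5, h6, h7⟩
    obtain ⟨τ, h, h0⟩ := (this.and self_mem_nhdsWithin).exists
    exact ⟨τ, h0, h⟩
  refine ⟨min (slope m (v + r / 2) - slope m v) (slope m v - slope m (v - r / 2)),
    lt_min (by linarith) (by linarith), τ, hτ0, ?_⟩
  intro N h b t p hN hh hhτ hbτ hNh hp hp' ht
  have hN' : (0 : ℝ) < N := by exact_mod_cast hN
  -- The linearisation is centred at the point where the slope equals `t`, but with derivative `D`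
  -- taken at `v`; this yields uniformity for `t` near `slope m v`.
  obtain ⟨w, hw, hwt⟩ : ∃ w ∈ Icc (v - r / 2) (v + r / 2), slope m w = t := by
    have hc : ContinuousOn (slope m) (Icc (v - r / 2) (v + r / 2)) :=
      hm.continuousOn_slope.mono ((Icc_subset_Icc (by linarith) (by linarith)).trans hI)
    have ht' := abs_lt.1 ht
    refine intermediate_value_Icc (by linarith) hc ⟨?_, ?_⟩
    · linarith [min_le_right (slope m (v + r / 2) - slope m v) (slope m v - slope m (v - r / 2))]
    · linarith [min_le_left (slope m (v + r / 2) - slope m v) (slope m v - slope m (v - r / 2))]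
  have hwI : w ∈ Icc (v - r) (v + r) := ⟨by linarith [hw.1], by linarith [hw.2]⟩
  have hlin : ∀ u ∈ Icc (v - r) (v + r), |slope m u - t - D * (u - w)| ≤ e * |u - w| := fun u hu => by
    have key := abs_sub_le_of_hasDerivWithinAt (f := fun x => slope m x - D * x)
      (f' := fun x => curv m x - D) (B := e) (fun x hx => by
        have h1 := (hm.hasDerivWithinAt_slope hx).sub
          (((hasDerivAt_id x).const_mul D).hasDerivWithinAt)
        rw [mul_one] at h1
        exact h1) (hI hwI) (hI hu) fun x hx => by
        have hxI := uIcc_subset_Icc hwI hu hx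
        refine (hLip x (hI hxI) v ⟨hv.1.le, hv.2.le⟩).trans ?_
        refine le_trans (mul_le_mul_of_nonneg_left ?_ hL.le) hrL
        rw [abs_le]; constructor <;> linarith [hxI.1, hxI.2]
    refine le_trans (le_of_eq ?_) key
    rw [← hwt]; congr 1; ring
  -- The grid step in the rescaled variable `y = D * (u - w) / h`, in which the sum becomes a
  -- Riemann sum of `∫ Kd = 1`.
  set d := D / (N * h) with hd
  have hd0 : 0 < d := by positivity
  have hdτ : d ≤ D * τ := by
    rw [hd, div_eq_mul_one_div]; exact mul_le_mul_of_nonneg_left hNh.le hD.le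
  have hgrid : ∀ i : ℕ, D * ((i : ℝ) / N - w) / h = -(D * w / h) + i * d := fun i => by
    rw [hd]; field_simp; ring
  have hsupp : ∀ x, x ∉ Icc (-1 : ℝ) 1 → Kd x = 0 := fun _ => hKd.eq_zero
  have hoscpos : ∀ y, 0 ≤ oscBound (δ * D / 4) W η y := fun y => by
    refine add_nonneg (add_nonneg ?_ ?_) ?_ <;>
      exact indicator_nonneg (fun _ _ => by positivity) _
  -- Close to `w` the two kernel arguments differ by at most `2 * η / 3` from linearisation and
  -- slope error, plus `η / 3` from the grid. At all other grid points both kernel values vanish.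
  have hterm : ∀ i ∈ Finset.Icc 1 N, ∀ y ∈ Icc (-(D * w / h) + ((i : ℝ) - 1) * d)
      (-(D * w / h) + i * d), |Kd ((p ((i : ℝ) / N) - t) / h) - Kd y| ≤
        oscBound (δ * D / 4) W η y := by
    intro i hi y hy
    rw [Finset.mem_Icc] at hi
    set u := (i : ℝ) / N with hu
    have hu01 : u ∈ Icc (0 : ℝ) 1 := ⟨by positivity, div_le_one_of_le₀ (by exact_mod_cast hi.2) hN'.le⟩
    set yi := D * (u - w) / h with hyi
    have hyi' : |yi - y| ≤ d := by
      have := hgrid i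
      rw [abs_le]
      constructor <;> linarith [hy.1, hy.2]
    have hd1 : d ≤ 1 := hdτ.trans hτD1
    have hzero : 1 < |(p u - t) / h| → 2 < |yi| →
        |Kd ((p u - t) / h) - Kd y| ≤ oscBound (δ * D / 4) W η y := fun h1 h2 => by
      have h3 : 1 < |y| := by
        have := abs_sub_abs_le_abs_sub yi y
        linarith
      rw [hsupp _ (not_mem_Icc_of_lt_abs h1), hsupp _ (not_mem_Icc_of_lt_abs h3), sub_zero, abs_zero]
      exact hoscpos y
    have hyiabs : |yi| = D * |u - w| / h := by
      rw [hyi, abs_div, abs_mul, abs_of_pos hD, abs_of_pos hh]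
    by_cases huI : u ∈ Icc (v - r) (v + r)
    · have hub : u ∈ Icc b (1 - b) := ⟨by linarith [huI.1], by linarith [huI.2]⟩
      have herr : |p u - t - D * (u - w)| ≤ e * |u - w| + τ * h := by
        have h1 := hp' u hub
        have h2 := hlin u huI
        have e1 : p u - t - D * (u - w) = (slope m u - t - D * (u - w)) + (p u - slope m u) := by ring
        rw [e1]
        exact (abs_add_le _ _).trans (add_le_add h2 h1)
      by_cases hfar : |u - w| ≤ 4 * h / D
      · refine abs_sub_le_oscBound (by positivity) hsupp hWb (fun x hx z hz hxz =>
          hmod x hx z hz (hxz.trans (min_le_left _ _))) ?_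
        have h1 : |(p u - t) / h - yi| ≤ 2 * η / 3 := by
          have e1 : (p u - t) / h - yi = (p u - t - D * (u - w)) / h := by rw [hyi]; ring
          rw [e1, abs_div, abs_of_pos hh, div_le_iff₀ hh]
          refine herr.trans ?_
          have h2 : e * |u - w| ≤ η * D / 12 * (4 * h / D) := by gcongr
          have h3 : η * D / 12 * (4 * h / D) = η / 3 * h := by field_simp; ring
          nlinarith
        have e2 : (p u - t) / h - y = ((p u - t) / h - yi) + (yi - y) := by ring
        rw [e2]
        refine (abs_add_le _ _).trans ?_
        linarith
      · rw [not_le, div_lt_iff₀ hD] at hfar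
        refine hzero ?_ ?_
        · rw [abs_div, abs_of_pos hh, lt_div_iff₀ hh, one_mul]
          have h1 := abs_sub_abs_le_abs_sub (D * (u - w)) (D * (u - w) - (p u - t))
          have e1 : D * (u - w) - (D * (u - w) - (p u - t)) = p u - t := by ring
          rw [e1, abs_sub_comm (D * (u - w)) (p u - t), abs_mul, abs_of_pos hD] at h1
          have h2 : e * |u - w| ≤ D / 4 * |u - w| := mul_le_mul_of_nonneg_right heD (abs_nonneg _)
          nlinarith
        · rw [hyiabs, lt_div_iff₀ hh]; linarith
    -- Here the grid point may lie in a boundary strip, where only the weaker bound `τ` is known; it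
    -- suffices because `γ` exceeds `τ + h`.
    · have hcase : u < v - r ∨ v + r < u := by
        by_contra hcon
        rw [not_or, not_lt, not_lt] at hcon
        exact huI ⟨hcon.1, hcon.2⟩
      have hdist : r / 2 ≤ |u - w| := by
        rcases hcase with hc | hc
        · rw [abs_of_neg (by linarith [hw.1])]; linarith [hw.1]
        · rw [abs_of_pos (by linarith [hw.2])]; linarith [hw.2]
      have hpγ : γ ≤ |slope m u - t| := by
        have hwm : t ≤ slope m (v + r / 2) ∧ slope m (v - r / 2) ≤ t := by
          rw [← hwt]
          exact ⟨hmono.monotoneOn (hI hwI) (hI ⟨by linarith, by linarith⟩) hw.2,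
            hmono.monotoneOn (hI ⟨by linarith, by linarith⟩) (hI hwI) hw.1⟩
        rcases hcase with hc | hc
        · have : slope m u ≤ slope m (v - r) :=
            hmono.monotoneOn hu01 (hI ⟨by linarith, by linarith⟩) hc.le
          have h2 : γ ≤ slope m (v - r / 2) - slope m (v - r) := min_le_right _ _
          rw [abs_sub_comm]
          exact le_trans (by linarith [hwm.2]) (le_abs_self _)
        · have : slope m (v + r) ≤ slope m u :=
            hmono.monotoneOn (hI ⟨by linarith, by linarith⟩) hu01 hc.le
          have h2 : γ ≤ slope m (v + r) - slope m (v + r / 2) := min_le_left _ _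
          exact le_trans (by linarith [hwm.1]) (le_abs_self _)
      refine hzero ?_ ?_
      · rw [abs_div, abs_of_pos hh, lt_div_iff₀ hh, one_mul]
        have h1 := abs_sub_abs_le_abs_sub (slope m u - t) (slope m u - p u)
        have e1 : slope m u - t - (slope m u - p u) = p u - t := by ring
        rw [e1, abs_sub_comm (slope m u) (p u)] at h1
        linarith [hp u hu01]
      · rw [hyiabs, lt_div_iff₀ hh]
        have : D * (r / 2) ≤ D * |u - w| := mul_le_mul_of_nonneg_left hdist hD.le
        nlinarith
  have key := abs_sum_sub_integral_le (F := Kd) (ψ := oscBound (δ * D / 4) W η) hKd.integrable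
    (integrable_oscBound _ _ _) hd0 N hoscpos hterm
  have hwpos : r / 2 ≤ w := by linarith [hw.1, hv.1]
  have hwpos' : r / 2 ≤ 1 - w := by linarith [hw.2, hv.2]
  rw [integral_oscBound _ _ hη0.le, intervalIntegral_eq_of_support hsupp
    (by
      rw [neg_le_neg_iff, one_le_div hh]
      nlinarith)
    (by
      have : -(D * w / h) + N * d = D * (1 - w) / h := by rw [hd]; field_simp; ring
      rw [this, one_le_div hh]
      nlinarith), hKd.integral_one] at key
  have efin : fHat Kd N h p t - 1 / D =
      1 / D * (d * ∑ i ∈ Finset.Icc 1 N, Kd ((p ((i : ℝ) / N) - t) / h) - 1) := by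
    rw [fHat, hd]; field_simp
  rw [efin, abs_mul, abs_of_pos (by positivity : 0 < 1 / D)]
  have hWη : 4 * W * η ≤ δ * D / 2 := by
    have : η ≤ δ * D / (8 * W) := min_le_right _ _
    rw [le_div_iff₀ (by positivity)] at this
    linarith
  calc _ ≤ 1 / D * (2 * (δ * D / 4) + 4 * W * η) := mul_le_mul_of_nonneg_left key (by positivity)
    _ ≤ 1 / D * (δ * D) := mul_le_mul_of_nonneg_left (by linarith) (by positivity)
    _ = δ := by field_simp

/-! ### The estimated inverse of the slope -/

/-- The integral of a scaled kernel. -/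
lemma IsDensityKernel.integral_comp (x₀ x p : ℝ) {h : ℝ} (hh : 0 < h) :
    ∫ t in x₀..x, 1 / h * Kd ((p - t) / h) = ∫ y in ((p - x) / h)..((p - x₀) / h), Kd y := by
  rw [intervalIntegral.integral_const_mul]
  have e : ∀ t, Kd ((p - t) / h) = Kd (p / h - t / h) := fun t => by rw [sub_div]
  simp only [e]
  rw [intervalIntegral.integral_comp_sub_div Kd hh.ne', smul_eq_mul, sub_div, sub_div]
  field_simp

lemma IsDensityKernel.abs_integral_le_one (hKd : IsDensityKernel Kd) (a b : ℝ) :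
    |∫ y in a..b, Kd y| ≤ 1 := by
  have h1 : ∫ y, Kd y = 1 := by
    rw [← hKd.integral_one, intervalIntegral.integral_of_le (by norm_num), ← integral_Icc_eq_integral_Ioc]
    exact (setIntegral_eq_integral_of_forall_compl_eq_zero fun x hx => hKd.eq_zero hx).symm
  rw [← Real.norm_eq_abs, ← h1]
  refine intervalIntegral.norm_integral_le_integral_norm_uIoc.trans ?_
  have e : ∀ y, ‖Kd y‖ = Kd y := fun y => by rw [Real.norm_eq_abs, abs_of_nonneg (hKd.nonneg y)]
  simp only [e]
  exact setIntegral_le_integral hKd.integrable (Eventually.of_forall hKd.nonneg)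

lemma IsDensityKernel.integral_eq_zero (hKd : IsDensityKernel Kd) {a b : ℝ} (ha : 1 < a) (hb : 1 < b) :
    ∫ y in a..b, Kd y = 0 := by
  have : ∀ y ∈ uIcc a b, Kd y = (fun _ => (0 : ℝ)) y := fun y hy => hKd.eq_zero fun h => by
    have := (lt_min ha hb).trans_le hy.1
    linarith [h.2]
  rw [intervalIntegral.integral_congr this, intervalIntegral.integral_zero]

lemma IsDensityKernel.integrable_fHat (hKd : IsDensityKernel Kd) (N : ℕ) {h : ℝ} (hh : 0 < h)
    (p : ℝ → ℝ) : Integrable (fHat Kd N h p) := by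
  unfold fHat
  refine (integrable_finsetSum _ fun i _ => ?_).const_mul _
  have := (hKd.integrable.comp_sub_left (p ((i : ℝ) / N) / h)).comp_div hh.ne'
  refine this.congr (Eventually.of_forall fun t => ?_)
  simp only [sub_div]

lemma IsDensityKernel.continuous_gHat (hKd : IsDensityKernel Kd) (x₀ : ℝ) (N : ℕ) {h : ℝ} (hh : 0 < h)
    (p : ℝ → ℝ) : Continuous (gHat x₀ (fHat Kd N h p)) :=
  intervalIntegral.continuous_primitive
    (fun _ _ => (hKd.integrable_fHat N hh p).intervalIntegrable) x₀

/-- Integrating each kernel exactly removes the factor `1 / h`: the summands become smoothed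
indicators, and no rate relative to `h` is needed for the slope estimator. -/
lemma IsDensityKernel.gHat_eq (hKd : IsDensityKernel Kd) (x₀ x : ℝ) (N : ℕ) {h : ℝ} (hh : 0 < h)
    (p : ℝ → ℝ) : gHat x₀ (fHat Kd N h p) x = 1 / N * ∑ i ∈ Finset.Icc 1 N,
      ∫ y in ((p ((i : ℝ) / N) - x) / h)..((p ((i : ℝ) / N) - x₀) / h), Kd y := by
  have e : ∀ t, fHat Kd N h p t =
      1 / N * ∑ i ∈ Finset.Icc 1 N, 1 / h * Kd ((p ((i : ℝ) / N) - t) / h) := fun t => by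
    rw [fHat, ← Finset.mul_sum, ← mul_assoc]
    congr 1
    rw [one_div_mul_one_div]
  simp only [gHat, e]
  rw [intervalIntegral.integral_const_mul, intervalIntegral.integral_finsetSum]
  · simp only [IsDensityKernel.integral_comp _ _ _ hh]
  · intro i _
    refine Integrable.intervalIntegrable (Integrable.const_mul ?_ _)
    have := (hKd.integrable.comp_sub_left (p ((i : ℝ) / N) / h)).comp_div hh.ne'
    refine this.congr (Eventually.of_forall fun t => ?_)
    simp only [sub_div]

/-- The continuous function `μ (u + η) - μ u` is positive on a compact interval, hence bounded away
from zero. -/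
lemma exists_separation {μ : ℝ → ℝ} (hμ : StrictMonoOn μ (Icc 0 1)) (hc : ContinuousOn μ (Icc 0 1))
    {η : ℝ} (hη : 0 < η) :
    ∃ τ > 0, ∀ u ∈ Icc (0 : ℝ) 1, ∀ u' ∈ Icc (0 : ℝ) 1, u + η ≤ u' → μ u + τ ≤ μ u' := by
  by_cases h1 : η ≤ 1
  · have hsub : Icc (0 : ℝ) (1 - η) ⊆ Icc 0 1 := Icc_subset_Icc le_rfl (by linarith)
    have hcont : ContinuousOn (fun u => μ (u + η) - μ u) (Icc 0 (1 - η)) := by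
      refine ContinuousOn.sub (hc.comp (by fun_prop) fun u hu => ?_) (hc.mono hsub)
      exact ⟨by linarith [hu.1], by linarith [hu.2]⟩
    obtain ⟨u₀, hu₀, hmin⟩ := isCompact_Icc.exists_isMinOn (nonempty_Icc.2 (by linarith)) hcont
    refine ⟨μ (u₀ + η) - μ u₀, sub_pos.2 (hμ (hsub hu₀) ⟨by linarith [hu₀.1], by linarith [hu₀.2]⟩
      (by linarith)), fun u hu u' hu' huu => ?_⟩
    have h2 : u ∈ Icc 0 (1 - η) := ⟨hu.1, by linarith [hu'.2]⟩
    have h3 : μ (u₀ + η) - μ u₀ ≤ μ (u + η) - μ u := hmin h2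
    have h4 := hμ.monotoneOn (a := u + η) ⟨by linarith [hu.1], by linarith [hu'.2]⟩ hu' huu
    linarith
  · exact ⟨1, one_pos, fun u hu u' hu' huu => by linarith [hu.1, hu'.2]⟩

/-- Uniform consistency of the estimated inverse. The number `w` is the value at `x` of the inverse of
`μ`, extended by `0` to the left and by `1` to the right. -/
lemma IsDensityKernel.exists_abs_gHat_sub_le (hKd : IsDensityKernel Kd) {μ : ℝ → ℝ}
    (hμ : StrictMonoOn μ (Icc 0 1)) (hc : ContinuousOn μ (Icc 0 1)) {δ : ℝ} (hδ : 0 < δ) :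
    ∃ τ > 0, ∀ (N : ℕ) (h x x' w : ℝ) (p : ℝ → ℝ), 0 < N → (1 : ℝ) / N < τ → 0 < h → h < τ →
      (∀ u ∈ Icc (0 : ℝ) 1, |p u - μ u| ≤ τ) → w ∈ Icc (0 : ℝ) 1 → (w < 1 → x ≤ μ w) →
      (0 < w → μ w ≤ x) → |x' - x| ≤ τ → |gHat (μ 0) (fHat Kd N h p) x' - w| ≤ δ := by
  set η := δ / 6 with hη
  have hη0 : 0 < η := by positivity
  -- Separation at distance `η / 2` leaves room for the grid step `1 / N < η / 2`; one third of `τ₁`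
  -- each is for the errors of `p` and of `x'` and for `h`.
  obtain ⟨τ₁, hτ₁, hsep⟩ := exists_separation hμ hc (half_pos hη0)
  refine ⟨min (τ₁ / 3) (η / 2), lt_min (by positivity) (by positivity), ?_⟩
  set τ := min (τ₁ / 3) (η / 2) with hτ
  have ht1 : 3 * τ ≤ τ₁ := by
    have : τ ≤ τ₁ / 3 := min_le_left _ _
    linarith
  have ht2 : τ ≤ η / 2 := min_le_right _ _
  intro N h x x' w p hN hNτ hh hhτ hp hw hw1 hw0 hx
  have hN' : (0 : ℝ) < N := by exact_mod_cast hN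
  rw [abs_le] at hx
  have h0mem : (0 : ℝ) ∈ Icc (0 : ℝ) 1 := by simp
  rw [hKd.gHat_eq _ _ _ hh]
  let J : ℕ → ℝ := fun i =>
    ∫ y in ((p ((i : ℝ) / N) - x') / h)..((p ((i : ℝ) / N) - μ 0) / h), Kd y
  let F : ℝ → ℝ := (Icc 0 w).indicator fun _ => 1
  -- The smoothed indicator agrees with `F` except near the jumps at `0` and `w`, where the
  -- difference is at most `2`. The integral is `2 * η + 4 * η = δ`.
  let ψ : ℝ → ℝ := fun y => (Icc 0 η).indicator (fun _ => 2) y +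
    (Icc (w - η) (w + η)).indicator (fun _ => 2) y
  have hψ1 : ∀ y, 0 ≤ (Icc 0 η).indicator (fun _ => (2 : ℝ)) y := fun y =>
    indicator_nonneg (fun _ _ => two_pos.le) _
  have hψ2 : ∀ y, 0 ≤ (Icc (w - η) (w + η)).indicator (fun _ => (2 : ℝ)) y := fun y =>
    indicator_nonneg (fun _ _ => two_pos.le) _
  have key := abs_sum_sub_integral_le (F := F) (ψ := ψ) (integrable_indicator_Icc _ _ _)
    ((integrable_indicator_Icc _ _ _).add (integrable_indicator_Icc _ _ _)) (d := 1 / N) (y₀ := 0)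
    (by positivity) N (a := J) (fun y => add_nonneg (hψ1 y) (hψ2 y)) (fun i hi y hy => by
      rw [Finset.mem_Icc] at hi
      simp only [zero_add] at hy
      set u := (i : ℝ) / N with hu
      have hu01 : u ∈ Icc (0 : ℝ) 1 :=
        ⟨by positivity, div_le_one_of_le₀ (by exact_mod_cast hi.2) hN'.le⟩
      have hyu : y ≤ u := by
        have := hy.2; rwa [mul_one_div] at this
      have hyu' : u - 1 / N ≤ y := by
        have := hy.1; rwa [sub_mul, one_mul, mul_one_div] at this
      have hy0 : 0 ≤ y := by
        refine le_trans ?_ hy.1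
        have : (1 : ℝ) ≤ i := by exact_mod_cast hi.1
        exact mul_nonneg (by linarith) (by positivity)
      have hFle : |F y| ≤ 1 := by
        simp only [F]
        by_cases hyw : y ∈ Icc 0 w
        · rw [indicator_of_mem hyw, abs_one]
        · rw [indicator_of_notMem hyw, abs_zero]; exact zero_le_one
      have hJ : |J i| ≤ 1 := hKd.abs_integral_le_one _ _
      have hpu := abs_le.1 (hp u hu01)
      by_cases c1 : y ≤ η
      · have : (2 : ℝ) ≤ ψ y := by
          simp only [ψ]
          have hmem : y ∈ Icc (0 : ℝ) η := ⟨hy0, c1⟩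
          rw [indicator_of_mem hmem]
          linarith [hψ2 y]
        exact (abs_sub _ _).trans (by linarith)
      by_cases c2 : y ∈ Icc (w - η) (w + η)
      · have : (2 : ℝ) ≤ ψ y := by
          simp only [ψ]
          rw [indicator_of_mem c2]
          linarith [hψ1 y]
        exact (abs_sub _ _).trans (by linarith)
      rw [not_le] at c1
      have hleft : μ 0 + τ₁ ≤ μ u := hsep 0 h0mem u hu01 (by linarith)
      have hJ0 : 1 < (p u - μ 0) / h := by rw [lt_div_iff₀ hh]; linarith
      have hJF : J i = F y := by
        rw [mem_Icc, not_and_or, not_le, not_le] at c2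
        rcases c2 with c2 | c2
        · have h2 : μ u + τ₁ ≤ μ w := hsep u hu01 w hw (by linarith)
          have h3 := hw0 (by linarith)
          have hJ1 : (p u - x') / h ≤ -1 := by rw [div_le_iff₀ hh]; linarith
          have hmem : y ∈ Icc (0 : ℝ) w := ⟨hy0, by linarith⟩
          have : F y = 1 := indicator_of_mem hmem _
          rw [this, ← hKd.integral_one]
          exact intervalIntegral_eq_of_support (fun _ => hKd.eq_zero) hJ1 hJ0.le
        · have h2 : μ w + τ₁ ≤ μ u := hsep w hw u hu01 (by linarith)
          have h3 := hw1 (by linarith [hu01.2])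
          have hJ1 : 1 < (p u - x') / h := by rw [lt_div_iff₀ hh]; linarith
          have : F y = 0 := indicator_of_notMem (fun hcon => by linarith [hcon.2]) _
          rw [this]
          exact hKd.integral_eq_zero hJ1 hJ0
      rw [hJF, sub_self, abs_zero]
      exact add_nonneg (hψ1 y) (hψ2 y))
  have hψint : ∫ y, ψ y = δ := by
    simp only [ψ]
    rw [integral_add (integrable_indicator_Icc _ _ _) (integrable_indicator_Icc _ _ _),
      integral_indicator_Icc hη0.le, integral_indicator_Icc (by linarith), hη]
    ring
  have hFint : ∫ y in (0 : ℝ)..(0 + N * (1 / N)), F y = w := by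
    have e1 : (0 : ℝ) + N * (1 / N) = 1 := by field_simp; simp
    rw [e1, intervalIntegral.integral_of_le zero_le_one, ← integral_Icc_eq_integral_Ioc,
      setIntegral_indicator measurableSet_Icc, Icc_inter_Icc]
    simp [hw.2, hw.1]
  rw [hψint, hFint] at key
  exact key

end Density

/-! ### The estimator of the shift -/

/-- Needed for the integral defining `ĉ` where its range exceeds the one on which consistency is
known. -/
lemma IsDensityKernel.abs_gHat_le_one {Kd : ℝ → ℝ} (hKd : IsDensityKernel Kd) (x₀ x : ℝ) (N : ℕ)
    {h : ℝ} (hh : 0 < h) (p : ℝ → ℝ) : |gHat x₀ (fHat Kd N h p) x| ≤ 1 := by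
  rw [hKd.gHat_eq _ _ _ hh, abs_mul, abs_of_nonneg (by positivity : (0 : ℝ) ≤ 1 / N)]
  have h1 : |∑ i ∈ Finset.Icc 1 N,
      ∫ y in ((p ((i : ℝ) / N) - x) / h)..((p ((i : ℝ) / N) - x₀) / h), Kd y| ≤ N := by
    refine (Finset.abs_sum_le_sum_abs _ _).trans
      ((Finset.sum_le_sum fun i _ => hKd.abs_integral_le_one _ _).trans ?_)
    simp
  rw [one_div_mul_eq_div]
  exact div_le_one_of_le₀ h1 (by positivity)

lemma intervalIntegrable_of_measurable_of_abs_le {f : ℝ → ℝ} (hf : Measurable f) {B : ℝ}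
    (hB : ∀ u, |f u| ≤ B) (a b : ℝ) : IntervalIntegrable f volume a b := by
  rw [intervalIntegrable_iff]
  refine Measure.integrableOn_of_bounded (M := B) ?_ hf.aestronglyMeasurable
    (Eventually.of_forall hB)
  rw [uIoc]; exact measure_Ioc_lt_top.ne

/-- The plug-in estimator of the shift is continuous in the estimated functions. -/
lemma exists_abs_cHat_sub_le {c : ℝ} (hc0 : 0 ≤ c) (hc1 : c < 1) {w : ℝ → ℝ}
    (hw : IntervalIntegrable w volume 0 (1 - c)) (hw01 : ∀ u ∈ Icc (0 : ℝ) (1 - c), w u ∈ Icc (0 : ℝ) 1)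
    {δ : ℝ} (hδ : 0 < δ) :
    ∃ τ > 0, ∀ q p : ℝ → ℝ, Measurable (fun u => q (p u)) → (∀ u, |q (p u)| ≤ 1) →
      (∀ u ∈ Icc (0 : ℝ) (1 - c), |q (p u) - w u| ≤ τ) → |q (p 0) - c| ≤ τ →
      |cHat q p - 1 / (1 - c) * ∫ u in (0 : ℝ)..(1 - c), (w u - u)| ≤ δ := by
  set l := 1 - c with hl
  have hl0 : 0 < l := by linarith
  -- The first bound keeps the denominator above `l / 2`. The numerator errors are `τ` (integrand),
  -- `3 * τ` (integration limit) and `τ` (normalisation), together at most `δ * l / 2`.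
  refine ⟨min (l / 2) (δ * l / 10), lt_min (by positivity) (by positivity), ?_⟩
  intro q p hmeas hbd hclose hstart
  set τ := min (l / 2) (δ * l / 10) with hτ
  have hτ1 : τ ≤ l / 2 := min_le_left _ _
  have hτ2 : τ ≤ δ * l / 10 := min_le_right _ _
  have hτ0 : 0 < τ := lt_min (by positivity) (by positivity)
  rw [cHat]
  set l' := 1 - q (p 0) with hl'
  have hstart' := abs_le.1 hstart
  have hll : l / 2 ≤ l' := by linarith
  have hl'0 : 0 < l' := by linarith
  have hid : ∀ a b : ℝ, IntervalIntegrable (fun u : ℝ => u) volume a b := fun a b =>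
    intervalIntegral.intervalIntegrable_id
  have hΦ := intervalIntegrable_of_measurable_of_abs_le hmeas hbd
  have hsplit : ∫ u in (0 : ℝ)..l', (q (p u) - u) = (∫ u in (0 : ℝ)..l, (w u - u)) +
      (∫ u in (0 : ℝ)..l, (q (p u) - w u)) + ∫ u in l..l', (q (p u) - u) := by
    rw [← intervalIntegral.integral_add (hw.sub (hid _ _)) ((hΦ _ _).sub hw),
      ← intervalIntegral.integral_add_adjacent_intervals ((hΦ 0 l).sub (hid _ _))
        ((hΦ l l').sub (hid _ _))]
    congr 2
    ext u; ring
  set A := ∫ u in (0 : ℝ)..l, (w u - u) with hA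
  have hAle : |A| ≤ l := by
    have := intervalIntegral.norm_integral_le_of_norm_le_const (a := 0) (b := l)
      (f := fun u => w u - u) (C := 1) (fun u hu => by
        rw [uIoc_of_le hl0.le] at hu
        have := hw01 u ⟨hu.1.le, hu.2⟩
        rw [Real.norm_eq_abs, abs_le]
        constructor <;> linarith [this.1, this.2, hu.1, hu.2])
    rwa [Real.norm_eq_abs, one_mul, sub_zero, abs_of_pos hl0] at this
  have hB : |∫ u in (0 : ℝ)..l, (q (p u) - w u)| ≤ τ := by
    have := intervalIntegral.norm_integral_le_of_norm_le_const (a := 0) (b := l)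
      (f := fun u => q (p u) - w u) (C := τ) (fun u hu => by
        rw [uIoc_of_le hl0.le] at hu
        exact hclose u ⟨hu.1.le, hu.2⟩)
    rw [Real.norm_eq_abs, sub_zero, abs_of_pos hl0] at this
    nlinarith
  have hC : |∫ u in l..l', (q (p u) - u)| ≤ 3 * τ := by
    have := intervalIntegral.norm_integral_le_of_norm_le_const (a := l) (b := l')
      (f := fun u => q (p u) - u) (C := 3) (fun u hu => by
        have h1 : 0 < u := (lt_min hl0 hl'0).trans hu.1
        have h2 : u ≤ 2 := hu.2.trans (max_le (by linarith) (by linarith))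
        have h3 := abs_le.1 (hbd u)
        rw [Real.norm_eq_abs, abs_le]
        constructor <;> linarith)
    rw [Real.norm_eq_abs] at this
    refine this.trans (mul_le_mul_of_nonneg_left ?_ (by norm_num))
    rw [abs_le]; constructor <;> linarith
  rw [hsplit]
  set B := ∫ u in (0 : ℝ)..l, (q (p u) - w u)
  set C := ∫ u in l..l', (q (p u) - u)
  have e : 1 / l' * (A + B + C) - 1 / l * A = (B + C + A * (l - l') / l) / l' := by
    field_simp; ring
  rw [e, abs_div, abs_of_pos hl'0, div_le_iff₀ hl'0]
  have h4 : |A * (l - l') / l| ≤ τ := by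
    rw [abs_div, abs_mul, abs_of_pos hl0, div_le_iff₀ hl0, mul_comm]
    refine mul_le_mul ?_ hAle (abs_nonneg _) hτ0.le
    rw [abs_le]; constructor <;> linarith
  have h5 := abs_add_three B C (A * (l - l') / l)
  have h6 : δ * (l / 2) ≤ δ * l' := mul_le_mul_of_nonneg_left hll hδ.le
  linarith

/-! ### Rates -/

lemma tendsto_eval_atTop_atTop (s : Fin 2) : Tendsto (fun n : Fin 2 → ℕ => n s) atTop atTop :=
  tendsto_atTop.2 fun k => (eventually_ge_atTop fun _ => k).mono fun _ hn => hn s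

namespace BandwidthConditions

variable {b h : Fin 2 → (Fin 2 → ℕ) → ℝ} {N : (Fin 2 → ℕ) → ℕ}

lemma eventually_one_le_log (s : Fin 2) :
    ∀ᶠ n : Fin 2 → ℕ in atTop, 0 < (n s : ℝ) ∧ 1 ≤ Real.log (n s) := by
  filter_upwards [(tendsto_eval_atTop_atTop s).eventually_ge_atTop 3] with n hn
  have h3 : (3 : ℝ) ≤ n s := by exact_mod_cast hn
  refine ⟨by linarith, ?_⟩
  rw [Real.le_log_iff_exp_le (by linarith)]
  linarith [Real.exp_one_lt_d9]

/-- Since `b ≤ ω̄`, the condition on `ω̄ b^(-1/2) log² n` already forces `√b → 0`. -/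
lemma tendsto_b (H : BandwidthConditions b h N) (s : Fin 2) : Tendsto (b s) atTop (𝓝 0) := by
  have key : Tendsto (fun n => Real.sqrt (b s n)) atTop (𝓝 0) := by
    refine squeeze_zero' (Eventually.of_forall fun n => Real.sqrt_nonneg _) ?_ (H.omega_small s)
    filter_upwards [eventually_one_le_log s] with n ⟨hn, hlog⟩
    have hb := H.b_pos s n
    have hsq := Real.sqrt_pos.2 hb
    have e : b s n ^ (-(1 / 2) : ℝ) = 1 / Real.sqrt (b s n) := by
      rw [Real.rpow_neg hb.le, ← Real.sqrt_eq_rpow, one_div]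
    have h1 : b s n ≤ rateOmega (n s) (b s n) := by
      rw [rateOmega]
      have : 0 ≤ Real.log (n s) / (Real.sqrt (n s * b s n) * b s n) +
        (n s : ℝ) ^ (1 / 4 : ℝ) * Real.log (n s) ^ 2 / (n s * b s n ^ 2) := by positivity
      linarith
    calc Real.sqrt (b s n) = b s n * (1 / Real.sqrt (b s n)) * 1 := by
          rw [mul_one_div, Real.div_sqrt, mul_one]
      _ ≤ rateOmega (n s) (b s n) * (1 / Real.sqrt (b s n)) * Real.log (n s) ^ 2 := by
          have : (1 : ℝ) ≤ Real.log (n s) ^ 2 := one_le_pow₀ hlog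
          gcongr
          exact mul_nonneg (hb.le.trans h1) (by positivity)
      _ = _ := by rw [e]
  have := key.pow 2
  simp only [ne_eq, OfNat.ofNat_ne_zero, not_false_eq_true, zero_pow] at this
  exact this.congr fun n => Real.sq_sqrt (H.b_pos s n).le

/-- The stochastic term of `ω̄`, multiplied by `b^(-1/2)`, is at least `1 / (√n b²)` once `log n ≥
1`. -/
lemma eventually_one_le_mul_pow (H : BandwidthConditions b h N) (s : Fin 2) :
    ∀ᶠ n : Fin 2 → ℕ in atTop, 1 ≤ (n s : ℝ) * b s n ^ 4 := by
  filter_upwards [eventually_one_le_log s, (H.omega_small s).eventually_le_const one_pos]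
    with n ⟨hn, hlog⟩ hX
  have hb := H.b_pos s n
  have hsq := Real.sqrt_pos.2 hb
  have hsn := Real.sqrt_pos.2 hn
  have e : b s n ^ (-(1 / 2) : ℝ) = 1 / Real.sqrt (b s n) := by
    rw [Real.rpow_neg hb.le, ← Real.sqrt_eq_rpow, one_div]
  have h1 : 1 / (Real.sqrt (n s * b s n) * b s n) ≤ rateOmega (n s) (b s n) := by
    rw [rateOmega]
    have h2 : 0 ≤ (n s : ℝ) ^ (1 / 4 : ℝ) * Real.log (n s) ^ 2 / (n s * b s n ^ 2) := by positivity
    have h3 : 1 / (Real.sqrt (n s * b s n) * b s n) ≤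
      Real.log (n s) / (Real.sqrt (n s * b s n) * b s n) := by gcongr
    linarith
  have h2 : 1 / (Real.sqrt (n s) * b s n ^ 2) ≤ 1 := by
    calc 1 / (Real.sqrt (n s) * b s n ^ 2)
        = 1 / (Real.sqrt (n s * b s n) * b s n) * (1 / Real.sqrt (b s n)) * 1 := by
          rw [Real.sqrt_mul hn.le]
          have : Real.sqrt (b s n) * Real.sqrt (b s n) = b s n := Real.mul_self_sqrt hb.le
          field_simp
          rw [sq, this]
      _ ≤ rateOmega (n s) (b s n) * (1 / Real.sqrt (b s n)) * Real.log (n s) ^ 2 := by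
          have : (1 : ℝ) ≤ Real.log (n s) ^ 2 := one_le_pow₀ hlog
          have h0 : 0 ≤ rateOmega (n s) (b s n) := le_trans (by positivity) h1
          gcongr
      _ ≤ 1 := by rw [← e]; exact hX
  rw [div_le_one (by positivity)] at h2
  have h3 := one_le_pow₀ (n := 2) h2
  rwa [mul_pow, Real.sq_sqrt hn.le, ← pow_mul] at h3

/-- This places the windows in the range covered by the maximal inequality. -/
lemma eventually_rpow_le (H : BandwidthConditions b h N) (s : Fin 2) :
    ∀ᶠ n : Fin 2 → ℕ in atTop, (n s : ℝ) ^ (3 / 4 : ℝ) ≤ n s * b s n := by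
  filter_upwards [H.eventually_one_le_mul_pow s] with n hn
  have hb := H.b_pos s n
  refine le_of_pow_le_pow_left₀ (n := 4) (by norm_num) (by positivity) ?_
  have e : ((n s : ℝ) ^ (3 / 4 : ℝ)) ^ 4 = (n s : ℝ) ^ 3 := by
    rw [← Real.rpow_natCast, ← Real.rpow_mul (by positivity), ← Real.rpow_natCast]
    norm_num
  rw [e, mul_pow]
  calc (n s : ℝ) ^ 3 = (n s : ℝ) ^ 3 * 1 := (mul_one _).symm
    _ ≤ (n s : ℝ) ^ 3 * (n s * b s n ^ 4) := by gcongr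
    _ = _ := by ring

lemma tendsto_mul (H : BandwidthConditions b h N) (s : Fin 2) :
    Tendsto (fun n : Fin 2 → ℕ => (n s : ℝ) * b s n) atTop atTop :=
  tendsto_atTop_mono' _ (H.eventually_rpow_le s) ((tendsto_rpow_atTop (by norm_num)).comp
    (tendsto_natCast_atTop_atTop.comp (tendsto_eval_atTop_atTop s)))

/-- The prefactor `n b⁴ log n` is eventually at least `1`, so the squared bracket itself tends to
zero. -/
lemma tendsto_h_add (H : BandwidthConditions b h N) (s : Fin 2) :
    Tendsto (fun n => h s n + 1 / (N n * h s n)) atTop (𝓝 0) := by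
  have key : Tendsto (fun n => (h s n + 1 / (N n * h s n)) ^ 2) atTop (𝓝 0) := by
    refine squeeze_zero' (Eventually.of_forall fun n => sq_nonneg _) ?_ (H.nb_four s)
    filter_upwards [eventually_one_le_log s, H.eventually_one_le_mul_pow s] with n ⟨hn, hlog⟩ hnb
    have hb := H.b_pos s n
    have hh := H.h_pos s n
    have h1 : 1 ≤ (n s : ℝ) * b s n ^ 4 * Real.log (n s) := by nlinarith
    have h2 : 0 ≤ ratePi' (n s) (b s n) / b s n := by rw [ratePi']; positivity
    have h3 : 0 ≤ ratePi (n s) (b s n) ^ 3 / h s n ^ 3 := by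
      have : 0 ≤ ratePi (n s) (b s n) := by rw [ratePi]; positivity
      positivity
    refine (le_mul_of_one_le_left (sq_nonneg _) h1).trans ?_
    gcongr
    linarith
  have := (Real.continuous_sqrt.tendsto 0).comp key
  rw [Real.sqrt_zero] at this
  refine this.congr fun n => ?_
  have hh := H.h_pos s n
  exact Real.sqrt_sq (by positivity)

lemma tendsto_h (H : BandwidthConditions b h N) (s : Fin 2) : Tendsto (h s) atTop (𝓝 0) :=
  squeeze_zero (fun n => (H.h_pos s n).le) (fun n => by
    have hh := H.h_pos s n
    have : 0 ≤ 1 / (N n * h s n) := by positivity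
    linarith) (H.tendsto_h_add s)

lemma tendsto_one_div_mul (H : BandwidthConditions b h N) (s : Fin 2) :
    Tendsto (fun n => 1 / (N n * h s n)) atTop (𝓝 0) :=
  squeeze_zero (fun n => by have hh := H.h_pos s n; positivity) (fun n => by
    have hh := H.h_pos s n
    linarith) (H.tendsto_h_add s)

lemma tendsto_one_div (H : BandwidthConditions b h N) :
    Tendsto (fun n => (1 : ℝ) / N n) atTop (𝓝 0) := by
  have := (H.tendsto_one_div_mul 0).mul (H.tendsto_h 0)
  rw [mul_zero] at this
  refine this.congr fun n => ?_
  have hh := H.h_pos 0 n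
  have hN : (0 : ℝ) < N n := by exact_mod_cast H.N_pos n
  field_simp

/-- Each term is a multiple of part of `π_n`: `1 / n ≤ b²` because `n b² ≥ 1`, and the noise term
equals `√2 log n / (√(nb) b)` up to the factor `c`. -/
lemma tendsto_slope_rate (H : BandwidthConditions b h N) (s : Fin 2) (C c : ℝ) (hC : 0 ≤ C)
    (hc : 0 ≤ c) :
    Tendsto (fun n : Fin 2 → ℕ => C * (b s n ^ 2 + 1 / n s + c * (Real.sqrt (2 * (n s * b s n)) *
      Real.log (n s)) / (n s * b s n ^ 2)) / h s n) atTop (𝓝 0) := by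
  have h0 := (H.pi_small s).tendsto_div_nhds_zero.const_mul (C * (2 + c * Real.sqrt 2))
  rw [mul_zero] at h0
  refine squeeze_zero' ?_ ?_ h0
  · filter_upwards [eventually_one_le_log s] with n ⟨hn, hlog⟩
    have hb := H.b_pos s n
    have hh := H.h_pos s n
    positivity
  · filter_upwards [eventually_one_le_log s, (H.nb_sq s).eventually_ge_atTop 1] with n ⟨hn, hlog⟩ hnb
    have hb := H.b_pos s n
    have hh := H.h_pos s n
    rw [← mul_div_assoc, mul_assoc]
    gcongr ?_ / _
    refine mul_le_mul_of_nonneg_left ?_ hC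
    have h1 : 1 / (n s : ℝ) ≤ b s n ^ 2 := by
      rw [div_le_iff₀ hn, mul_comm]; exact hnb
    have hsq := Real.sqrt_pos.2 (mul_pos hn hb)
    have h2 : Real.sqrt (2 * (n s * b s n)) * Real.log (n s) / (n s * b s n ^ 2) =
        Real.sqrt 2 * (Real.log (n s) / (Real.sqrt (n s * b s n) * b s n)) := by
      have e : (n s : ℝ) * b s n ^ 2 = Real.sqrt (n s * b s n) * Real.sqrt (n s * b s n) * b s n := by
        rw [Real.mul_self_sqrt (by positivity)]; ring
      rw [e, Real.sqrt_mul (by norm_num)]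
      field_simp
    have h3 : 0 ≤ (n s : ℝ) ^ (1 / 4 : ℝ) * Real.log (n s) ^ 2 / (n s * b s n ^ 2) := by positivity
    have h4 : 0 ≤ Real.log (n s) / (Real.sqrt (n s * b s n) * b s n) := by positivity
    have h5 : 0 ≤ c * Real.sqrt 2 := by positivity
    rw [mul_div_assoc, h2, ratePi]
    nlinarith [mul_nonneg h5 h3, mul_nonneg h5 (sq_nonneg (b s n))]

end BandwidthConditions

/-! ### Consistency of the slope estimators -/

lemma slopeHat_eq (K : ℝ → ℝ) (n : ℕ) {b : ℝ} (Y : ℕ → ℝ) {u : ℝ} (hu : u ∈ Icc b (1 - b)) :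
    slopeHat K n b Y u = (llArgmin K n b Y u).2 := by
  rw [slopeHat, min_eq_left hu.2, max_eq_right hu.1]

/-- With probability tending to one, the estimated slopes are within `τ h` of the slopes on
`[b, 1 - b]`, and within `τ` on `[0, 1]`. -/
lemma tendsto_measureReal_slope_error {Ω : Type*} [MeasurableSpace Ω] {P : Measure Ω}
    [IsProbabilityMeasure P] {ε : ℤ → Ω → Fin 2 → ℝ} {G : Fin 2 → ℝ → (ℕ → ℝ) → ℝ}
    (herr : LocallyStationary P ε G) {m : Fin 2 → ℝ → ℝ} (hm : ∀ s, IsC21 (m s))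
    {T : Procedure} (hK : IsSmoothingKernel T.K) (hband : BandwidthConditions T.b T.h T.N)
    (s : Fin 2) {τ : ℝ} (hτ : 0 < τ) :
    Tendsto (fun n : Fin 2 → ℕ => P.real {ω | ¬ ((∀ u ∈ Icc (T.b s n) (1 - T.b s n),
        |T.mHat n (obs m G n fun i => ε i ω) s u - slope (m s) u| ≤ τ * T.h s n) ∧
      ∀ u ∈ Icc (0 : ℝ) 1, |T.mHat n (obs m G n fun i => ε i ω) s u - slope (m s) u| ≤ τ)})
      atTop (𝓝 0) := by
  obtain ⟨c, hc, r, hr, hwin⟩ := herr.exists_window_bound s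
  obtain ⟨C, v₀, hC, hll⟩ := hK.exists_abs_llArgmin_sub_le (hm s)
  obtain ⟨D, hD, hDlip⟩ := (hm s).exists_lipschitz
  have hnt := tendsto_eval_atTop_atTop s
  refine squeeze_zero' (Eventually.of_forall fun n => measureReal_nonneg) ?_ (hr.comp hnt)
  have hh0 := hband.tendsto_h s
  have hb0 := hband.tendsto_b s
  have hsum : Tendsto (fun n => τ * T.h s n + D * T.b s n) atTop (𝓝 0) := by
    simpa using (hh0.const_mul τ).add (hb0.const_mul D)
  filter_upwards [hnt.eventually hwin, hband.eventually_rpow_le s,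
    BandwidthConditions.eventually_one_le_log s,
    (hband.tendsto_mul s).eventually_ge_atTop v₀,
    hb0.eventually_le_const (by norm_num : (0 : ℝ) < 1 / 2),
    (hband.tendsto_slope_rate s C c hC.le hc.le).eventually_le_const hτ,
    hsum.eventually_le_const hτ] with n hwin hnb ⟨hn, hlog⟩ hv hb2 hrate hsum
  have hb := hband.b_pos s n
  have hh := hband.h_pos s n
  refine (measureReal_mono ?_).trans (hwin (2 * (n s * T.b s n)) (by nlinarith [mul_pos hn hb]))
  intro ω hω
  by_contra hgood
  refine hω ?_
  simp only [mem_ofPred_eq, not_exists, not_and, not_lt] at hgood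
  rw [div_le_iff₀ hh] at hrate
  have hin : ∀ u ∈ Icc (T.b s n) (1 - T.b s n),
      |T.mHat n (obs m G n fun i => ε i ω) s u - slope (m s) u| ≤ τ * T.h s n := fun u hu => by
    rw [Procedure.mHat, slopeHat_eq _ _ _ hu]
    exact (hll (n s) (T.b s n) _ (fun i => filt G (fun a => ε a ω) s ((i : ℝ) / n s) i) hv hb
      (by positivity) (fun j k hj hk hjk => hgood j k hj hk hjk) u hu _ fun i _ => rfl).trans hrate
  refine ⟨hin, fun u hu => ?_⟩
  -- In the boundary strips the estimator takes its value at `v`, which costs at most a Lipschitz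
  -- constant times `b`.
  set v := max (T.b s n) (min u (1 - T.b s n)) with hvdef
  have hvI : v ∈ Icc (T.b s n) (1 - T.b s n) :=
    ⟨le_max_left _ _, max_le (by linarith) (min_le_right _ _)⟩
  have hmv : T.mHat n (obs m G n fun i => ε i ω) s u = T.mHat n (obs m G n fun i => ε i ω) s v := by
    rw [Procedure.mHat, slopeHat_eq _ _ _ hvI, slopeHat]
  have huv : |v - u| ≤ T.b s n := by
    rw [hvdef, abs_le]
    rcases le_total u (1 - T.b s n) with h1 | h1
    · rw [min_eq_left h1]
      rcases le_total (T.b s n) u with h2 | h2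
      · rw [max_eq_right h2]; constructor <;> linarith
      · rw [max_eq_left h2]; constructor <;> linarith [hu.1]
    · rw [min_eq_right h1, max_eq_right (by linarith)]; constructor <;> linarith [hu.2]
  have hvI1 : v ∈ Icc (0 : ℝ) 1 := ⟨by linarith [hvI.1], by linarith [hvI.2]⟩
  rw [hmv]
  have h1 : |slope (m s) v - slope (m s) u| ≤ D * |v - u| :=
    (hm s).abs_slope_sub_le hDlip.2 hu hvI1
  have e : T.mHat n (obs m G n fun i => ε i ω) s v - slope (m s) u =
    (T.mHat n (obs m G n fun i => ε i ω) s v - slope (m s) v) + (slope (m s) v - slope (m s) u) := by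
    ring
  rw [e]
  refine (abs_add_le _ _).trans ?_
  have h2 : D * |v - u| ≤ D * T.b s n := mul_le_mul_of_nonneg_left huv hD.le
  linarith [hin v hvI]

/-! ### Population quantities -/

section Population

lemma slopeInv_slope {m : ℝ → ℝ} (hmono : StrictMonoOn (slope m) (Icc 0 1)) {u : ℝ}
    (hu : u ∈ Icc (0 : ℝ) 1) : slopeInv m (slope m u) = u :=
  hmono.injOn.leftInvOn_invFunOn hu

lemma slopeInv_mem {m : ℝ → ℝ} {x : ℝ} (hx : x ∈ slope m '' Icc 0 1) : slopeInv m x ∈ Icc (0 : ℝ) 1 :=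
  Function.invFunOn_mem hx

lemma slope_slopeInv {m : ℝ → ℝ} {x : ℝ} (hx : x ∈ slope m '' Icc 0 1) : slope m (slopeInv m x) = x :=
  Function.invFunOn_eq hx

lemma IsC21.mem_image_slope {m : ℝ → ℝ} (hm : IsC21 m) {x u v : ℝ} (hu : u ∈ Icc (0 : ℝ) 1)
    (hv : v ∈ Icc (0 : ℝ) 1) (hux : slope m u ≤ x) (hxv : x ≤ slope m v) :
    x ∈ slope m '' Icc 0 1 := by
  have h := intermediate_value_uIcc
    (hm.continuousOn_slope.mono (uIcc_subset_Icc hu hv)) (Icc_subset_uIcc ⟨hux, hxv⟩)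
  exact image_mono (uIcc_subset_Icc hu hv) h

lemma monotoneOn_slopeInv {m : ℝ → ℝ} (hmono : StrictMonoOn (slope m) (Icc 0 1)) :
    MonotoneOn (slopeInv m) (slope m '' Icc 0 1) := by
  rintro _ ⟨u, hu, rfl⟩ _ ⟨v, hv, rfl⟩ huv
  rw [slopeInv_slope hmono hu, slopeInv_slope hmono hv]
  exact (hmono.le_iff_le hu hv).1 huv

lemma IsC21.hasDerivAt_slope {m : ℝ → ℝ} (hm : IsC21 m) {v : ℝ} (hv : v ∈ Ioo (0 : ℝ) 1) :
    HasDerivAt (slope m) (curv m v) v :=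
  (hm.hasDerivWithinAt_slope ⟨hv.1.le, hv.2.le⟩).hasDerivAt (Icc_mem_nhds hv.1 hv.2)

/-- The derivative of the inverse, where it exists. -/
lemma deriv_slopeInv {m : ℝ → ℝ} (hm : IsC21 m) (hmono : StrictMonoOn (slope m) (Icc 0 1)) {v : ℝ}
    (hv : v ∈ Ioo (0 : ℝ) 1) (hd : DifferentiableAt ℝ (slopeInv m) (slope m v)) :
    0 < curv m v ∧ deriv (slopeInv m) (slope m v) = 1 / curv m v := by
  have h1 := hm.hasDerivAt_slope hv
  -- Differentiating `slopeInv m ∘ slope m = id` gives a product equal to `1`, so the second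
  -- derivative cannot vanish; monotonicity fixes its sign.
  have h2 : HasDerivAt (slopeInv m ∘ slope m) (deriv (slopeInv m) (slope m v) * curv m v) v :=
    hd.hasDerivAt.comp v h1
  have h3 : slopeInv m ∘ slope m =ᶠ[𝓝 v] id := by
    filter_upwards [Icc_mem_nhds hv.1 hv.2] with u hu
    exact slopeInv_slope hmono hu
  have h4 : deriv (slopeInv m) (slope m v) * curv m v = 1 :=
    h2.unique ((hasDerivAt_id v).congr_of_eventuallyEq h3)
  have h5 : 0 ≤ curv m v :=
    (hm.hasDerivWithinAt_slope ⟨hv.1.le, hv.2.le⟩).derivWithin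
      (uniqueDiffOn_Icc zero_lt_one v ⟨hv.1.le, hv.2.le⟩) ▸ hmono.monotoneOn.derivWithin_nonneg
  have h6 : curv m v ≠ 0 := fun h0 => by rw [h0, mul_zero] at h4; exact zero_ne_one h4
  exact ⟨lt_of_le_of_ne h5 h6.symm, by rw [eq_div_iff h6]; exact h4⟩

variable {m : Fin 2 → ℝ → ℝ}

lemma ShiftWellDefined.preShift_mem (hw : ShiftWellDefined m)
    (hmono : ∀ s, StrictMonoOn (slope (m s)) (Icc 0 1)) :
    preShift m ∈ Ico (0 : ℝ) 1 ∧ slope (m 1) (preShift m) = slope (m 0) 0 := by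
  obtain ⟨x, hx, hxe⟩ := hw.start
  have : preShift m = x := by
    rw [preShift, ← hxe]; exact slopeInv_slope (hmono 1) ⟨hx.1, hx.2.le⟩
  rw [this]; exact ⟨hx, hxe⟩

/-- Between `m₁'(0)` and a value in the range of `m₂'`, all values are in the range of `m₂'`. -/
lemma ShiftWellDefined.mem_image (hw : ShiftWellDefined m) (hm : ∀ s, IsC21 (m s)) {x y : ℝ}
    (hy : y ∈ slope (m 1) '' Icc 0 1) (h0 : slope (m 0) 0 ≤ x) (hxy : x ≤ y) :
    x ∈ slope (m 1) '' Icc 0 1 := by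
  obtain ⟨u, hu, hue⟩ := hw.start
  obtain ⟨v, hv, rfl⟩ := hy
  exact (hm 1).mem_image_slope ⟨hu.1, hu.2.le⟩ hv (hue.trans_le h0) hxy

lemma ShiftWellDefined.slope_mem_image (hw : ShiftWellDefined m) (hm : ∀ s, IsC21 (m s))
    (hmono : ∀ s, StrictMonoOn (slope (m s)) (Icc 0 1)) {u : ℝ} (hu : u ∈ Icc 0 (1 - preShift m)) :
    slope (m 0) u ∈ slope (m 1) '' Icc 0 1 := by
  have h1 := (hw.preShift_mem hmono).1
  have h2 : 1 - preShift m ≤ 1 := by linarith [h1.1]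
  exact hw.mem_image hm hw.stop_pre
    ((hmono 0).monotoneOn (by simp) ⟨hu.1, hu.2.trans h2⟩ hu.1)
    ((hmono 0).monotoneOn ⟨hu.1, hu.2.trans h2⟩ ⟨by linarith [h1.2], h2⟩ hu.2)

lemma ShiftWellDefined.intervalIntegrable (hw : ShiftWellDefined m) (hm : ∀ s, IsC21 (m s))
    (hmono : ∀ s, StrictMonoOn (slope (m s)) (Icc 0 1)) :
    IntervalIntegrable (fun u => slopeInv (m 1) (slope (m 0) u)) volume 0 (1 - preShift m) := by
  have h1 := (hw.preShift_mem hmono).1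
  have h2 : 1 - preShift m ≤ 1 := by linarith [h1.1]
  refine MonotoneOn.intervalIntegrable ?_
  rw [uIcc_of_le (by linarith [h1.2])]
  intro u hu v hv huv
  exact monotoneOn_slopeInv (hmono 1) (hw.slope_mem_image hm hmono hu)
    (hw.slope_mem_image hm hmono hv)
    ((hmono 0).monotoneOn ⟨hu.1, hu.2.trans h2⟩ ⟨hv.1, hv.2.trans h2⟩ huv)

/-- The integrand is at most `1 - u`, whose average over `[0, l]` is `1 - l / 2`. -/
lemma ShiftWellDefined.popShift_lt_one (hw : ShiftWellDefined m) (hm : ∀ s, IsC21 (m s))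
    (hmono : ∀ s, StrictMonoOn (slope (m s)) (Icc 0 1)) : popShift m < 1 := by
  have h1 := (hw.preShift_mem hmono).1
  set l := 1 - preShift m with hl
  have hl0 : 0 < l := by linarith [h1.2]
  have hint : ∫ u in (0 : ℝ)..l, (slopeInv (m 1) (slope (m 0) u) - u) ≤ ∫ u in (0 : ℝ)..l, (1 - u) := by
    refine intervalIntegral.integral_mono_on hl0.le
      ((hw.intervalIntegrable hm hmono).sub intervalIntegral.intervalIntegrable_id)
      (by fun_prop : Continuous fun u : ℝ => 1 - u).continuousOn.intervalIntegrable fun u hu => ?_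
    linarith [(slopeInv_mem (hw.slope_mem_image hm hmono hu)).2]
  have hval : ∫ u in (0 : ℝ)..l, (1 - u) = l - l ^ 2 / 2 := by
    rw [intervalIntegral.integral_sub (by simp) intervalIntegral.intervalIntegrable_id]
    simp
  rw [popShift, one_div_mul_eq_div, div_lt_one hl0]
  rw [hval] at hint
  nlinarith

/-- Inside the interval, both inverses take values in `(0,1)`. -/
lemma ShiftWellDefined.slopeInv_mem_Ioo (hw : ShiftWellDefined m) (hm : ∀ s, IsC21 (m s))
    (hmono : ∀ s, StrictMonoOn (slope (m s)) (Icc 0 1)) {t : ℝ}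
    (ht : t ∈ Ioo (slope (m 0) 0) (slope (m 0) (1 - popShift m))) (s : Fin 2) :
    slopeInv (m s) t ∈ Ioo (0 : ℝ) 1 ∧ slope (m s) (slopeInv (m s) t) = t := by
  have hc1 := hw.popShift_lt_one hm hmono
  have hc0 := hw.pos
  obtain ⟨u, hu, v, hv, hut, htv⟩ : ∃ u ∈ Icc (0 : ℝ) 1, ∃ v ∈ Icc (0 : ℝ) 1,
      slope (m s) u < t ∧ t < slope (m s) v := by
    fin_cases s
    · exact ⟨0, by simp, 1 - popShift m, ⟨by linarith, by linarith⟩, ht.1, ht.2⟩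
    · obtain ⟨u, hu, hue⟩ := hw.start
      obtain ⟨v, hv, hve⟩ := hw.stop_pop
      exact ⟨u, ⟨hu.1, hu.2.le⟩, v, hv, hue.trans_lt ht.1, ht.2.trans_le hve.ge⟩
  have him := (hm s).mem_image_slope hu hv hut.le htv.le
  have h1 := slopeInv_mem him
  have h2 := slope_slopeInv him
  have h3 : u < slopeInv (m s) t := ((hmono s).lt_iff_lt hu h1).1 (by rwa [h2])
  have h4 : slopeInv (m s) t < v := ((hmono s).lt_iff_lt h1 hv).1 (by rwa [h2])
  exact ⟨⟨hu.1.trans_lt h3, h4.trans_le hv.2⟩, h2⟩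

lemma IsC21.continuousOn_curv {m : ℝ → ℝ} (hm : IsC21 m) : ContinuousOn (curv m) (Icc 0 1) := by
  obtain ⟨-, C, hC⟩ := hm
  exact hC.continuousOn

lemma ShiftWellDefined.deriv_slopeInv_eq (hw : ShiftWellDefined m) (hm : ∀ s, IsC21 (m s))
    (hmono : ∀ s, StrictMonoOn (slope (m s)) (Icc 0 1)) (hdiff : InvDifferentiable m (popShift m))
    {t : ℝ} (ht : t ∈ Ioo (slope (m 0) 0) (slope (m 0) (1 - popShift m))) (s : Fin 2) :
    0 < curv (m s) (slopeInv (m s) t) ∧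
      deriv (slopeInv (m s)) t = 1 / curv (m s) (slopeInv (m s) t) := by
  obtain ⟨h1, h2⟩ := hw.slopeInv_mem_Ioo hm hmono ht s
  have := deriv_slopeInv (hm s) (hmono s) h1 (by rw [h2]; exact hdiff s t ht)
  rwa [h2] at this

/-- Near `t` the derivative equals `1 / curv` composed with the inverse, and the inverse is
continuous because it is differentiable. -/
lemma ShiftWellDefined.continuousAt_deriv_slopeInv (hw : ShiftWellDefined m) (hm : ∀ s, IsC21 (m s))
    (hmono : ∀ s, StrictMonoOn (slope (m s)) (Icc 0 1)) (hdiff : InvDifferentiable m (popShift m))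
    {t : ℝ} (ht : t ∈ Ioo (slope (m 0) 0) (slope (m 0) (1 - popShift m))) (s : Fin 2) :
    ContinuousAt (deriv (slopeInv (m s))) t := by
  have h1 : ContinuousAt (fun x => 1 / curv (m s) (slopeInv (m s) x)) t := by
    obtain ⟨h1, -⟩ := hw.slopeInv_mem_Ioo hm hmono ht s
    have h2 : ContinuousAt (curv (m s)) (slopeInv (m s) t) :=
      (hm s).continuousOn_curv.continuousAt (Icc_mem_nhds h1.1 h1.2)
    refine continuousAt_const.div (h2.comp (hdiff s t ht).continuousAt) ?_
    exact (hw.deriv_slopeInv_eq hm hmono hdiff ht s).1.ne'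
  refine h1.congr ?_
  filter_upwards [Ioo_mem_nhds ht.1 ht.2] with x hx
  exact (hw.deriv_slopeInv_eq hm hmono hdiff hx s).2.symm

/-! ### The null hypothesis -/

/-- Differentiation gives the identity in the open interval; continuity of both slopes extends it to
the end points, where they are one-sided derivatives. -/
lemma NullHypothesis.slope_eq {c d : ℝ} (h0 : NullHypothesis m c d) (hm : ∀ s, IsC21 (m s)) :
    ∀ u ∈ Icc (0 : ℝ) (1 - c), slope (m 0) u = slope (m 1) (u + c) := by
  obtain ⟨hc, heq⟩ := h0
  have hIoo : EqOn (slope (m 0)) (fun u => slope (m 1) (u + c)) (Ioo 0 (1 - c)) := fun u hu => by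
    have hd0 : HasDerivAt (m 0) (slope (m 0) u) u :=
      ((hm 0).hasDerivWithinAt ⟨hu.1.le, by linarith [hu.2, hc.1]⟩).hasDerivAt
        (Icc_mem_nhds hu.1 (by linarith [hu.2, hc.1]))
    have hd1 : HasDerivAt (m 1) (slope (m 1) (u + c)) (u + c) :=
      ((hm 1).hasDerivWithinAt ⟨by linarith [hu.1, hc.1], by linarith [hu.2]⟩).hasDerivAt
        (Icc_mem_nhds (by linarith [hu.1, hc.1]) (by linarith [hu.2]))
    have h2 : HasDerivAt (fun x => m 1 (x + c) + d) (slope (m 1) (u + c)) u :=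
      (hd1.comp_add_const u c).add_const d
    refine hd0.unique (h2.congr_of_eventuallyEq ?_)
    filter_upwards [Ioo_mem_nhds hu.1 hu.2] with x hx using heq x hx
  have hcl : Icc (0 : ℝ) (1 - c) ⊆ closure (Ioo 0 (1 - c)) := by
    rw [closure_Ioo (by linarith [hc.2])]
  refine EqOn.of_subset_closure hIoo ((hm 0).continuousOn_slope.mono fun u hu => ?_)
    ((hm 1).continuousOn_slope.comp (by fun_prop) fun u hu => ?_) Ioo_subset_Icc_self hcl
  · exact ⟨hu.1, by linarith [hu.2, hc.1]⟩
  · exact ⟨by linarith [hu.1, hc.1], by linarith [hu.2]⟩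

lemma NullHypothesis.preShift_eq {c d : ℝ} (h0 : NullHypothesis m c d) (hm : ∀ s, IsC21 (m s))
    (hmono : ∀ s, StrictMonoOn (slope (m s)) (Icc 0 1)) : preShift m = c := by
  have hc := h0.1
  rw [preShift, h0.slope_eq hm 0 ⟨le_rfl, by linarith [hc.2]⟩, zero_add]
  exact slopeInv_slope (hmono 1) ⟨hc.1.le, hc.2.le⟩

lemma NullHypothesis.popShift_eq {c d : ℝ} (h0 : NullHypothesis m c d) (hm : ∀ s, IsC21 (m s))
    (hmono : ∀ s, StrictMonoOn (slope (m s)) (Icc 0 1)) : popShift m = c := by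
  have hc := h0.1
  have hl : 0 < 1 - c := by linarith [hc.2]
  have : ∫ u in (0 : ℝ)..(1 - c), (slopeInv (m 1) (slope (m 0) u) - u) =
      ∫ _ in (0 : ℝ)..(1 - c), c := by
    refine intervalIntegral.integral_congr fun u hu => ?_
    rw [uIcc_of_le hl.le] at hu
    rw [h0.slope_eq hm u hu, slopeInv_slope (hmono 1) ⟨by linarith [hu.1, hc.1], by linarith [hu.2]⟩]
    ring
  rw [popShift, h0.preShift_eq hm hmono, this, intervalIntegral.integral_const, smul_eq_mul, sub_zero]
  field_simp

lemma NullHypothesis.shiftWellDefined {c d : ℝ} (h0 : NullHypothesis m c d) (hm : ∀ s, IsC21 (m s))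
    (hmono : ∀ s, StrictMonoOn (slope (m s)) (Icc 0 1)) : ShiftWellDefined m := by
  have hc := h0.1
  have h_range : slope (m 0) (1 - c) ∈ slope (m 1) '' Icc 0 1 :=
    ⟨1, by simp, by rw [h0.slope_eq hm (1 - c) ⟨by linarith [hc.2], le_rfl⟩, sub_add_cancel]⟩
  refine ⟨⟨c, ⟨hc.1.le, hc.2⟩, ?_⟩, ?_, ?_, ?_⟩
  · rw [h0.slope_eq hm 0 ⟨le_rfl, by linarith [hc.2]⟩, zero_add]
  · rwa [h0.preShift_eq hm hmono]
  · rw [h0.popShift_eq hm hmono]; exact hc.1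
  · rwa [h0.popShift_eq hm hmono]

/-- The two inverses differ by the constant `c` near `x`, so their derivatives agree. -/
lemma NullHypothesis.gDiff_eq_zero {c d : ℝ} (h0 : NullHypothesis m c d) (hm : ∀ s, IsC21 (m s))
    (hmono : ∀ s, StrictMonoOn (slope (m s)) (Icc 0 1)) {x : ℝ}
    (hx : x ∈ Ioo (slope (m 0) 0) (slope (m 0) (1 - c))) : gDiff m x = 0 := by
  have hc := h0.1
  have : slopeInv (m 1) =ᶠ[𝓝 x] fun y => slopeInv (m 0) y + c := by
    filter_upwards [Ioo_mem_nhds hx.1 hx.2] with y hy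
    have h0m : (0 : ℝ) ∈ Icc (0 : ℝ) 1 := by simp
    have hcm : 1 - c ∈ Icc (0 : ℝ) 1 := ⟨by linarith [hc.2], by linarith [hc.1]⟩
    have him := (hm 0).mem_image_slope h0m hcm hy.1.le hy.2.le
    have h1 := slopeInv_mem him
    have h2 := slope_slopeInv him
    have h3 : slopeInv (m 0) y ≤ 1 - c := ((hmono 0).le_iff_le h1 hcm).1 (by rw [h2]; exact hy.2.le)
    rw [h0.slope_eq hm _ ⟨h1.1, h3⟩] at h2
    conv_lhs => rw [← h2]
    exact slopeInv_slope (hmono 1) ⟨by linarith [h1.1, hc.1], by linarith⟩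
  rw [gDiff, this.deriv_eq, deriv_add_const, sub_self]

end Population

/-! ### Consistency of the procedure -/

namespace Procedure

variable {T : Procedure} {m : Fin 2 → ℝ → ℝ}

/-- The estimated slopes are within `τ h` of the slopes on `[b, 1 - b]` and within `τ` on `[0,1]`. -/
def SlopesWithin (T : Procedure) (m : Fin 2 → ℝ → ℝ) (n : Fin 2 → ℕ) (Y : Fin 2 → ℕ → ℝ) (τ : ℝ) :
    Prop :=
  ∀ s, (∀ u ∈ Icc (T.b s n) (1 - T.b s n), |T.mHat n Y s u - slope (m s) u| ≤ τ * T.h s n) ∧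
    ∀ u ∈ Icc (0 : ℝ) 1, |T.mHat n Y s u - slope (m s) u| ≤ τ

/-- The property `Q` holds for large samples as soon as the estimated slopes are close enough. -/
def ImpliedBySlopes (T : Procedure) (m : Fin 2 → ℝ → ℝ)
    (Q : (Fin 2 → ℕ) → (Fin 2 → ℕ → ℝ) → Prop) : Prop :=
  ∃ τ > 0, ∀ᶠ n in atTop, ∀ Y, T.SlopesWithin m n Y τ → Q n Y

lemma SlopesWithin.mono (hh : ∀ s n, 0 < T.h s n) {n : Fin 2 → ℕ} {Y : Fin 2 → ℕ → ℝ} {τ τ' : ℝ}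
    (h : T.SlopesWithin m n Y τ) (hτ : τ ≤ τ') : T.SlopesWithin m n Y τ' := fun s =>
  ⟨fun u hu => ((h s).1 u hu).trans (mul_le_mul_of_nonneg_right hτ (hh s n).le),
    fun u hu => ((h s).2 u hu).trans hτ⟩

lemma ImpliedBySlopes.mono {Q Q' : (Fin 2 → ℕ) → (Fin 2 → ℕ → ℝ) → Prop}
    (h : T.ImpliedBySlopes m Q) (hQ : ∀ n Y, Q n Y → Q' n Y) : T.ImpliedBySlopes m Q' := by
  obtain ⟨τ, hτ, h⟩ := h
  exact ⟨τ, hτ, h.mono fun n hn Y hY => hQ n Y (hn Y hY)⟩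

lemma ImpliedBySlopes.and (hh : ∀ s n, 0 < T.h s n) {Q Q' : (Fin 2 → ℕ) → (Fin 2 → ℕ → ℝ) → Prop}
    (h : T.ImpliedBySlopes m Q) (h' : T.ImpliedBySlopes m Q') :
    T.ImpliedBySlopes m fun n Y => Q n Y ∧ Q' n Y := by
  obtain ⟨τ, hτ, h⟩ := h
  obtain ⟨τ', hτ', h'⟩ := h'
  refine ⟨min τ τ', lt_min hτ hτ', (h.and h').mono fun n hn Y hY => ?_⟩
  exact ⟨hn.1 Y (hY.mono hh (min_le_left _ _)), hn.2 Y (hY.mono hh (min_le_right _ _))⟩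

lemma ImpliedBySlopes.forall_fin (hh : ∀ s n, 0 < T.h s n) {L : ℕ}
    {Q : Fin L → (Fin 2 → ℕ) → (Fin 2 → ℕ → ℝ) → Prop}
    (h : ∀ l, T.ImpliedBySlopes m (Q l)) : T.ImpliedBySlopes m fun n Y => ∀ l, Q l n Y := by
  induction L with
  | zero => exact ⟨1, one_pos, Eventually.of_forall fun _ _ _ l => l.elim0⟩
  | succ L ih =>
    exact ((h 0).and hh (ih fun l => h l.succ)).mono fun n Y hQ l => Fin.cases hQ.1 hQ.2 l

/-- All randomness enters here. -/
lemma ImpliedBySlopes.tendsto {Ω : Type*} [MeasurableSpace Ω] {P : Measure Ω}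
    [IsProbabilityMeasure P] {ε : ℤ → Ω → Fin 2 → ℝ} {G : Fin 2 → ℝ → (ℕ → ℝ) → ℝ}
    (herr : LocallyStationary P ε G) (hm : ∀ s, IsC21 (m s)) (hK : IsSmoothingKernel T.K)
    (hband : BandwidthConditions T.b T.h T.N) {Q : (Fin 2 → ℕ) → (Fin 2 → ℕ → ℝ) → Prop}
    (h : T.ImpliedBySlopes m Q) :
    Tendsto (fun n => P {ω | Q n (obs m G n fun i => ε i ω)}) atTop (𝓝 1) := by
  obtain ⟨τ, hτ, h⟩ := h
  have h0 := (tendsto_measureReal_slope_error herr hm hK hband 0 hτ).add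
    (tendsto_measureReal_slope_error herr hm hK hband 1 hτ)
  rw [add_zero] at h0
  have h1 := ENNReal.tendsto_ofReal (h0.const_sub 1)
  rw [sub_zero, ENNReal.ofReal_one] at h1
  refine tendsto_of_tendsto_of_tendsto_of_le_of_le' h1 tendsto_const_nhds ?_
    (Eventually.of_forall fun n => prob_le_one)
  filter_upwards [h] with n hn
  set B : Fin 2 → Set Ω := fun s => {ω | ¬ ((∀ u ∈ Icc (T.b s n) (1 - T.b s n),
        |T.mHat n (obs m G n fun i => ε i ω) s u - slope (m s) u| ≤ τ * T.h s n) ∧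
      ∀ u ∈ Icc (0 : ℝ) 1, |T.mHat n (obs m G n fun i => ε i ω) s u - slope (m s) u| ≤ τ)} with hB
  -- Covering the whole space and using subadditivity requires no measurability of the event `Q`.
  have hcover : (univ : Set Ω) ⊆ {ω | Q n (obs m G n fun i => ε i ω)} ∪ (B 0 ∪ B 1) := by
    intro ω _
    by_cases hω : ω ∈ B 0 ∪ B 1
    · exact Or.inr hω
    · left
      rw [mem_union, not_or] at hω
      refine hn _ fun s => ?_
      fin_cases s
      · exact not_not.1 hω.1
      · exact not_not.1 hω.2
  have h2 : 1 ≤ P.real {ω | Q n (obs m G n fun i => ε i ω)} + (P.real (B 0) + P.real (B 1)) := by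
    have h3 := (measureReal_mono (μ := P) hcover).trans (measureReal_union_le _ _)
    rw [probReal_univ] at h3
    linarith [measureReal_union_le (μ := P) (B 0) (B 1)]
  rw [← ofReal_measureReal (measure_ne_top P _)]
  exact ENNReal.ofReal_le_ofReal (by linarith)

/-! ### Consistency of the estimated shift, interval and plotted values -/

lemma impliedBySlopes_aEst (T : Procedure) (m : Fin 2 → ℝ → ℝ) {δ : ℝ} (hδ : 0 < δ) :
    T.ImpliedBySlopes m fun n Y => |T.aEst n Y - slope (m 0) 0| ≤ δ :=
  ⟨δ, hδ, Eventually.of_forall fun _ _ h => (h 0).2 0 (by simp)⟩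

/-- Consistency of `ĝ₂` tolerates a perturbed argument, so `ĝ₂(m̂₁'(u))` converges uniformly on `[0,
1 - preShift m]`; the value at `u = 0` takes care of `c̃`. -/
lemma impliedBySlopes_cEst (hm : ∀ s, IsC21 (m s))
    (hmono : ∀ s, StrictMonoOn (slope (m s)) (Icc 0 1)) (hK : IsSmoothingKernel T.K)
    (hKd : IsDensityKernel T.Kd) (hband : BandwidthConditions T.b T.h T.N)
    (hw : ShiftWellDefined m) {δ : ℝ} (hδ : 0 < δ) :
    T.ImpliedBySlopes m fun n Y => |T.cEst m n Y - popShift m| ≤ δ := by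
  have hpre := (hw.preShift_mem hmono).1
  have hIcc : Icc 0 (1 - preShift m) ⊆ Icc 0 1 := Icc_subset_Icc le_rfl (by linarith [hpre.1])
  obtain ⟨τc, hτc, hc⟩ := exists_abs_cHat_sub_le hpre.1 hpre.2 (hw.intervalIntegrable hm hmono)
    (fun u hu => slopeInv_mem (hw.slope_mem_image hm hmono hu)) hδ
  obtain ⟨τ, hτ, hg⟩ := hKd.exists_abs_gHat_sub_le (hmono 1) (hm 1).continuousOn_slope hτc
  obtain ⟨v₀, hmeas⟩ := hK.exists_measurable_slopeHat
  refine ⟨τ, hτ, ?_⟩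
  filter_upwards [hband.tendsto_one_div.eventually_lt_const hτ,
    (hband.tendsto_h 1).eventually_lt_const hτ, (hband.tendsto_mul 0).eventually_ge_atTop v₀,
    (hband.tendsto_b 0).eventually_le_const (by norm_num : (0 : ℝ) < 1 / 2)] with n hN hh hv hb Y hY
  have hclose : ∀ u ∈ Icc (0 : ℝ) (1 - preShift m),
      |gHat (slope (m 1) 0) (T.fEst n Y 1) (T.mHat n Y 0 u) -
        slopeInv (m 1) (slope (m 0) u)| ≤ τc := fun u hu => by
    have him := hw.slope_mem_image hm hmono hu
    exact hg (T.N n) (T.h 1 n) (slope (m 0) u) _ _ _ (hband.N_pos n) hN (hband.h_pos 1 n) hh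
      (hY 1).2 (slopeInv_mem him) (fun _ => (slope_slopeInv him).ge) (fun _ => (slope_slopeInv him).le)
      ((hY 0).2 u (hIcc hu))
  refine hc _ _ ?_ (fun u => hKd.abs_gHat_le_one _ _ _ (hband.h_pos 1 n) _) hclose ?_
  · exact (hKd.continuous_gHat _ _ (hband.h_pos 1 n) _).measurable.comp
      (hmeas _ _ _ hv (hband.b_pos 0 n) hb)
  · exact hclose 0 ⟨le_rfl, by linarith [hpre.2]⟩

lemma impliedBySlopes_bEst (hm : ∀ s, IsC21 (m s))
    (hmono : ∀ s, StrictMonoOn (slope (m s)) (Icc 0 1)) (hK : IsSmoothingKernel T.K)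
    (hKd : IsDensityKernel T.Kd) (hband : BandwidthConditions T.b T.h T.N)
    (hw : ShiftWellDefined m) {δ : ℝ} (hδ : 0 < δ) :
    T.ImpliedBySlopes m fun n Y => |T.bEst m n Y - slope (m 0) (1 - popShift m)| ≤ δ := by
  have hc1 := hw.popShift_lt_one hm hmono
  have hc0 := hw.pos
  obtain ⟨C, hC, -, hCb⟩ := (hm 0).exists_lipschitz
  -- The last two bounds keep the random point `1 - ĉ` inside `[0, 1]`, where the slope estimate is
  -- controlled.
  set δ' := min (δ / (2 * C)) (min (popShift m) (1 - popShift m)) with hδ'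
  have h1 : δ' ≤ δ / (2 * C) := min_le_left _ _
  have h2 : δ' ≤ popShift m := (min_le_right _ _).trans (min_le_left _ _)
  have h3 : δ' ≤ 1 - popShift m := (min_le_right _ _).trans (min_le_right _ _)
  have hδ'0 : 0 < δ' := lt_min (by positivity) (lt_min hc0 (by linarith))
  have hc := impliedBySlopes_cEst hm hmono hK hKd hband hw hδ'0
  have hs : T.ImpliedBySlopes m fun n Y => ∀ u ∈ Icc (0 : ℝ) 1,
      |T.mHat n Y 0 u - slope (m 0) u| ≤ δ / 2 :=
    ⟨δ / 2, by positivity, Eventually.of_forall fun _ _ h => (h 0).2⟩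
  refine (hc.and hband.h_pos hs).mono fun n Y hQ => ?_
  have hcc := abs_le.1 hQ.1
  have hu : 1 - T.cEst m n Y ∈ Icc (0 : ℝ) 1 := ⟨by linarith, by linarith⟩
  have h4 := (hm 0).abs_slope_sub_le hCb (u := 1 - popShift m) ⟨by linarith, by linarith⟩ hu
  have h5 : C * |1 - T.cEst m n Y - (1 - popShift m)| ≤ δ / 2 := by
    have : |1 - T.cEst m n Y - (1 - popShift m)| ≤ δ / (2 * C) := by
      refine le_trans ?_ h1
      rw [abs_le]; constructor <;> linarith
    calc _ ≤ C * (δ / (2 * C)) := by gcongr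
      _ = δ / 2 := by field_simp
  have h6 := hQ.2 _ hu
  have e : T.bEst m n Y - slope (m 0) (1 - popShift m) =
      (T.mHat n Y 0 (1 - T.cEst m n Y) - slope (m 0) (1 - T.cEst m n Y)) +
        (slope (m 0) (1 - T.cEst m n Y) - slope (m 0) (1 - popShift m)) := by
    rw [bEst]; ring
  rw [e]
  exact (abs_add_le _ _).trans (by linarith)

/-- Local uniform consistency of the estimated difference of the derivatives of the inverses. -/
lemma exists_impliedBySlopes_fEst_sub (hm : ∀ s, IsC21 (m s))
    (hmono : ∀ s, StrictMonoOn (slope (m s)) (Icc 0 1))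
    (hKd : IsDensityKernel T.Kd) (hband : BandwidthConditions T.b T.h T.N)
    (hw : ShiftWellDefined m) (hdiff : InvDifferentiable m (popShift m)) {x : ℝ}
    (hx : x ∈ Ioo (slope (m 0) 0) (slope (m 0) (1 - popShift m))) {δ : ℝ} (hδ : 0 < δ) :
    ∃ κ > 0, T.ImpliedBySlopes m fun n Y => ∀ t, |t - x| < κ →
      |T.fEst n Y 0 t - T.fEst n Y 1 t - gDiff m t| ≤ δ := by
  have hs : ∀ s, ∃ κ > 0, T.ImpliedBySlopes m fun n Y => ∀ t, |t - x| < κ →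
      |T.fEst n Y s t - deriv (slopeInv (m s)) t| ≤ δ / 2 := fun s => by
    obtain ⟨hv, hvx⟩ := hw.slopeInv_mem_Ioo hm hmono hx s
    obtain ⟨hD, hderiv⟩ := hw.deriv_slopeInv_eq hm hmono hdiff hx s
    obtain ⟨κ, hκ, τ, hτ, H⟩ := hKd.exists_abs_fHat_sub_le (hm s) (hmono s) hv hD
      (by positivity : 0 < δ / 4)
    obtain ⟨κ', hκ', hcont⟩ := Metric.continuousAt_iff.1
      (hw.continuousAt_deriv_slopeInv hm hmono hdiff hx s) (δ / 4) (by positivity)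
    refine ⟨min κ κ', lt_min hκ hκ', τ, hτ, ?_⟩
    filter_upwards [(hband.tendsto_one_div_mul s).eventually_lt_const hτ,
      (hband.tendsto_h s).eventually_lt_const hτ, (hband.tendsto_b s).eventually_lt_const hτ]
      with n hN hh hb Y hY t ht
    have h1 := H (T.N n) (T.h s n) (T.b s n) t (T.mHat n Y s) (hband.N_pos n) (hband.h_pos s n) hh hb hN
      (hY s).2 (hY s).1 (by rw [hvx]; exact ht.trans_le (min_le_left _ _))
    have h2 := hcont (x := t) (by rw [Real.dist_eq]; exact ht.trans_le (min_le_right _ _))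
    rw [Real.dist_eq, abs_sub_comm, hderiv] at h2
    have h3 := abs_sub_le (T.fEst n Y s t) (1 / curv (m s) (slopeInv (m s) x))
      (deriv (slopeInv (m s)) t)
    rw [fEst] at h3 ⊢
    linarith
  obtain ⟨κ₀, hκ₀, H₀⟩ := hs 0
  obtain ⟨κ₁, hκ₁, H₁⟩ := hs 1
  refine ⟨min κ₀ κ₁, lt_min hκ₀ hκ₁, (H₀.and hband.h_pos H₁).mono fun n Y hQ t ht => ?_⟩
  have h0 := hQ.1 t (ht.trans_le (min_le_left _ _))
  have h1 := hQ.2 t (ht.trans_le (min_le_right _ _))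
  rw [gDiff]
  rw [abs_le] at h0 h1 ⊢
  constructor <;> linarith

/-- A point outside the closed target interval is eventually not plotted; a point inside it is at
distance at least `η` from the ends of the interval where `g` is defined. -/
lemma impliedBySlopes_point_fixed (hm : ∀ s, IsC21 (m s))
    (hmono : ∀ s, StrictMonoOn (slope (m s)) (Icc 0 1)) (hK : IsSmoothingKernel T.K)
    (hKd : IsDensityKernel T.Kd) (hband : BandwidthConditions T.b T.h T.N)
    (hw : ShiftWellDefined m) (hdiff : InvDifferentiable m (popShift m)) {η : ℝ} (hη : 0 < η)
    {δ : ℝ} (hδ : 0 < δ) (t : ℝ) :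
    T.ImpliedBySlopes m fun n Y => t ∈ Ioo (T.aEst n Y + η) (T.bEst m n Y - η) →
      (t, T.fEst n Y 0 t - T.fEst n Y 1 t) ∈
        band (slope (m 0) 0) (slope (m 0) (1 - popShift m)) η δ (gDiff m) := by
  by_cases ha : t < slope (m 0) 0 + η
  · refine (impliedBySlopes_aEst T m (sub_pos.2 ha)).mono fun n Y h ht => ?_
    linarith [ht.1, (abs_le.1 h).1]
  by_cases hb : slope (m 0) (1 - popShift m) - η < t
  · refine (impliedBySlopes_bEst hm hmono hK hKd hband hw (sub_pos.2 hb)).mono fun n Y h ht => ?_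
    linarith [ht.2, (abs_le.1 h).2]
  rw [not_lt] at ha hb
  obtain ⟨κ, hκ, H⟩ := exists_impliedBySlopes_fEst_sub hm hmono hKd hband hw hdiff
    (x := t) ⟨by linarith, by linarith⟩ hδ
  exact H.mono fun n Y h _ => ⟨⟨ha, hb⟩, h t (by rwa [sub_self, abs_zero])⟩

/-- The random point concentrates at its population position, which is interior, so locally uniform
consistency there applies. -/
lemma impliedBySlopes_point_relative (hm : ∀ s, IsC21 (m s))
    (hmono : ∀ s, StrictMonoOn (slope (m s)) (Icc 0 1)) (hK : IsSmoothingKernel T.K)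
    (hKd : IsDensityKernel T.Kd) (hband : BandwidthConditions T.b T.h T.N)
    (hw : ShiftWellDefined m) (hdiff : InvDifferentiable m (popShift m)) {η : ℝ} (hη : 0 < η)
    (hlt : slope (m 0) 0 + η < slope (m 0) (1 - popShift m) - η)
    {δ : ℝ} (hδ : 0 < δ) {θ : ℝ} (hθ : θ ∈ Ioo (0 : ℝ) 1) :
    T.ImpliedBySlopes m fun n Y =>
      ((1 - θ) * (T.aEst n Y + η) + θ * (T.bEst m n Y - η),
        T.fEst n Y 0 ((1 - θ) * (T.aEst n Y + η) + θ * (T.bEst m n Y - η)) -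
        T.fEst n Y 1 ((1 - θ) * (T.aEst n Y + η) + θ * (T.bEst m n Y - η))) ∈
        band (slope (m 0) 0) (slope (m 0) (1 - popShift m)) η δ (gDiff m) := by
  set a := slope (m 0) 0 with ha
  set b := slope (m 0) (1 - popShift m) with hb
  set x := (1 - θ) * (a + η) + θ * (b - η) with hx
  have hxa : a + η < x := by
    have : x - (a + η) = θ * (b - η - (a + η)) := by rw [hx]; ring
    linarith [mul_pos hθ.1 (sub_pos.2 hlt)]
  have hxb : x < b - η := by
    have : b - η - x = (1 - θ) * (b - η - (a + η)) := by rw [hx]; ring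
    linarith [mul_pos (sub_pos.2 hθ.2) (sub_pos.2 hlt)]
  obtain ⟨κ, hκ, H⟩ := exists_impliedBySlopes_fEst_sub hm hmono hKd hband hw hdiff
    (x := x) ⟨by linarith, by linarith⟩ hδ
  set r := min (κ / 2) (min (x - (a + η)) (b - η - x)) with hr
  have hr0 : 0 < r := lt_min (by positivity) (lt_min (by linarith) (by linarith))
  have hr1 : r ≤ κ / 2 := min_le_left _ _
  have hr2 : r ≤ x - (a + η) := (min_le_right _ _).trans (min_le_left _ _)
  have hr3 : r ≤ b - η - x := (min_le_right _ _).trans (min_le_right _ _)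
  refine ((H.and hband.h_pos (impliedBySlopes_aEst T m hr0)).and hband.h_pos
    (impliedBySlopes_bEst hm hmono hK hKd hband hw hr0)).mono fun n Y hQ => ?_
  obtain ⟨⟨h1, h2⟩, h3⟩ := hQ
  set t := (1 - θ) * (T.aEst n Y + η) + θ * (T.bEst m n Y - η) with ht
  have htx : |t - x| ≤ r := by
    have e : t - x = (1 - θ) * (T.aEst n Y - a) + θ * (T.bEst m n Y - b) := by rw [ht, hx]; ring
    have h4 : 0 ≤ 1 - θ := by linarith [hθ.2]
    rw [e]
    refine (abs_add_le _ _).trans ?_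
    rw [abs_mul, abs_mul, abs_of_nonneg h4, abs_of_pos hθ.1]
    have h5 := mul_le_mul_of_nonneg_left h2 h4
    have h6 := mul_le_mul_of_nonneg_left h3 hθ.1.le
    linarith
  have htx' := abs_le.1 htx
  exact ⟨⟨by simp only; linarith, by simp only; linarith⟩, h1 t (by linarith)⟩

/-- Consistency of the plotted points. -/
theorem pointsInBand_gDiff {Ω : Type*} [MeasurableSpace Ω] {P : Measure Ω}
    [IsProbabilityMeasure P] {ε : ℤ → Ω → Fin 2 → ℝ} {G : Fin 2 → ℝ → (ℕ → ℝ) → ℝ}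
    (herr : LocallyStationary P ε G) (hm : ∀ s, IsC21 (m s))
    (hmono : ∀ s, StrictMonoOn (slope (m s)) (Icc 0 1)) (hK : IsSmoothingKernel T.K)
    (hKd : IsDensityKernel T.Kd) (hband : BandwidthConditions T.b T.h T.N)
    (hw : ShiftWellDefined m) (hdiff : InvDifferentiable m (popShift m)) {η : ℝ} (hη : 0 < η) :
    T.PointsInBand m P ε G η (popShift m) (gDiff m) := by
  refine fun δ hδ L => ⟨fun t => ?_, fun hlt θ hθ => ?_⟩
  · refine ImpliedBySlopes.tendsto (Q := fun n Y => T.points m n Y η t ⊆ _) herr hm hK hband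
      ((ImpliedBySlopes.forall_fin hband.h_pos fun l =>
        impliedBySlopes_point_fixed hm hmono hK hKd hband hw hdiff hη hδ (t l)).mono fun n Y h => ?_)
    rintro _ ⟨l, hl, rfl⟩
    exact h l hl
  · refine ImpliedBySlopes.tendsto
      (Q := fun n Y => T.points m n Y η (T.relPoints m n Y η θ) ⊆ _) herr hm hK hband
      ((ImpliedBySlopes.forall_fin hband.h_pos fun l =>
        impliedBySlopes_point_relative hm hmono hK hKd hband hw hdiff hη hlt hδ (hθ l)).mono
          fun n Y h => ?_)
    rintro _ ⟨l, -, rfl⟩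
    exact h l

lemma PointsInBand.congr {Ω : Type*} [MeasurableSpace Ω] {P : Measure Ω}
    {ε : ℤ → Ω → Fin 2 → ℝ} {G : Fin 2 → ℝ → (ℕ → ℝ) → ℝ} {η c : ℝ} {g g' : ℝ → ℝ} (hη : 0 < η)
    (h : T.PointsInBand m P ε G η c g)
    (hg : EqOn g g' (Ioo (slope (m 0) 0) (slope (m 0) (1 - c)))) :
    T.PointsInBand m P ε G η c g' := by
  have hband : ∀ δ, band (slope (m 0) 0) (slope (m 0) (1 - c)) η δ g =
      band (slope (m 0) 0) (slope (m 0) (1 - c)) η δ g' := fun δ => by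
    ext z
    refine and_congr_right fun hz => ?_
    rw [hg ⟨by linarith [hz.1], by linarith [hz.2]⟩]
  simpa only [PointsInBand, hband] using h

end Procedure

end CurveShift

theorem theorem3p1 {Ω : Type*} [MeasurableSpace Ω] (P : Measure Ω) [IsProbabilityMeasure P]
    (ε : ℤ → Ω → Fin 2 → ℝ) (G : Fin 2 → ℝ → (ℕ → ℝ) → ℝ)
    (herr : CurveShift.LocallyStationary P ε G)
    (m : Fin 2 → ℝ → ℝ) (hm : ∀ s, CurveShift.IsC21 (m s))
    (hmono : ∀ s, StrictMonoOn (CurveShift.slope (m s)) (Icc 0 1))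
    (T : CurveShift.Procedure)
    (hK : CurveShift.IsSmoothingKernel T.K) (hKd : CurveShift.IsDensityKernel T.Kd)
    (hband : CurveShift.BandwidthConditions T.b T.h T.N)
    (η : ℝ) (hη : 0 < η) :
    (CurveShift.ShiftWellDefined m → CurveShift.InvDifferentiable m (CurveShift.popShift m) →
      T.PointsInBand m P ε G η (CurveShift.popShift m) (CurveShift.gDiff m)) ∧
    (∀ c d : ℝ, CurveShift.NullHypothesis m c d → CurveShift.InvDifferentiable m c →
      CurveShift.popShift m = c ∧
      (∀ x ∈ Ioo (CurveShift.slope (m 0) 0) (CurveShift.slope (m 0) (1 - c)),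
        CurveShift.gDiff m x = 0) ∧
      T.PointsInBand m P ε G η c fun _ => 0) := by
  refine ⟨fun hw hdiff => CurveShift.Procedure.pointsInBand_gDiff herr hm hmono hK hKd hband hw hdiff hη,
    fun c d h0 hdiff => ?_⟩
  have hc := h0.popShift_eq hm hmono
  have hg : ∀ x ∈ Ioo (CurveShift.slope (m 0) 0) (CurveShift.slope (m 0) (1 - c)),
      CurveShift.gDiff m x = 0 := fun x hx => h0.gDiff_eq_zero hm hmono hx
  -- Under the null hypothesis `m₁'(1 - c) = m₂'(1)`, so well-definedness of the shift is derived,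
  -- not assumed.
  have h := CurveShift.Procedure.pointsInBand_gDiff herr hm hmono hK hKd hband
    (h0.shiftWellDefined hm hmono) (by rwa [hc]) hη
  rw [hc] at h
  exact ⟨hc, hg, h.congr hη hg⟩
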